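/- Throughout, $z,\sigma_0,\sigma_1$ are points of the Riemann surface of the logarithm, i.e. non-zero complex numbers with a prescribed argument (so that complex powers of them are determined), and $\int_0^{[\eta]}$ denotes integration along the ray from $0$ to $\infty e^{i\eta}$, on which $\arg\tau=\eta$. **Hyperterminants.** For $\operatorname{Re}a>0$ let $$F^{(1)}\left(z;\begin{matrix}a\\ \sigma\end{matrix}\right)=\int_0^{[\pi-\arg\sigma]}\frac{e^{\sigma\tau}\tau^{a-1}}{z-\tau}\,d\tau\qquad(|\arg(\sigma z)|<\pi),$$ continued analytically in $z$ to the whole Riemann surface of the logarithm. Let $$F^{(2)}\left(z;\begin{matrix}N_0+1,&N_1+1\\ \sigma_0,&\sigma_1\end{matrix}\right)=\int_0^{[\eta_0]}\int_0^{[\eta_1]}\frac{e^{\sigma_0\tau_0+\sigma_1\tau_1}\tau_0^{N_0}\tau_1^{N_1}}{(z-\tau_0)(\tau_0-\tau_1)}\,d\tau_1\,d\tau_0\qquad(\eta_0-2\pi<\arg z<\eta_0),$$ again continued analytically in $z$ to the whole Riemann surface of the logarithm. The basic choice of directions is $\eta_j=\pi-\arg\sigma_j$ (then the initial range of $z$ is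 $|\arg(\sigma_0z)|<\pi$, and $0<|\eta_0-\eta_1|<2\pi$ means $0<|\arg\sigma_0-\arg\sigma_1|<2\pi$). More generally any directions with $$|\eta_j-(\pi-\arg\sigma_j)|<\tfrac{\pi}{2}\quad(j=0,1),\qquad 0<|\eta_0-\eta_1|<2\pi$$ are allowed. (For instance, $\eta_j=\pi-\arg\sigma_j+\arg N_j$ when $\operatorname{Re}N_j>0$; these two directions differ modulo $2\pi$ exactly when $\sigma_0N_1/(\sigma_1N_0)$ is not on the positive real axis.) In the flipped function $F^{(2)}\left(z;\begin{matrix}N_1+1,&N_0+1\\ \sigma_1,&\sigma_0\end{matrix}\right)$ each $\sigma_j$ keeps its direction $\eta_j$, the outer integral being the one along $[\eta_1]$, with initial range $\eta_1-2\pi<\arg z<\eta_1$. **Notation.** For $\operatorname{Re}N_0>0$ put $\ell=\ln\left(e^{-\pi i}\sigma_0zN_0^{-1}\right)$, with $\arg N_0\in(-\frac{\pi}{2},\frac{\pi}{2})$, and $i a_0(z)=1+\frac{\sigma_0z}{N_0}=1-e^{\ell}$. Let $\alpha_0=\alpha_0(z)$ be the analytic function of $\ell$ in the strip $|\operatorname{Im}\ell|<2\pi$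 with $$\tfrac12\alpha_0^2=1+\frac{\sigma_0z}{N_0}+\ln\left(e^{-\pi i}\frac{\sigma_0z}{N_0}\right)$$ on the branch $a_0\sim\alpha_0-\frac{i}{3}\alpha_0^2$ as $\ell\to0$. Let $g_0(z)=\frac1{a_0(z)}-\frac1{\alpha_0(z)}$, with its limit value $\frac{i}{3}$ at $\ell=0$. Let $\operatorname{erfc}(x)=\frac{2}{\sqrt\pi}\int_x^\infty e^{-t^2}dt$. Square roots of $N_0$ are principal. **Statement.** For every $\delta>0$ there are constants $C$ and $R>0$, depending only on $\delta$, such that for all $N_0,N_1\in\mathbb C$ with $\operatorname{Re}N_0\ge R$ and $\operatorname{Re}N_1>-1$, all $\sigma_0,\sigma_1$, all directions $\eta_0,\eta_1$ as above, and all $z$ with $\left|\arg\left(e^{-\pi i}\sigma_0zN_0^{-1}\right)\right|\le2\pi-\delta$, $$\begin{aligned}F^{(2)}\left(z;\begin{matrix}N_0+1,&N_1+1\\ \sigma_0,&\sigma_1\end{matrix}\right)={}&\pi i\,e^{\sigma_0z}z^{N_0}\operatorname{erfc}\left(\alpha_0(z)\sqrt{\tfrac12N_0}\right)F^{(1)}\left(z;\begin{matrix}N_1+1\\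 \sigma_1\end{matrix}\right)\\&+i\sqrt{\frac{2\pi}{N_0}}\,g_0(z)\,e^{-\frac12\alpha_0^2(z)N_0}e^{\sigma_0z}z^{N_0}F^{(1)}\left(z;\begin{matrix}N_1+1\\ \sigma_1\end{matrix}\right)\\&-F^{(2)}\left(z;\begin{matrix}N_1+1,&N_0+1\\ \sigma_1,&\sigma_0\end{matrix}\right)+E,\end{aligned}$$ where $$|E|\le C\,|N_0|^{-3/2}\left|e^{-\frac12\alpha_0^2(z)N_0}e^{\sigma_0z}z^{N_0}F^{(1)}\left(z;\begin{matrix}N_1+1\\ \sigma_1\end{matrix}\right)\right|.$$ -/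

import Mathlib

open Complex Set Filter Asymptotics MeasureTheory
open scoped Topology

/-
Points of the Riemann surface of the logarithm are represented by their logarithm:
`Z` stands for the point `z = exp Z` with `arg z = Im Z`, and `z ^ s` is `exp (s * Z)`.
The quantities `σ₀, σ₁` (which are non-zero and carry an argument) are given by
`S₀, S₁` in the same way.
-/

/-- The entire function that agrees with `f` on the set `U` (it is unique when `U` is a
non-empty open set).  In the variable `Z = log z` it is the analytic continuation of `f` to the
whole Riemann surface of the logarithm. -/
noncomputable def entireContinuation (U : Set ℂ) (f : ℂ → ℂ) : ℂ → ℂ :=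
  Classical.epsilon fun F : ℂ → ℂ => Differentiable ℂ F ∧ EqOn F f U

/-- The point `τ = t * exp (i η)` of the ray with direction `η`. -/
noncomputable def rayPoint (η t : ℝ) : ℂ := (t : ℂ) * exp ((η : ℂ) * I)

/-- The power `τ ^ s` at the point `τ = t * exp (i η)`, `t > 0`, with `arg τ = η`. -/
noncomputable def rayPower (η t : ℝ) (s : ℂ) : ℂ := exp (s * ((Real.log t : ℂ) + (η : ℂ) * I))

/-- The integral of `φ (τ) dτ` over the ray from `0` to `∞ * exp (i η)`; the integrand is given as
a function of the parameter `t > 0` of `τ = t * exp (i η)`. -/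
noncomputable def rayIntegral (η : ℝ) (φ : ℝ → ℂ) : ℂ :=
  ∫ t in Ioi (0 : ℝ), φ t * exp ((η : ℂ) * I)

/-- The first hyperterminant
`F⁽¹⁾(z; a; σ) = ∫_0^{[π - arg σ]} exp (σ τ) τ ^ (a - 1) / (z - τ) dτ` for `|arg (σ z)| < π`,
continued analytically in `z`. -/
noncomputable def hyperterminantOne (a S : ℂ) : ℂ → ℂ :=
  entireContinuation {Z | |(S + Z).im| < Real.pi} fun Z =>
    rayIntegral (Real.pi - S.im) fun t =>
      exp (exp S * rayPoint (Real.pi - S.im) t) * rayPower (Real.pi - S.im) t (a - 1) /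
        (exp Z - rayPoint (Real.pi - S.im) t)

/-- The second hyperterminant
`F⁽²⁾(z; a, b; σ₀, σ₁) = ∫_0^{[η₀]} ∫_0^{[η₁]} exp (σ₀ τ₀ + σ₁ τ₁) τ₀ ^ (a - 1) τ₁ ^ (b - 1) /
((z - τ₀) (τ₀ - τ₁)) dτ₁ dτ₀` for `η₀ - 2 π < arg z < η₀`, continued analytically in `z`.
The basic choice of the directions is `η₀ = π - arg σ₀`, `η₁ = π - arg σ₁`, for which the range of
`arg z` is `|arg (σ₀ z)| < π`.  Turning the directions inside the sectors of convergence
`|η_j - (π - arg σ_j)| < π / 2` gives the analytic continuation in `σ₀, σ₁`. -/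
noncomputable def hyperterminantTwo (η₀ η₁ : ℝ) (a b S₀ S₁ : ℂ) : ℂ → ℂ :=
  entireContinuation {Z | |Z.im - η₀ + Real.pi| < Real.pi} fun Z =>
    rayIntegral η₀ fun t₀ => rayIntegral η₁ fun t₁ =>
      exp (exp S₀ * rayPoint η₀ t₀ + exp S₁ * rayPoint η₁ t₁) *
          rayPower η₀ t₀ (a - 1) * rayPower η₁ t₁ (b - 1) /
        ((exp Z - rayPoint η₀ t₀) * (rayPoint η₀ t₀ - rayPoint η₁ t₁))

/-- The complementary error function `erfc x = 2 / √π * ∫_x^∞ exp (-τ ^ 2) dτ` of a complex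
argument, the path being the horizontal half-line that starts at `x`. -/
noncomputable def cerfc (x : ℂ) : ℂ :=
  2 / (Real.sqrt Real.pi : ℂ) * ∫ t in Ioi (0 : ℝ), exp (-(x + (t : ℂ)) ^ 2)

/-- The logarithm `log (exp (-π i) * σ₀ * z / N₀)`, for `Re N₀ > 0` (with the principal value
of `log N₀`). -/
noncomputable def logRatio (N₀ S₀ Z : ℂ) : ℂ := S₀ + Z - Real.pi * I - log N₀

/-- `a₀`, defined by `i a₀ = 1 + σ₀ z / N₀`, in terms of `l = log (exp (-π i) * σ₀ * z / N₀)`. -/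
noncomputable def aZero (l : ℂ) : ℂ := -I * (1 - exp l)

/-- `α₀` in terms of `l = log (exp (-π i) * σ₀ * z / N₀)`: the analytic function on the strip
`|Im l| < 2 π` with `α₀ ^ 2 / 2 = 1 + σ₀ z / N₀ + log (exp (-π i) * σ₀ * z / N₀)` on the branch
`a₀ ∼ α₀ - (i / 3) α₀ ^ 2` at the point `l = 0`, where `α₀` vanishes. -/
noncomputable def alphaZero : ℂ → ℂ :=
  Classical.epsilon fun α : ℂ → ℂ =>
    DifferentiableOn ℂ α {l | |l.im| < 2 * Real.pi} ∧
    (∀ l : ℂ, |l.im| < 2 * Real.pi → α l ^ 2 / 2 = 1 - exp l + l) ∧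
    aZero ~[𝓝 0] fun l => α l - I / 3 * α l ^ 2

/-- `g₀ = 1 / a₀ - 1 / α₀`, with its removable singularity at `l = 0` filled. -/
noncomputable def gZero (l : ℂ) : ℂ :=
  if l = 0 then I / 3 else 1 / aZero l - 1 / alphaZero l

/-! In the variable `Z = log z` every ray becomes a horizontal line and `dτ / (z - τ)` becomes `dW /
(exp (Z - W) - 1)`, so hyperterminants are Cauchy transforms along lines (`cauchyLine`) of
`hyperPhi`. Two facts carry the proof.

The first is an exact connection formula, `hyperterminantTwo_add_flip`: the sum of the second
hyperterminant and its flip is the product of two first hyperterminants. It is partial fractions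
plus Fubini where both double integrals converge, and the identity theorem elsewhere. What remains
is an expansion of the single factor with parameter `N₀ + 1`. The other factor is merely carried
along, which is why the error is relative to it and uniform in `N₁`.

The second is that uniform expansion, `exists_norm_hyperterminantOne_sub_le`. On the line through
the saddle `W = log N + π i - S` the integrand is a constant times `exp (-N * phase u)`, and the
kernel has its pole at `u = l`, the logarithm of the ratio. The pole may approach the saddle `u =
0`. With `tau ^ 2 / 2 = phase` and `tau ∼ l`, the kernel splits as `tau' w / (tau l - tau w)` plus
the regular `regKernel`. After the substitution `t = tau u` the pole term is a Cauchy integral of a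
Gaussian, exactly an `erfc` (`integral_gaussian_div_sub`). The regular term is treated by Laplace's
method (`exists_norm_integral_exp_neg_mul_phase_sub_le`): its leading coefficient is `regKernel l 0
= I * gZero l`.

Uniformity in `l` rests on bounding `regKernel` near the real line (`exists_norm_regKernel_le`),
which needs `tau` to be injective enough on the wide strip (`tau_inj`) and quantitatively open
(`exists_tau_separation`). When the pole lies above the line, the residue gained in the continuation
cancels the jump of the Gaussian integral, so one formula serves on both sides. -/

/-! ### The phase on the strip -/

/-- The phase function `exp l - l - 1`. -/
noncomputable def phase (l : ℂ) : ℂ := exp l - l - 1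

/-- The open strip `|Im l| < 2 π`. -/
def logStrip : Set ℂ := {l | |l.im| < 2 * Real.pi}

theorem isOpen_logStrip : IsOpen logStrip :=
  isOpen_lt (by fun_prop) continuous_const

theorem convex_logStrip : Convex ℝ logStrip := by
  have : logStrip = Complex.imCLM ⁻¹' (Metric.ball (0 : ℝ) (2 * Real.pi)) := by
    ext l; simp [logStrip]
  rw [this]
  exact (convex_ball _ _).linear_preimage (Complex.imCLM : ℂ →L[ℝ] ℝ).toLinearMap

theorem zero_mem_logStrip : (0 : ℂ) ∈ logStrip := by
  simp [logStrip, Real.pi_pos]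

theorem phase_re (l : ℂ) : (phase l).re = Real.exp l.re * Real.cos l.im - l.re - 1 := by
  simp [phase, Complex.exp_re]

theorem phase_im (l : ℂ) : (phase l).im = Real.exp l.re * Real.sin l.im - l.im := by
  simp [phase, Complex.exp_im]

theorem hasDerivAt_phase (l : ℂ) : HasDerivAt phase (exp l - 1) l :=
  ((hasDerivAt_exp l).sub (hasDerivAt_id l)).sub_const 1

theorem differentiable_phase : Differentiable ℂ phase := fun l =>
  (hasDerivAt_phase l).differentiableAt

theorem deriv_phase : deriv phase = fun l => exp l - 1 :=
  funext fun l => (hasDerivAt_phase l).deriv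

theorem phase_zero : phase 0 = 0 := by simp [phase]

/-- Since `sin v < v`, the equation forces `0 < v < π` and `0 < u`. If `cos v ≤ 0` the bound is
immediate. Otherwise `v < tan v` makes `exp u * cos v = v * cot v` less than 1. -/
theorem exp_mul_cos_lt_of_exp_mul_sin_eq {u v : ℝ} (hv : 0 < v) (hv' : v < 2 * Real.pi)
    (h : Real.exp u * Real.sin v = v) : Real.exp u * Real.cos v - u - 1 < 0 := by
  have hsin : 0 < Real.sin v := by
    by_contra hs
    have := mul_nonpos_of_nonneg_of_nonpos (Real.exp_pos u).le (not_lt.1 hs)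
    linarith
  have hvpi : v < Real.pi := by
    by_contra hp
    have : Real.sin (v - Real.pi) < 0 := by rw [Real.sin_sub_pi]; linarith
    have h2 := Real.sin_nonneg_of_nonneg_of_le_pi (x := v - Real.pi) (by linarith) (by linarith)
    linarith
  have hexp : 1 < Real.exp u := by
    by_contra he
    have := mul_le_mul_of_nonneg_right (not_lt.1 he) hsin.le
    have := Real.sin_lt hv
    linarith
  have hu : 0 < u := Real.one_lt_exp_iff.1 hexp
  rcases le_or_gt (Real.cos v) 0 with hc | hc
  · have := mul_nonpos_of_nonneg_of_nonpos (Real.exp_pos u).le hc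
    linarith
  · have hv2 : v < Real.pi / 2 := by
      by_contra hp
      exact absurd (Real.cos_nonpos_of_pi_div_two_le_of_le (not_lt.1 hp) (by linarith))
        (not_le.2 hc)
    have htan := Real.lt_tan hv hv2
    rw [Real.tan_eq_sin_div_cos, lt_div_iff₀ hc] at htan
    have : Real.exp u * Real.cos v * Real.sin v < 1 * Real.sin v := by
      calc _ = v * Real.cos v := by linear_combination Real.cos v * h
        _ < _ := by linarith
    have := lt_of_mul_lt_mul_right this hsin.le
    linarith

/-- Off the real axis the phase avoids `[0, ∞)`. Hence its only zero in the strip is 0, and its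
square root is real only on the real axis. -/
theorem phase_not_nonneg {l : ℂ} (hl : l ∈ logStrip) (h0 : l.im ≠ 0)
    (him : (phase l).im = 0) : (phase l).re < 0 := by
  rw [phase_im] at him
  rw [phase_re]
  have hl' := abs_lt.1 (show |l.im| < 2 * Real.pi from hl)
  rcases lt_or_gt_of_ne h0 with h | h
  · have := exp_mul_cos_lt_of_exp_mul_sin_eq (u := l.re) (v := -l.im) (by linarith) (by linarith)
      (by rw [Real.sin_neg]; linarith)
    rwa [Real.cos_neg] at this
  · exact exp_mul_cos_lt_of_exp_mul_sin_eq h (by linarith) (by linarith)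

theorem phase_ofReal (u : ℝ) : phase u = ((Real.exp u - u - 1 : ℝ) : ℂ) := by
  simp [phase]

theorem phase_ofReal_pos {u : ℝ} (hu : u ≠ 0) : 0 < Real.exp u - u - 1 := by
  have := Real.add_one_lt_exp hu
  linarith

theorem phase_eq_zero {l : ℂ} (hl : l ∈ logStrip) (h : phase l = 0) : l = 0 := by
  by_cases h0 : l.im = 0
  · have hl' : l = (l.re : ℂ) := by apply Complex.ext <;> simp [h0]
    by_contra hne
    have hre : l.re ≠ 0 := fun hr => hne (by rw [hl', hr]; simp)
    rw [hl', phase_ofReal] at h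
    have := phase_ofReal_pos hre
    norm_cast at h
    linarith
  · have := phase_not_nonneg hl h0 (by rw [h]; simp)
    rw [h] at this
    simp at this

/-- A nowhere vanishing holomorphic function on a convex open set has a holomorphic logarithm. -/
theorem Convex.exists_differentiableOn_exp_eq {s : Set ℂ} (hs : Convex ℝ s) (hso : IsOpen s)
    {q : ℂ → ℂ} (hq : DifferentiableOn ℂ q s) (h0 : ∀ l ∈ s, q l ≠ 0) {c : ℂ} (hc : c ∈ s) :
    ∃ L : ℂ → ℂ, DifferentiableOn ℂ L s ∧ (∀ l ∈ s, exp (L l) = q l) ∧ L c = log (q c) := by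
  obtain ⟨g, hg⟩ := hs.exists_forall_hasDerivWithinAt
    (f := fun l => deriv q l / q l) ((hq.deriv hso).div hq h0)
  have hg' : ∀ a ∈ s, HasDerivAt g (deriv q a / q a) a := fun a ha =>
    (hg a ha).hasDerivAt (hso.mem_nhds ha)
  have hq' : ∀ a ∈ s, HasDerivAt q (deriv q a) a := fun a ha =>
    ((hq a ha).differentiableAt (hso.mem_nhds ha)).hasDerivAt
  have hder : ∀ a ∈ s, HasDerivAt (fun l => q l * exp (-g l)) 0 a := by
    intro a ha
    have h0a := h0 a ha
    refine ((hq' a ha).mul (hg' a ha).fun_neg.cexp).congr_deriv ?_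
    field_simp
    ring
  have hconst : ∀ a ∈ s, q a * exp (-g a) = q c * exp (-g c) := fun a ha =>
    hso.is_const_of_deriv_eq_zero hs.isPreconnected
      (fun x hx => (hder x hx).differentiableAt.differentiableWithinAt)
      (fun x hx => (hder x hx).deriv) ha hc
  refine ⟨fun l => g l - g c + log (q c), fun a ha =>
    (((hg' a ha).sub_const _).add_const _).differentiableAt.differentiableWithinAt, ?_, by simp⟩
  intro l hl
  have := hconst l hl
  simp only [exp_add, exp_sub, exp_log (h0 c hc)]
  simp only [exp_neg] at this
  have e1 := exp_ne_zero (g l)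
  have e2 := exp_ne_zero (g c)
  field_simp at this ⊢
  linear_combination -this

/-! ### The branch `tau` of the square root of the phase -/

/-- The origin is a double zero of the phase and its only zero in the strip. Dividing out `l ^ 2`
leaves a nowhere vanishing function on a convex set, so it has a logarithm and hence a square root.
-/
theorem exists_sqrt_two_phase : ∃ t : ℂ → ℂ, DifferentiableOn ℂ t logStrip ∧
    (∀ l ∈ logStrip, t l ^ 2 = 2 * phase l) ∧ HasDerivAt t 1 0 := by
  set q1 := dslope phase 0 with hq1
  set q2 := dslope q1 0 with hq2
  have d1 : Differentiable ℂ q1 := by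
    rw [← differentiableOn_univ, hq1, Complex.differentiableOn_dslope univ_mem]
    exact differentiable_phase.differentiableOn
  have d2 : Differentiable ℂ q2 := by
    rw [← differentiableOn_univ, hq2, Complex.differentiableOn_dslope univ_mem]
    exact d1.differentiableOn
  have h1 : ∀ l, phase l = l * q1 l := fun l => by
    have := sub_smul_dslope phase 0 l
    simpa [phase_zero] using this.symm
  have h10 : q1 0 = 0 := by
    rw [hq1, dslope_same, deriv_phase]; simp
  have h2 : ∀ l, phase l = l ^ 2 * q2 l := fun l => by
    have := sub_smul_dslope q1 0 l
    simp only [sub_zero, smul_eq_mul, h10] at this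
    rw [h1, ← this]; ring
  have d2' : Differentiable ℂ (deriv q2) := by
    have := d2.differentiableOn.deriv isOpen_univ
    exact differentiableOn_univ.1 this
  -- This first derivative of `l ^ 2 * q2 l` is differentiated once more at 0 to find `2 * q2 0 =
  -- 1`, which normalises the logarithm to `L 0 = 0`.
  have hd : ∀ l, exp l - 1 = 2 * l * q2 l + l ^ 2 * deriv q2 l := fun l => by
    have e1 : HasDerivAt phase (2 * l * q2 l + l ^ 2 * deriv q2 l) l := by
      rw [show phase = fun l => l ^ 2 * q2 l from funext h2]
      exact ((hasDerivAt_pow 2 l).mul (d2 l).hasDerivAt).congr_deriv (by simp)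
    exact (hasDerivAt_phase l).unique e1
  have h20 : 2 * q2 0 = 1 := by
    have e1 : HasDerivAt (fun l => exp l - 1) (2 * q2 0) 0 := by
      rw [funext hd]
      exact ((((hasDerivAt_id (0 : ℂ)).const_mul 2).mul (d2 0).hasDerivAt).add
        ((hasDerivAt_pow 2 (0 : ℂ)).mul (d2' 0).hasDerivAt)).congr_deriv (by simp)
    have e2 : HasDerivAt (fun l => exp l - 1) 1 0 := by
      simpa using (hasDerivAt_exp 0).sub_const 1
    exact e1.unique e2
  obtain ⟨L, hL, hLe, hL0⟩ := convex_logStrip.exists_differentiableOn_exp_eq isOpen_logStrip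
    (q := fun l => 2 * q2 l) (d2.const_mul 2).differentiableOn (by
      intro l hl h
      have : q2 l = 0 := by simpa using h
      have hl0 := phase_eq_zero hl (by rw [h2, this, mul_zero])
      rw [hl0] at this
      rw [this] at h20
      simp at h20) zero_mem_logStrip
  have hL0' : L 0 = 0 := by rw [hL0, h20, log_one]
  refine ⟨fun l => l * exp (L l / 2), differentiableOn_id.mul (hL.div_const 2).cexp, ?_, ?_⟩
  · intro l hl
    rw [mul_pow, ← exp_nat_mul]
    push_cast
    rw [mul_div_cancel₀ _ two_ne_zero, hLe l hl, h2]
    ring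
  · have hLd := ((hL 0 zero_mem_logStrip).differentiableAt
      (isOpen_logStrip.mem_nhds zero_mem_logStrip)).hasDerivAt
    exact ((hasDerivAt_id (0 : ℂ)).mul (hLd.div_const 2).cexp).congr_deriv (by simp [hL0'])

/-- The function `I * t` qualifies. Asymptotic equivalence at 0 sees only the leading term, so the
quadratic correction is immaterial and the condition merely selects the sign of the root; both sides
have derivative `I`. -/
theorem alphaZero_spec :
    DifferentiableOn ℂ alphaZero {l | |l.im| < 2 * Real.pi} ∧
    (∀ l : ℂ, |l.im| < 2 * Real.pi → alphaZero l ^ 2 / 2 = 1 - exp l + l) ∧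
    aZero ~[𝓝 0] fun l => alphaZero l - I / 3 * alphaZero l ^ 2 := by
  apply Classical.epsilon_spec (p := fun α : ℂ → ℂ =>
    DifferentiableOn ℂ α {l | |l.im| < 2 * Real.pi} ∧
    (∀ l : ℂ, |l.im| < 2 * Real.pi → α l ^ 2 / 2 = 1 - exp l + l) ∧
    aZero ~[𝓝 0] fun l => α l - I / 3 * α l ^ 2)
  obtain ⟨t, ht, ht2, ht0⟩ := exists_sqrt_two_phase
  have h0 : t 0 = 0 := by
    have := ht2 0 zero_mem_logStrip
    rw [phase_zero] at this
    simpa using this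
  refine ⟨fun l => I * t l, ht.const_mul I, fun l hl => ?_, ?_⟩
  · rw [mul_pow, I_sq, ht2 l hl, phase]; ring
  · have hv : HasDerivAt (fun l => I * t l - I / 3 * (I * t l) ^ 2) I 0 := by
      exact ((ht0.const_mul I).sub (((ht0.const_mul I).pow 2).const_mul (I / 3))).congr_deriv
        (by simp [h0])
    have ha : HasDerivAt aZero I 0 := by
      exact (((hasDerivAt_exp 0).const_sub 1).const_mul (-I)).congr_deriv (by simp)
    have hO : (fun l => I * t l - I / 3 * (I * t l) ^ 2) =Θ[𝓝 0] fun l : ℂ => l - 0 := by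
      have h1 := hv.isTheta_sub I_ne_zero
      have h2 : Tendsto (fun l : ℂ => (l, (0 : ℂ))) (𝓝 0) (𝓝 0 ×ˢ pure 0) :=
        tendsto_id.prodMk tendsto_const_pure
      have h3 := h1.1.comp_tendsto h2
      have h4 := h1.2.comp_tendsto h2
      simp only [Function.comp_def, h0, mul_zero, ne_eq, OfNat.ofNat_ne_zero, not_false_eq_true,
        zero_pow, sub_zero] at h3 h4 ⊢
      exact ⟨h3, h4⟩
    have hd : (aZero - fun l => I * t l - I / 3 * (I * t l) ^ 2) =o[𝓝 0]
        fun l : ℂ => l - 0 := by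
      refine (hasDerivAt_iff_isLittleO.1 (ha.sub hv)).congr_left fun l => ?_
      simp [h0, aZero]
    exact hd.trans_isTheta hO.symm

/-- The function `t = - i α₀`, the square root of `2 (exp l - l - 1)` with `t ∼ l` at the
origin. -/
noncomputable def tau (l : ℂ) : ℂ := -I * alphaZero l

theorem alphaZero_eq (l : ℂ) : alphaZero l = I * tau l := by
  rw [tau, ← mul_assoc]; simp

theorem differentiableOn_tau : DifferentiableOn ℂ tau logStrip :=
  alphaZero_spec.1.const_mul _

theorem tau_sq {l : ℂ} (hl : l ∈ logStrip) : tau l ^ 2 = 2 * phase l := by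
  have := alphaZero_spec.2.1 l hl
  rw [tau, mul_pow, neg_sq, I_sq, phase]
  linear_combination (-2) * this

theorem tau_zero : tau 0 = 0 := by
  have := tau_sq zero_mem_logStrip
  rw [phase_zero] at this
  simpa using this

theorem differentiableAt_tau {l : ℂ} (hl : l ∈ logStrip) : DifferentiableAt ℂ tau l :=
  (differentiableOn_tau l hl).differentiableAt (isOpen_logStrip.mem_nhds hl)

/-- The branch condition read backwards: the difference of the two sides is `o(l)`, so their
derivatives at 0 coincide. -/
theorem hasDerivAt_tau_zero : HasDerivAt tau 1 0 := by
  have hα : HasDerivAt alphaZero (deriv alphaZero 0) 0 :=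
    ((alphaZero_spec.1 0 zero_mem_logStrip).differentiableAt
      (isOpen_logStrip.mem_nhds zero_mem_logStrip)).hasDerivAt
  have hα0 : alphaZero 0 = 0 := by rw [alphaZero_eq, tau_zero, mul_zero]
  set d := deriv alphaZero 0
  have hv : HasDerivAt (fun l => alphaZero l - I / 3 * alphaZero l ^ 2) d 0 := by
    exact (hα.sub ((hα.pow 2).const_mul (I / 3))).congr_deriv (by simp [hα0])
  have ha : HasDerivAt aZero I 0 := by
    exact (((hasDerivAt_exp 0).const_sub 1).const_mul (-I)).congr_deriv (by simp)
  have h1 : (aZero - fun l => alphaZero l - I / 3 * alphaZero l ^ 2) =o[𝓝 0]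
      fun l : ℂ => l - 0 := by
    refine (show IsLittleO _ _ _ from alphaZero_spec.2.2).trans_isBigO ?_
    have := hv.isBigO_sub
    simpa [hα0] using this
  have h2 : HasDerivAt (aZero - fun l => alphaZero l - I / 3 * alphaZero l ^ 2) 0 0 := by
    rw [hasDerivAt_iff_isLittleO]
    refine h1.congr_left fun l => ?_
    simp [hα0, aZero]
  have h3 := (ha.sub hv).unique h2
  have h4 : d = I := by linear_combination -h3
  have := hα.const_mul (-I)
  rw [h4] at this
  exact this.congr_deriv (by simp)

theorem mem_logStrip {l : ℂ} : l ∈ logStrip ↔ |l.im| < 2 * Real.pi := Iff.rfl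

theorem ofReal_mem_logStrip (u : ℝ) : (u : ℂ) ∈ logStrip := by
  simp [mem_logStrip, Real.pi_pos]

theorem mem_logStrip_of_abs_im_le_one {w : ℂ} (hw : |w.im| ≤ 1) : w ∈ logStrip := by
  rw [mem_logStrip]
  linarith [Real.pi_gt_three]

theorem tau_im_ne_zero {l : ℂ} (hl : l ∈ logStrip) (h0 : l.im ≠ 0) : (tau l).im ≠ 0 := by
  intro h
  have h2 := tau_sq hl
  have hre := congrArg re h2
  have him := congrArg im h2
  simp [pow_two, h] at hre him
  have := phase_not_nonneg hl h0 him
  nlinarith [mul_self_nonneg (tau l).re]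

theorem tau_ofReal_im (u : ℝ) : (tau u).im = 0 := by
  have h2 := tau_sq (ofReal_mem_logStrip u)
  rw [phase_ofReal] at h2
  have hre := congrArg re h2
  have him := congrArg im h2
  simp only [pow_two, mul_re, mul_im, ofReal_re, ofReal_im, re_ofNat, im_ofNat] at hre him
  have hp : 0 ≤ Real.exp u - u - 1 := by linarith [Real.add_one_le_exp u]
  have h3 : (tau u).re * (tau u).im = 0 := by linarith
  rcases mul_eq_zero.1 h3 with h | h
  · rw [h] at hre
    have : (tau u).im * (tau u).im ≤ 0 := by linarith
    exact mul_self_eq_zero.1 (le_antisymm this (mul_self_nonneg _))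
  · exact h

/-- The restriction of `tau` to the real line. -/
noncomputable def tauReal (u : ℝ) : ℝ := (tau u).re

theorem tau_ofReal (u : ℝ) : tau u = tauReal u := by
  apply Complex.ext <;> simp [tauReal, tau_ofReal_im]

theorem tauReal_sq (u : ℝ) : tauReal u ^ 2 = 2 * (Real.exp u - u - 1) := by
  have := tau_sq (ofReal_mem_logStrip u)
  rw [phase_ofReal, tau_ofReal] at this
  exact_mod_cast this

theorem hasDerivAt_tau {l : ℂ} (hl : l ∈ logStrip) : HasDerivAt tau (deriv tau l) l :=
  (differentiableAt_tau hl).hasDerivAt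

theorem tau_mul_deriv {l : ℂ} (hl : l ∈ logStrip) : tau l * deriv tau l = exp l - 1 := by
  have h1 : HasDerivAt (fun l => tau l ^ 2) (2 * (tau l * deriv tau l)) l :=
    ((hasDerivAt_tau hl).pow 2).congr_deriv (by push_cast; ring)
  have h2 : HasDerivAt (fun l => tau l ^ 2) (2 * (exp l - 1)) l := by
    refine ((hasDerivAt_phase l).const_mul 2).congr_of_eventuallyEq ?_
    filter_upwards [isOpen_logStrip.mem_nhds hl] with x hx using tau_sq hx
  exact mul_left_cancel₀ two_ne_zero (h1.unique h2)

theorem exp_ne_one_of_mem_logStrip {l : ℂ} (hl : l ∈ logStrip) (h0 : l ≠ 0) : exp l ≠ 1 := by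
  intro h
  obtain ⟨n, hn⟩ := Complex.exp_eq_one_iff.1 h
  rw [mem_logStrip, hn] at hl
  simp only [mul_im, intCast_re, intCast_im, re_ofNat, im_ofNat, ofReal_re, ofReal_im, I_re, I_im,
    mul_re, mul_zero, sub_zero, mul_one, zero_mul, add_zero] at hl
  rw [abs_mul, abs_of_pos (by positivity : 0 < 2 * Real.pi)] at hl
  have h1 : |(n : ℝ)| < 1 := by
    by_contra hc
    nlinarith [Real.pi_pos, not_lt.1 hc]
  have h2 : n = 0 := Int.abs_lt_one_iff.1 (by exact_mod_cast h1)
  exact h0 (by rw [hn, h2]; simp)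

theorem deriv_tau_zero : deriv tau 0 = 1 := hasDerivAt_tau_zero.deriv

theorem deriv_tau_ne_zero {l : ℂ} (hl : l ∈ logStrip) : deriv tau l ≠ 0 := by
  by_cases h0 : l = 0
  · rw [h0, deriv_tau_zero]; exact one_ne_zero
  · intro h
    have := tau_mul_deriv hl
    rw [h, mul_zero] at this
    exact exp_ne_one_of_mem_logStrip hl h0 (by linear_combination -this)

theorem tau_ne_zero {l : ℂ} (hl : l ∈ logStrip) (h0 : l ≠ 0) : tau l ≠ 0 := by
  intro h
  have := tau_mul_deriv hl
  rw [h, zero_mul] at this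
  exact exp_ne_one_of_mem_logStrip hl h0 (by linear_combination -this)

theorem differentiableOn_deriv_tau : DifferentiableOn ℂ (deriv tau) logStrip :=
  differentiableOn_tau.deriv isOpen_logStrip

theorem hasDerivAt_deriv_tau {l : ℂ} (hl : l ∈ logStrip) :
    HasDerivAt (deriv tau) (deriv (deriv tau) l) l :=
  ((differentiableOn_deriv_tau l hl).differentiableAt (isOpen_logStrip.mem_nhds hl)).hasDerivAt

theorem hasDerivAt_tauReal (u : ℝ) : HasDerivAt tauReal (deriv tau u).re u :=
  (hasDerivAt_tau (ofReal_mem_logStrip u)).real_of_complex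

theorem deriv_tau_ofReal_im (u : ℝ) : (deriv tau u).im = 0 := by
  by_cases hu : u = 0
  · simp [hu, deriv_tau_zero]
  · have h := tau_mul_deriv (ofReal_mem_logStrip u)
    have hne := tau_ne_zero (ofReal_mem_logStrip u) (by exact_mod_cast hu)
    rw [tau_ofReal] at h hne
    have him := congrArg im h
    rw [← ofReal_exp] at him
    simp only [mul_im, ofReal_re, ofReal_im, zero_mul, add_zero, sub_im, one_im, sub_zero] at him
    rcases mul_eq_zero.1 him with h | h
    · rw [h] at hne; simp at hne
    · exact h

theorem deriv_tau_ofReal (u : ℝ) : deriv tau u = ((deriv tau u).re : ℂ) := by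
  apply Complex.ext <;> simp [deriv_tau_ofReal_im]

theorem continuous_deriv_tau_ofReal : Continuous fun u : ℝ => deriv tau u :=
  differentiableOn_deriv_tau.continuousOn.comp_continuous continuous_ofReal ofReal_mem_logStrip

/-- On the real axis the derivative is real, continuous, never zero and equal to 1 at the origin, so
it cannot change sign. -/
theorem deriv_tau_ofReal_re_pos (u : ℝ) : 0 < (deriv tau u).re := by
  by_contra h
  have hc : Continuous fun u : ℝ => (deriv tau u).re :=
    continuous_re.comp continuous_deriv_tau_ofReal
  obtain ⟨x, hx⟩ := mem_range_of_exists_le_of_exists_ge hc ⟨u, not_lt.1 h⟩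
    ⟨0, by simp [deriv_tau_zero]⟩
  apply deriv_tau_ne_zero (ofReal_mem_logStrip x)
  rw [deriv_tau_ofReal]
  exact_mod_cast hx

theorem tauReal_strictMono : StrictMono tauReal :=
  strictMono_of_hasDerivAt_pos hasDerivAt_tauReal deriv_tau_ofReal_re_pos

theorem continuous_tauReal : Continuous tauReal :=
  continuous_iff_continuousAt.2 fun u => (hasDerivAt_tauReal u).continuousAt

theorem tauReal_zero : tauReal 0 = 0 := by simp [tauReal, tau_zero]

/-- With strict monotonicity this makes `t = tau u` a bijective change of variables of the line,
under which `exp (-N * phase u)` becomes a full Gaussian. -/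
theorem tauReal_surjective : Function.Surjective tauReal := by
  have h1 : Tendsto (fun u : ℝ => 2 * (Real.exp u - u - 1)) atTop atTop := by
    refine tendsto_atTop_mono' (f₁ := fun u : ℝ => u ^ 2) atTop ?_ (tendsto_pow_atTop two_ne_zero)
    filter_upwards [eventually_ge_atTop 0] with u hu
    linarith [Real.quadratic_le_exp_of_nonneg hu]
  have h2 : Tendsto (fun u : ℝ => 2 * (Real.exp u - u - 1)) atBot atTop := by
    refine tendsto_atTop_mono (f := fun u : ℝ => 2 * (-u + -1)) (fun u => ?_) ?_
    · linarith [Real.exp_pos u]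
    · exact (tendsto_atTop_add_const_right _ _ tendsto_neg_atBot_atTop).const_mul_atTop two_pos
  apply continuous_tauReal.surjective
  · refine (Real.tendsto_sqrt_atTop.comp h1).congr' ?_
    filter_upwards [eventually_ge_atTop 0] with u hu
    have : 0 ≤ tauReal u := by
      rw [← tauReal_zero]; exact tauReal_strictMono.monotone hu
    simp only [Function.comp_apply]
    rw [← tauReal_sq, Real.sqrt_sq this]
  · refine (tendsto_neg_atTop_atBot.comp (Real.tendsto_sqrt_atTop.comp h2)).congr' ?_
    filter_upwards [eventually_le_atBot 0] with u hu
    have : tauReal u ≤ 0 := by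
      rw [← tauReal_zero]; exact tauReal_strictMono.monotone hu
    simp only [Function.comp_apply]
    rw [← tauReal_sq, Real.sqrt_sq_eq_abs, abs_of_nonpos this, neg_neg]

/-! ### Half-planes and injectivity of `tau` -/

theorem norm_tau_sub_le_near_zero : ∀ᶠ l : ℂ in 𝓝 0, ‖tau l - l‖ ≤ 1 / 2 * ‖l‖ := by
  have h := hasDerivAt_iff_isLittleO.1 hasDerivAt_tau_zero
  have := h.def (show (0 : ℝ) < 1 / 2 by norm_num)
  filter_upwards [this] with l hl
  simpa [tau_zero] using hl

theorem exists_small_tau_im {e : ℝ} (he : |e| = 1) : ∃ s : ℝ, 0 < s ∧ s < 1 ∧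
    0 < e * (tau (((s * e : ℝ) : ℂ) * I)).im := by
  have h1 : Tendsto (fun s : ℝ => ((s * e : ℝ) : ℂ) * I) (𝓝 0) (𝓝 0) := by
    have : Continuous fun s : ℝ => ((s * e : ℝ) : ℂ) * I := by fun_prop
    simpa using this.tendsto 0
  have h2 := (h1.eventually norm_tau_sub_le_near_zero)
  have h3 : ∀ᶠ s : ℝ in 𝓝[>] 0, 0 < s ∧ s < 1 := by
    filter_upwards [Ioo_mem_nhdsGT (show (0 : ℝ) < 1 by norm_num)] with s hs using hs
  obtain ⟨s, hs, h0, h1⟩ := ((h2.filter_mono nhdsWithin_le_nhds).and h3).exists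
  refine ⟨s, h0, h1, ?_⟩
  have h4 := (abs_im_le_norm _).trans hs
  have he2 : e * e = 1 := by rw [← abs_mul_abs_self, he, one_mul]
  simp only [sub_im, mul_im, ofReal_re, ofReal_im, I_re, I_im, mul_one, mul_zero, add_zero,
    norm_mul, norm_real, norm_I, Real.norm_eq_abs, he, abs_of_pos h0] at h4
  have h5 : |e * (tau (((s * e : ℝ) : ℂ) * I)).im - s| ≤ 1 / 2 * s := by
    calc _ = |e * ((tau (((s * e : ℝ) : ℂ) * I)).im - s * e)| := by
          congr 1; linear_combination (s) * he2
      _ ≤ _ := by rw [abs_mul, he, one_mul]; exact h4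
  linarith [(abs_le.1 h5).1]

/-- Each half of the strip is convex and `Im tau` has no zero there, so its sign is constant; near
the origin `tau l ∼ l` reveals it. The sign `e = ±1` treats both halves at once. -/
theorem tau_im_sign {e : ℝ} (he : |e| = 1) {l : ℂ} (hl : l ∈ logStrip) (h0 : 0 < e * l.im) :
    0 < e * (tau l).im := by
  obtain ⟨s, hs0, hs1, hs⟩ := exists_small_tau_im he
  have he2 : e * e = 1 := by rw [← abs_mul_abs_self, he, one_mul]
  have hconv : Convex ℝ (logStrip ∩ {l : ℂ | 0 < e * l.im}) := by
    refine convex_logStrip.inter ?_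
    have : {l : ℂ | 0 < e * l.im} = (e • Complex.imCLM : ℂ →L[ℝ] ℝ) ⁻¹' Ioi 0 := by
      ext l; simp
    rw [this]
    exact (convex_Ioi _).linear_preimage (e • Complex.imCLM : ℂ →L[ℝ] ℝ).toLinearMap
  by_contra hneg
  have hcont : ContinuousOn (fun l => e * (tau l).im) (logStrip ∩ {l : ℂ | 0 < e * l.im}) :=
    (continuous_im.comp_continuousOn (differentiableOn_tau.continuousOn.mono
      inter_subset_left)).const_mul _ |>.congr fun _ _ => rfl
  have hmem : ((s * e : ℝ) : ℂ) * I ∈ logStrip ∩ {l : ℂ | 0 < e * l.im} := by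
    refine ⟨mem_logStrip_of_abs_im_le_one ?_, ?_⟩
    · simp [abs_mul, he, abs_of_pos hs0, hs1.le]
    · simp only [mem_ofPred_eq, mul_im, ofReal_re, ofReal_im, I_re, I_im, mul_one, mul_zero,
        add_zero]
      nlinarith
  obtain ⟨x, hx, hx0⟩ := hconv.isPreconnected.intermediate_value (a := l) ⟨hl, h0⟩ hmem hcont
    (show (0 : ℝ) ∈ Icc _ _ from ⟨not_lt.1 hneg, hs.le⟩)
  have hxim : x.im ≠ 0 := fun h => by
    have := hx.2
    simp [h] at this
  have hne : e ≠ 0 := fun h => by simp [h] at he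
  exact tau_im_ne_zero hx.1 hxim ((mul_eq_zero.1 hx0).resolve_left hne)

theorem tau_im_pos {l : ℂ} (hl : l ∈ logStrip) (h0 : 0 < l.im) : 0 < (tau l).im := by
  simpa using tau_im_sign (e := 1) (by simp) hl (by simpa using h0)

theorem tau_im_neg {l : ℂ} (hl : l ∈ logStrip) (h0 : l.im < 0) : (tau l).im < 0 := by
  simpa using tau_im_sign (e := -1) (by simp) hl (by simpa using h0)

/-- The derivative `exp l - 1` has positive imaginary part for `0 < Im l < π`. Rolle's theorem on
the segment, applied to the imaginary part of the phase times the conjugate of `l - w`, would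
produce a zero of `Im (exp - 1) * |l - w| ^ 2`. -/
theorem phase_injOn_upper {l w : ℂ} (hl : 0 < l.im) (hl' : l.im < Real.pi) (hw : 0 < w.im)
    (hw' : w.im < Real.pi) (h : phase l = phase w) : l = w := by
  by_contra hne
  have hγ : ∀ s : ℝ, HasDerivAt (fun s : ℝ => w + (s : ℂ) * (l - w)) (l - w) s := fun s => by
    simpa using ((ofRealCLM.hasDerivAt (x := s)).mul_const (l - w)).const_add w
  have hf : ∀ s : ℝ, HasDerivAt
      (fun s : ℝ => (phase (w + (s : ℂ) * (l - w)) * (starRingEnd ℂ) (l - w)).im)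
      ((exp (w + (s : ℂ) * (l - w)) - 1) * (l - w) * (starRingEnd ℂ) (l - w)).im s := fun s => by
    have h1 := (((hasDerivAt_phase _).comp s (hγ s)).mul_const ((starRingEnd ℂ) (l - w)))
    exact (imCLM.hasFDerivAt.comp_hasDerivAt s h1)
  obtain ⟨s, hs, hs0⟩ := exists_hasDerivAt_eq_zero (a := (0 : ℝ)) (b := 1) zero_lt_one
    (continuous_iff_continuousAt.2 fun s => (hf s).continuousAt).continuousOn
    (by simp [h]) fun s _ => hf s
  rw [mul_assoc, mul_conj] at hs0
  have him : (w + (s : ℂ) * (l - w)).im = (1 - s) * w.im + s * l.im := by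
    simp; ring
  have hpos : 0 < (w + (s : ℂ) * (l - w)).im := by
    rw [him]; have := mul_pos hs.1 hl; have := mul_pos (sub_pos.2 hs.2) hw; linarith
  have hlt : (w + (s : ℂ) * (l - w)).im < Real.pi := by
    rw [him]
    have := mul_lt_mul_of_pos_left hl' hs.1
    have := mul_lt_mul_of_pos_left hw' (sub_pos.2 hs.2)
    linarith
  have hsin := Real.sin_pos_of_pos_of_lt_pi hpos hlt
  simp only [mul_im, ofReal_re, ofReal_im, mul_zero, zero_add, sub_im, one_im, sub_zero,
    exp_im] at hs0
  have hn : 0 < normSq (l - w) := normSq_pos.2 (sub_ne_zero.2 hne)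
  have := mul_pos (mul_pos (Real.exp_pos (w + (s : ℂ) * (l - w)).re) hsin) hn
  linarith

theorem phase_conj (l : ℂ) : phase ((starRingEnd ℂ) l) = (starRingEnd ℂ) (phase l) := by
  simp [phase, exp_conj]

/-- If `π ≤ Im l < 2 π` the sine is nonpositive and `Im (phase l) ≤ -π`, whereas `Im (phase w) >
-π`. So only the lower half of this range can compete with `w`. -/
theorem phase_inj_upper {l w : ℂ} (hl : 0 < l.im) (hl' : l.im < 2 * Real.pi) (hw : 0 < w.im)
    (hw' : w.im < Real.pi) (h : phase l = phase w) : l = w := by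
  rcases lt_or_ge l.im Real.pi with hlp | hlp
  · exact phase_injOn_upper hl hlp hw hw' h
  · exfalso
    have h1 := congrArg im h
    rw [phase_im, phase_im] at h1
    have h2 : 0 ≤ Real.sin (l.im - Real.pi) :=
      Real.sin_nonneg_of_nonneg_of_le_pi (by linarith) (by linarith)
    rw [Real.sin_sub_pi] at h2
    have h3 := Real.sin_pos_of_pos_of_lt_pi hw hw'
    have := mul_nonneg (Real.exp_pos l.re).le h2
    have := mul_pos (Real.exp_pos w.re) h3
    linarith

/-- Equal `tau` means equal phase, and the sign of `Im tau` tells which half of the strip each point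
lies in. The asymmetric hypotheses suit the application: `l` is the pole, anywhere in the strip, and
`w` stays near the real line. -/
theorem tau_inj {l w : ℂ} (hl : l ∈ logStrip) (hw : |w.im| < Real.pi) (h : tau l = tau w) :
    l = w := by
  have hw2 : w ∈ logStrip := by
    rw [mem_logStrip]; linarith [Real.pi_pos]
  have hp : phase l = phase w := by
    have h1 := tau_sq hl
    rw [h, tau_sq hw2] at h1
    exact (mul_left_cancel₀ two_ne_zero h1).symm
  have hl' := abs_lt.1 (mem_logStrip.1 hl)
  have hw' := abs_lt.1 hw
  rcases lt_trichotomy w.im 0 with h0 | h0 | h0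
  · have hlim : l.im < 0 := by
      by_contra hc
      have h1 := tau_im_neg hw2 h0
      rw [← h] at h1
      rcases (not_lt.1 hc).lt_or_eq with h2 | h2
      · linarith [tau_im_pos hl h2]
      · rw [show l = (l.re : ℂ) by apply Complex.ext <;> simp [← h2], tau_ofReal_im] at h1
        exact lt_irrefl _ h1
    have := phase_inj_upper (l := (starRingEnd ℂ) l) (w := (starRingEnd ℂ) w) (by simpa)
      (by rw [conj_im]; linarith) (by simpa) (by rw [conj_im]; linarith)
      (by rw [phase_conj, phase_conj, hp])
    exact (starRingEnd ℂ).injective this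
  · have hwr : w = (w.re : ℂ) := by apply Complex.ext <;> simp [h0]
    have hlim : l.im = 0 := by
      by_contra hc
      apply tau_im_ne_zero hl hc
      rw [h, hwr, tau_ofReal_im]
    have hlr : l = (l.re : ℂ) := by apply Complex.ext <;> simp [hlim]
    rw [hwr, hlr, tau_ofReal, tau_ofReal] at h
    rw [hwr, hlr, tauReal_strictMono.injective (ofReal_injective h)]
  · have hlim : 0 < l.im := by
      by_contra hc
      have h1 := tau_im_pos hw2 h0
      rw [← h] at h1
      rcases (not_lt.1 hc).lt_or_eq with h2 | h2
      · linarith [tau_im_neg hl h2]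
      · rw [show l = (l.re : ℂ) by apply Complex.ext <;> simp [h2], tau_ofReal_im] at h1
        exact lt_irrefl _ h1
    exact phase_inj_upper hlim hl'.2 h0 hw'.2 hp

/-! ### Uniform lower bounds -/

/-- For `|Re x| ≤ 1` compactness gives a positive minimum, since 0 is the only zero of `exp - 1` in
the strip. For `|Re x| > 1` one of the two terms dominates and the constant 1/4 suffices. -/
theorem exists_le_norm_exp_sub_one {r d : ℝ} (hr : 0 < r) (hd : 0 < d) :
    ∃ c : ℝ, 0 < c ∧ ∀ x : ℂ, |x.im| ≤ 2 * Real.pi - d → r ≤ ‖x‖ →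
      c * (1 + Real.exp x.re) ≤ ‖exp x - 1‖ := by
  set K : Set ℂ := (Icc (-1) 1 ×ℂ Icc (-(2 * Real.pi - d)) (2 * Real.pi - d)) ∩ {x | r ≤ ‖x‖}
    with hK
  have hKc : IsCompact K := (isCompact_Icc.reProdIm isCompact_Icc).inter_right
    (isClosed_le continuous_const continuous_norm)
  have hpos : ∀ x ∈ K, 0 < ‖exp x - 1‖ := fun x hx => by
    rw [norm_pos_iff, sub_ne_zero]
    refine exp_ne_one_of_mem_logStrip ?_ ?_
    · rw [mem_logStrip]
      have := abs_le.2 (show _ ∧ _ from hx.1.2)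
      linarith
    · rintro rfl
      have : r ≤ ‖(0 : ℂ)‖ := hx.2
      rw [norm_zero] at this
      linarith
  obtain ⟨m, hm, hmK⟩ : ∃ m : ℝ, 0 < m ∧ ∀ x ∈ K, m ≤ ‖exp x - 1‖ := by
    rcases K.eq_empty_or_nonempty with h | h
    · exact ⟨1, one_pos, by simp [h]⟩
    · obtain ⟨x, hx, hmin⟩ := hKc.exists_isMinOn h
        (f := fun x => ‖exp x - 1‖) (by fun_prop)
      exact ⟨_, hpos x hx, fun y hy => hmin hy⟩
  refine ⟨min (m / 4) (1 / 4), by positivity, fun x hx hxr => ?_⟩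
  have hle : ∀ {c' : ℝ}, min (m / 4) (1 / 4) ≤ c' →
      min (m / 4) (1 / 4) * (1 + Real.exp x.re) ≤ c' * (1 + Real.exp x.re) := fun h =>
    mul_le_mul_of_nonneg_right h (by positivity)
  rcases le_or_gt |x.re| 1 with h1 | h1
  · have hxK : x ∈ K := ⟨⟨abs_le.1 h1, abs_le.1 hx⟩, hxr⟩
    have he : Real.exp x.re ≤ 3 := by
      have := Real.exp_le_exp.2 (abs_le.1 h1).2
      linarith [Real.exp_one_lt_three]
    have := hmK x hxK
    refine (hle (min_le_left _ _)).trans ?_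
    nlinarith
  · refine (hle (min_le_right _ _)).trans ?_
    rcases lt_abs.1 h1 with h | h
    · have h2 := norm_sub_norm_le (exp x) 1
      rw [norm_exp, norm_one] at h2
      have := Real.exp_le_exp.2 h.le
      linarith [Real.exp_one_gt_d9]
    · have h2 := norm_sub_norm_le 1 (exp x)
      rw [norm_exp, norm_one, norm_sub_rev] at h2
      have h3 : Real.exp x.re * 2 ≤ 1 := by
        have h4 := Real.add_one_le_exp (-x.re)
        have : Real.exp x.re * Real.exp (-x.re) = 1 := by rw [← Real.exp_add]; simp
        have := mul_le_mul_of_nonneg_left (show 2 ≤ Real.exp (-x.re) by linarith)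
          (Real.exp_pos x.re).le
        linarith
      linarith

theorem deriv_deriv_tau_mul {w : ℂ} (hw : w ∈ logStrip) :
    deriv (deriv tau) w * (exp w - 1) = deriv tau w * (exp w - deriv tau w ^ 2) := by
  have h1 : HasDerivAt (fun l => tau l * deriv tau l)
      (deriv tau w * deriv tau w + tau w * deriv (deriv tau) w) w :=
    (hasDerivAt_tau hw).mul (hasDerivAt_deriv_tau hw)
  have h2 : HasDerivAt (fun l => tau l * deriv tau l) (exp w) w := by
    refine ((hasDerivAt_exp w).sub_const 1).congr_of_eventuallyEq ?_
    filter_upwards [isOpen_logStrip.mem_nhds hw] with x hx using tau_mul_deriv hx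
  have h3 := h1.unique h2
  linear_combination (-deriv (deriv tau) w) * tau_mul_deriv hw + deriv tau w * h3

/-- The logarithmic derivative of `tau'` is bounded. This is compactness for `|Re w| ≤ 8`. Beyond,
`|exp w - 1| ≤ |2 * phase w|` together with `tau' ^ 2 * (2 * phase) = (exp - 1) ^ 2` gives `|tau'| ^
2 ≤ |exp w - 1|`, and the identity of `deriv_deriv_tau_mul` yields the constant 3. -/
theorem exists_norm_deriv_deriv_tau_le : ∃ A : ℝ, 0 < A ∧ ∀ w : ℂ, |w.im| ≤ 1 →
    ‖deriv (deriv tau) w‖ ≤ A * ‖deriv tau w‖ := by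
  set K : Set ℂ := Icc (-8) 8 ×ℂ Icc (-1) 1 with hK
  have hKs : ∀ w ∈ K, w ∈ logStrip := fun w hw =>
    mem_logStrip_of_abs_im_le_one (abs_le.2 hw.2)
  have hcont : ContinuousOn (fun w => deriv (deriv tau) w / deriv tau w) K :=
    ((differentiableOn_deriv_tau.deriv isOpen_logStrip).continuousOn.mono hKs).div
      (differentiableOn_deriv_tau.continuousOn.mono hKs) fun w hw => deriv_tau_ne_zero (hKs w hw)
  obtain ⟨A, hA⟩ := (isCompact_Icc.reProdIm isCompact_Icc).exists_bound_of_continuousOn hcont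
  refine ⟨max A 3, by positivity, fun w hw => ?_⟩
  have hws := mem_logStrip_of_abs_im_le_one hw
  have hd := norm_pos_iff.2 (deriv_tau_ne_zero hws)
  have hle : ∀ {c' : ℝ}, c' ≤ max A 3 → c' * ‖deriv tau w‖ ≤ max A 3 * ‖deriv tau w‖ := fun h =>
    mul_le_mul_of_nonneg_right h (by positivity)
  rcases le_or_gt |w.re| 8 with h1 | h1
  · have := hA w ⟨abs_le.1 h1, abs_le.1 hw⟩
    rw [norm_div, div_le_iff₀ hd] at this
    exact this.trans (hle (le_max_left _ _))
  · refine le_trans ?_ (hle (le_max_right _ _))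
    have key : ‖exp w‖ ≤ 2 * ‖exp w - 1‖ ∧ ‖exp w - 1‖ ≤ ‖2 * phase w‖ ∧ 0 < ‖exp w - 1‖ := by
      have hp : ‖2 * phase w‖ = 2 * ‖exp w - (w + 1)‖ := by
        rw [norm_mul, norm_ofNat, phase, sub_sub]
      have hn1 : ‖w + 1‖ ≤ |w.re| + 2 := by
        have := norm_le_abs_re_add_abs_im w
        have h3 := norm_add_le w 1
        rw [norm_one] at h3
        linarith
      have hn2 : |w.re| - 1 ≤ ‖w + 1‖ := by
        have := abs_re_le_norm w
        have h3 := norm_sub_le (w + 1) 1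
        rw [norm_one, add_sub_cancel_right] at h3
        linarith
      have ha := norm_sub_le (exp w) 1
      rw [norm_one] at ha
      rw [hp]
      rcases lt_abs.1 h1 with h | h
      · have h2 := norm_sub_norm_le (exp w) 1
        have h3 := norm_sub_norm_le (exp w) (w + 1)
        have h4 := Real.quadratic_le_exp_of_nonneg (x := w.re) (by linarith)
        rw [abs_of_pos (by linarith)] at hn1
        rw [norm_one] at h2
        rw [norm_exp] at *
        refine ⟨?_, ?_, ?_⟩ <;> nlinarith
      · have h2 := norm_sub_norm_le 1 (exp w)
        have h3 := norm_sub_norm_le (w + 1) (exp w)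
        rw [norm_one, norm_sub_rev] at h2
        rw [norm_sub_rev] at h3
        rw [abs_of_neg (by linarith)] at hn2
        have h5 : ‖exp w‖ * 2 ≤ 1 := by
          rw [norm_exp]
          have h4 := Real.add_one_le_exp (-w.re)
          have : Real.exp w.re * Real.exp (-w.re) = 1 := by rw [← Real.exp_add]; simp
          have := mul_le_mul_of_nonneg_left (show 2 ≤ Real.exp (-w.re) by linarith)
            (Real.exp_pos w.re).le
          linarith
        refine ⟨?_, ?_, ?_⟩ <;> linarith
    obtain ⟨k1, k2, k3⟩ := key
    have hsq : deriv tau w ^ 2 * (2 * phase w) = (exp w - 1) ^ 2 := by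
      rw [← tau_sq hws, ← tau_mul_deriv hws]; ring
    have hsqn := congrArg norm hsq
    rw [norm_mul, norm_pow _ 2, norm_pow _ 2] at hsqn
    have k4 : ‖deriv tau w‖ ^ 2 ≤ ‖exp w - 1‖ := by
      by_contra hc
      have := mul_lt_mul_of_pos_right (not_le.1 hc) k3
      have := mul_le_mul_of_nonneg_left k2 (sq_nonneg ‖deriv tau w‖)
      nlinarith
    have h2 := congrArg norm (deriv_deriv_tau_mul hws)
    rw [norm_mul, norm_mul] at h2
    have h3 : ‖exp w - deriv tau w ^ 2‖ ≤ 3 * ‖exp w - 1‖ := by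
      refine (norm_sub_le _ _).trans ?_
      rw [norm_pow]
      linarith
    have h4 := mul_le_mul_of_nonneg_left h3 hd.le
    rw [← h2] at h4
    refine le_of_mul_le_mul_right (h4.trans (le_of_eq ?_)) k3
    ring

theorem abs_im_le_of_mem_closedBall {w w₀ : ℂ} {a r : ℝ} (h0 : |w₀.im| ≤ a)
    (h : w ∈ Metric.closedBall w₀ r) : |w.im| ≤ a + r := by
  have h1 : |(w - w₀).im| ≤ r := (abs_im_le_norm _).trans (mem_closedBall_iff_norm.1 h)
  have h2 := abs_add_le w₀.im (w - w₀).im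
  rw [sub_im, add_sub_cancel] at h2
  rw [sub_im] at h1
  linarith

/-- A bounded logarithmic derivative means that `tau'` is nearly constant, in relative terms, on
discs of a fixed small radius, so `tau` is close to its linearisation there, uniformly in the
centre. -/
theorem exists_tau_lower_lipschitz : ∃ ρ₀ : ℝ, 0 < ρ₀ ∧ ρ₀ ≤ 1 / 2 ∧ ∀ w₀ w : ℂ, |w₀.im| ≤ 1 / 2 →
    ‖w - w₀‖ ≤ ρ₀ → ‖deriv tau w₀‖ * ‖w - w₀‖ / 2 ≤ ‖tau w - tau w₀‖ := by
  obtain ⟨A, hA, hAb⟩ := exists_norm_deriv_deriv_tau_le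
  set ρ := min (1 / 2) (1 / (4 * A)) with hρ
  have hρ0 : 0 < ρ := by positivity
  have hρ2 : ρ ≤ 1 / 2 := min_le_left _ _
  have hAρ : A * ρ ≤ 1 / 4 := by
    have : ρ ≤ 1 / (4 * A) := min_le_right _ _
    calc A * ρ ≤ A * (1 / (4 * A)) := by gcongr
      _ = 1 / 4 := by field_simp
  refine ⟨ρ, hρ0, hρ2, fun w₀ w h0 hw => ?_⟩
  set K := Metric.closedBall w₀ ρ with hK
  have hK1 : ∀ x ∈ K, |x.im| ≤ 1 := fun x hx =>
    (abs_im_le_of_mem_closedBall h0 hx).trans (by linarith)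
  have hKs : K ⊆ logStrip := fun x hx => mem_logStrip_of_abs_im_le_one (hK1 x hx)
  have hw0K : w₀ ∈ K := Metric.mem_closedBall_self hρ0.le
  have hwK : w ∈ K := mem_closedBall_iff_norm.2 hw
  -- Measuring the variation against the maximum of `|tau'|` on the disc closes the estimate:
  -- variation at most 1/4 of the maximum forces the maximum to be at most 4/3 of the central value.
  obtain ⟨y, hy, hmax⟩ := (isCompact_closedBall w₀ ρ).exists_isMaxOn ⟨w₀, hw0K⟩
    (f := fun x => ‖deriv tau x‖) (differentiableOn_deriv_tau.continuousOn.mono hKs).norm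
  have hM : ∀ x ∈ K, ‖deriv tau x‖ ≤ ‖deriv tau y‖ := fun x hx => hmax hx
  have h1 : ∀ x ∈ K, ‖deriv tau x - deriv tau w₀‖ ≤ 1 / 4 * ‖deriv tau y‖ := fun x hx => by
    have := (convex_closedBall w₀ ρ).norm_image_sub_le_of_norm_hasDerivWithin_le
      (f := deriv tau) (f' := deriv (deriv tau)) (C := A * ‖deriv tau y‖)
      (fun z hz => (hasDerivAt_deriv_tau (hKs hz)).hasDerivWithinAt)
      (fun z hz => (hAb z (hK1 z hz)).trans (by gcongr; exact hM z hz)) hw0K hx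
    refine this.trans ?_
    have h2 := mem_closedBall_iff_norm.1 hx
    calc A * ‖deriv tau y‖ * ‖x - w₀‖ ≤ A * ‖deriv tau y‖ * ρ := by gcongr
      _ = A * ρ * ‖deriv tau y‖ := by ring
      _ ≤ _ := by gcongr
  have h2 : ‖deriv tau y‖ ≤ 4 / 3 * ‖deriv tau w₀‖ := by
    have h3 := h1 y hy
    have h4 := norm_sub_norm_le (deriv tau y) (deriv tau w₀)
    linarith
  have h3 := (convex_closedBall w₀ ρ).norm_image_sub_le_of_norm_hasDerivWithin_le
      (f := fun x => tau x - x * deriv tau w₀) (f' := fun x => deriv tau x - deriv tau w₀)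
      (C := 1 / 2 * ‖deriv tau w₀‖)
      (fun z hz => (((hasDerivAt_tau (hKs hz)).sub
        ((hasDerivAt_id z).mul_const (deriv tau w₀))).congr_deriv (by simp)).hasDerivWithinAt)
      (fun z hz => (h1 z hz).trans (by linarith [norm_nonneg (deriv tau w₀)])) hw0K hwK
  have h4 := norm_sub_norm_le ((w - w₀) * deriv tau w₀) (-(tau w - tau w₀))
  rw [norm_mul, norm_neg, sub_neg_eq_add] at h4
  have h5 : ‖(w - w₀) * deriv tau w₀ - (tau w - tau w₀)‖ ≤
      1 / 2 * ‖deriv tau w₀‖ * ‖w - w₀‖ := by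
    rw [norm_sub_rev]
    refine le_trans (le_of_eq ?_) h3
    congr 1
    ring
  have h6 := norm_sub_norm_le ((w - w₀) * deriv tau w₀) (tau w - tau w₀)
  rw [norm_mul] at h6
  linarith

/-- Quantitative open mapping: the image of the disc of radius `ρ` about `w` contains a disc of
radius `|tau' w| * ρ / 4` about `tau w`. If `tau l` lay inside, `tau_inj` would put `l` in the
original disc. The factor `|tau' w|` matches the numerator of the pole term. -/
theorem exists_tau_separation : ∃ ρ₀ : ℝ, 0 < ρ₀ ∧ ρ₀ ≤ 1 / 2 ∧ ∀ (ρ : ℝ) (l w : ℂ), 0 < ρ → ρ ≤ ρ₀ →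
    l ∈ logStrip → |w.im| ≤ 1 / 2 → ρ < ‖l - w‖ →
    ‖deriv tau w‖ * ρ / 4 ≤ ‖tau l - tau w‖ := by
  obtain ⟨ρ₀, h0, h2, H⟩ := exists_tau_lower_lipschitz
  refine ⟨ρ₀, h0, h2, fun ρ l w hρ hρ' hl hw hlw => ?_⟩
  by_contra hc
  have hws := mem_logStrip_of_abs_im_le_one (hw.trans (by norm_num))
  have hd := norm_pos_iff.2 (deriv_tau_ne_zero hws)
  have hKs : Metric.closedBall w ρ ⊆ logStrip := fun x hx =>
    mem_logStrip_of_abs_im_le_one ((abs_im_le_of_mem_closedBall hw hx).trans (by linarith))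
  have hsub := DiffContOnCl.ball_subset_image_closedBall (f := tau) (z₀ := w) (r := ρ)
    (ε := ‖deriv tau w‖ * ρ / 2) (differentiableOn_tau.diffContOnCl_ball hKs) hρ
    (fun z hz => by
      have hz' : ‖z - w‖ = ρ := mem_sphere_iff_norm.1 hz
      have := H w z hw (by rw [hz']; exact hρ')
      rwa [hz'] at this)
    (by
      refine Eventually.frequently (f := 𝓝[≠] w) ?_ |>.filter_mono nhdsWithin_le_nhds
      filter_upwards [self_mem_nhdsWithin,
        mem_nhdsWithin_of_mem_nhds (Metric.closedBall_mem_nhds w hρ)] with z hz hzb h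
      have hz' := mem_closedBall_iff_norm.1 hzb
      have := H w z hw (hz'.trans hρ')
      rw [h, sub_self, norm_zero] at this
      have := mul_pos hd (norm_pos_iff.2 (sub_ne_zero.2 hz))
      linarith)
  obtain ⟨x, hx, hxe⟩ := hsub (show tau l ∈ Metric.ball (tau w) (‖deriv tau w‖ * ρ / 2 / 2) by
    rw [mem_ball_iff_norm]; linarith [not_le.1 hc])
  have hxl := tau_inj hl (w := x)
    ((abs_im_le_of_mem_closedBall hw hx).trans_lt (by linarith [Real.pi_gt_three])) hxe.symm
  rw [hxl] at hlw
  linarith [mem_closedBall_iff_norm.1 hx]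

/-! ### The kernel with its pole removed -/

/-- The analytic function of `w` that agrees with
`1 / (exp (l - w) - 1) - tau' w / (tau l - tau w)` for `w ≠ l`. -/
noncomputable def regKernel (l w : ℂ) : ℂ :=
  dslope (fun w => deriv tau w / dslope tau l w - 1 / dslope exp 0 (l - w)) l w

/-- Both quotients in the bracket equal 1 at `w = l`, so the outer `dslope` divides a function
vanishing at `l` by `w - l`, which is also the factor that turns each quotient into the displayed
one. -/
theorem regKernel_of_ne {l w : ℂ} (hl : l ∈ logStrip) (h : w ≠ l) :
    regKernel l w = 1 / (exp (l - w) - 1) - deriv tau w / (tau l - tau w) := by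
  have h1 : l - w ≠ 0 := sub_ne_zero.2 h.symm
  have h2 : w - l ≠ 0 := sub_ne_zero.2 h
  have hd := deriv_tau_ne_zero hl
  have e1 : dslope exp 0 0 = 1 := by rw [dslope_same]; simp
  rw [regKernel, dslope_of_ne _ h, slope_def_field]
  simp only [sub_self, e1, dslope_same tau, div_self hd, div_one]
  rw [dslope_of_ne _ h, slope_def_field, dslope_of_ne _ h1, slope_def_field, exp_zero, sub_zero,
    div_div_eq_mul_div, one_div_div, sub_zero, sub_div,
    mul_div_right_comm, mul_div_assoc, div_self h2, mul_one, ← neg_sub w l, neg_div, neg_div,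
    div_right_comm, div_self h2, ← neg_sub (tau w) (tau l), div_neg]
  ring

theorem isOpen_imStrip (d : ℝ) : IsOpen {w : ℂ | |w.im| < d} :=
  isOpen_lt (by fun_prop) continuous_const

theorem dslope_tau_ne_zero {l w : ℂ} (hl : l ∈ logStrip) (hw : |w.im| < 1) :
    dslope tau l w ≠ 0 := by
  by_cases h : w = l
  · rw [h, dslope_same]; exact deriv_tau_ne_zero hl
  · rw [dslope_of_ne _ h, slope_def_field]
    refine div_ne_zero (sub_ne_zero.2 fun he => ?_) (sub_ne_zero.2 h)
    exact h (tau_inj hl (hw.trans (by linarith [Real.pi_gt_three])) he.symm).symm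

theorem differentiable_dslope_exp : Differentiable ℂ (dslope exp 0) := by
  rw [← differentiableOn_univ, differentiableOn_dslope univ_mem]
  exact differentiable_exp.differentiableOn

theorem dslope_exp_ne_zero {x : ℂ} (hx : x ∈ logStrip) : dslope exp 0 x ≠ 0 := by
  by_cases h : x = 0
  · rw [h, dslope_same]; simp
  · rw [dslope_of_ne _ h, slope_def_field, exp_zero]
    exact div_ne_zero (sub_ne_zero.2 (exp_ne_one_of_mem_logStrip hx h)) (by simpa using h)

theorem mul_dslope_exp (x : ℂ) : x * dslope exp 0 x = exp x - 1 := by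
  simpa using sub_smul_dslope exp 0 x

/-- The conditions on `l` and `w` keep `l - w` inside the strip, where `exp - 1` vanishes only at 0;
so `w = l` is the only singularity, and it is removable. -/
theorem differentiableAt_regKernel {d : ℝ} (hd : 0 < d) (hd1 : d ≤ 1) {l w : ℂ}
    (hl : |l.im| ≤ 2 * Real.pi - d) (hw : |w.im| < d) : DifferentiableAt ℂ (regKernel l) w := by
  have hls : l ∈ logStrip := by rw [mem_logStrip]; linarith
  have d1 : DifferentiableOn ℂ (dslope tau l) logStrip :=
    (differentiableOn_dslope (isOpen_logStrip.mem_nhds hls)).2 differentiableOn_tau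
  have hne : ∀ w : ℂ, |w.im| < d → dslope exp 0 (l - w) ≠ 0 := fun w hw => by
    refine dslope_exp_ne_zero ?_
    rw [mem_logStrip, sub_im]
    linarith [abs_sub l.im w.im]
  have d3 : DifferentiableOn ℂ
      (fun w => deriv tau w / dslope tau l w - 1 / dslope exp 0 (l - w)) {w : ℂ | |w.im| < d} := by
    have hsub : {w : ℂ | |w.im| < d} ⊆ logStrip := fun w hw =>
      mem_logStrip_of_abs_im_le_one (le_of_lt (lt_of_lt_of_le hw hd1))
    refine ((differentiableOn_deriv_tau.mono hsub).div (d1.mono hsub)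
      fun w hw => dslope_tau_ne_zero hls (lt_of_lt_of_le hw hd1)).sub
      ((differentiableOn_const 1).div ?_ hne)
    exact (differentiable_dslope_exp.comp
      ((differentiable_const l).sub differentiable_id)).differentiableOn
  have hn := (isOpen_imStrip d).mem_nhds (show w ∈ {w : ℂ | |w.im| < d} from hw)
  by_cases h : w = l
  · subst h
    exact ((differentiableOn_dslope hn).2 d3).differentiableAt hn
  · rw [show regKernel l = dslope (fun w => deriv tau w / dslope tau l w -
      1 / dslope exp 0 (l - w)) l from rfl, differentiableAt_dslope_of_ne h]
    exact d3.differentiableAt hn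

/-- At distance more than `ρ` from the pole the two terms are bounded separately, by `1 / c` and `4
/ ρ`, uniformly in `l`. Nearer, only their difference is bounded, and the maximum principle
transports the far bound inwards. -/
theorem exists_norm_regKernel_le {d : ℝ} (hd : 0 < d) (hd1 : d ≤ 1) :
    ∃ ρ B : ℝ, 0 < ρ ∧ ρ ≤ d / 8 ∧ 0 < B ∧ ∀ l w : ℂ, |l.im| ≤ 2 * Real.pi - d → |w.im| ≤ ρ →
      ‖regKernel l w‖ ≤ B := by
  obtain ⟨ρ₀, h0, h2, H⟩ := exists_tau_separation
  set ρ := min ρ₀ (d / 8) with hρ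
  have hρ0 : 0 < ρ := by positivity
  have hρd : ρ ≤ d / 8 := min_le_right _ _
  obtain ⟨c, hc, hcb⟩ := exists_le_norm_exp_sub_one hρ0 (half_pos hd)
  have far : ∀ l w : ℂ, |l.im| ≤ 2 * Real.pi - d → |w.im| ≤ d / 2 → ρ < ‖l - w‖ →
      ‖regKernel l w‖ ≤ 1 / c + 4 / ρ := by
    intro l w hl hw hlw
    have hls : l ∈ logStrip := by rw [mem_logStrip]; linarith
    have hws : w ∈ logStrip := mem_logStrip_of_abs_im_le_one (by linarith)
    have hdw := norm_pos_iff.2 (deriv_tau_ne_zero hws)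
    rw [regKernel_of_ne hls (by rintro rfl; rw [sub_self, norm_zero] at hlw; linarith)]
    refine (norm_sub_le _ _).trans (add_le_add ?_ ?_)
    · have := hcb (l - w) (by rw [sub_im]; linarith [abs_sub l.im w.im]) hlw.le
      have h3 : c ≤ ‖exp (l - w) - 1‖ := by nlinarith [Real.exp_pos (l - w).re]
      rw [norm_div, norm_one]
      exact one_div_le_one_div_of_le hc h3
    · have := H ρ l w hρ0 (min_le_left _ _) hls (by linarith) hlw
      have hpos : 0 < ‖tau l - tau w‖ := lt_of_lt_of_le (by positivity) this
      rw [norm_div, div_le_div_iff₀ hpos hρ0]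
      linarith
  refine ⟨ρ, 1 / c + 4 / ρ, hρ0, hρd, by positivity, fun l w hl hw => ?_⟩
  rcases lt_or_ge ρ ‖l - w‖ with hlw | hlw
  · exact far l w hl (by linarith) hlw
  -- Here `|l - w| ≤ ρ`, so the circle of radius `3 * ρ` about `w` stays at distance at least `2 *
  -- ρ` from `l`.
  · refine Complex.norm_le_of_forall_mem_frontier_norm_le (U := Metric.ball w (3 * ρ))
      Metric.isBounded_ball (f := regKernel l) ?_ ?_ (subset_closure
        (Metric.mem_ball_self (by positivity)))
    · refine DifferentiableOn.diffContOnCl_ball (U := {w : ℂ | |w.im| < d}) (fun x hx =>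
        (differentiableAt_regKernel hd hd1 hl hx).differentiableWithinAt) fun x hx => ?_
      exact (abs_im_le_of_mem_closedBall hw hx).trans_lt (by linarith)
    · intro x hx
      rw [frontier_ball _ (by positivity)] at hx
      refine far l x hl ((abs_im_le_of_mem_closedBall hw
        (Metric.sphere_subset_closedBall hx)).trans (by linarith)) ?_
      have h3 : ‖x - w‖ = 3 * ρ := mem_sphere_iff_norm.1 hx
      have h4 := norm_sub_le_norm_sub_add_norm_sub x l w
      rw [norm_sub_rev x l] at h4
      linarith

/-! ### Laplace's method for the phase -/

/-- The quotient `(h - h 0 * tau') / (exp - 1)`, with its removable singularity at `0` filled. -/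
noncomputable def divPhase (h : ℂ → ℂ) (w : ℂ) : ℂ :=
  dslope (fun w => h w - h 0 * deriv tau w) 0 w / dslope exp 0 w

theorem divPhase_mul (h : ℂ → ℂ) {w : ℂ} (hw : w ∈ logStrip) :
    divPhase h w * (exp w - 1) = h w - h 0 * deriv tau w := by
  have h1 := sub_smul_dslope (fun w => h w - h 0 * deriv tau w) 0 w
  simp only [sub_zero, smul_eq_mul, deriv_tau_zero, mul_one, sub_self] at h1
  rw [divPhase, ← mul_dslope_exp, ← h1]
  field_simp [dslope_exp_ne_zero hw]

theorem differentiableOn_divPhase {h : ℂ → ℂ} {d : ℝ} (hd : 0 < d) (hd1 : d ≤ 1)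
    (hh : DifferentiableOn ℂ h {w | |w.im| < d}) :
    DifferentiableOn ℂ (divPhase h) {w | |w.im| < d} := by
  have hsub : {w : ℂ | |w.im| < d} ⊆ logStrip := fun w hw =>
    mem_logStrip_of_abs_im_le_one (le_of_lt (lt_of_lt_of_le hw hd1))
  refine DifferentiableOn.div ?_ differentiable_dslope_exp.differentiableOn
    fun w hw => dslope_exp_ne_zero (hsub hw)
  rw [differentiableOn_dslope ((isOpen_imStrip d).mem_nhds (by simpa using hd))]
  exact hh.sub ((differentiableOn_deriv_tau.mono hsub).const_mul _)

/-- Away from 0 the quotient is `h / (exp - 1) - h 0 / tau`, with both denominators bounded below;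
near 0 the maximum principle applies as for `regKernel`. The constant does not depend on `h`. -/
theorem exists_norm_divPhase_le {d : ℝ} (hd : 0 < d) (hd1 : d ≤ 1) :
    ∃ C : ℝ, 0 < C ∧ ∀ (h : ℂ → ℂ) (B : ℝ), DifferentiableOn ℂ h {w | |w.im| < d} →
      (∀ w : ℂ, |w.im| < d → ‖h w‖ ≤ B) → ∀ w : ℂ, |w.im| < d → ‖divPhase h w‖ ≤ C * B := by
  obtain ⟨ρ₀, h0, h2, H⟩ := exists_tau_separation
  set r := min ρ₀ (d / 4) with hr
  have hr0 : 0 < r := by positivity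
  have hrd : r ≤ d / 4 := min_le_right _ _
  obtain ⟨c, hc, hcb⟩ := exists_le_norm_exp_sub_one hr0 (d := 1) one_pos
  refine ⟨1 / c + 4 / r, by positivity, fun h B hh hB => ?_⟩
  have hB0 : 0 ≤ B := (norm_nonneg _).trans (hB 0 (by simpa using hd))
  have far : ∀ w : ℂ, |w.im| < d → r < ‖w‖ → |w.im| ≤ 1 → ‖divPhase h w‖ ≤ (1 / c + 4 / r) * B := by
    intro w hw hwr hw1
    have hws := mem_logStrip_of_abs_im_le_one hw1
    have hw0 : w ≠ 0 := by rintro rfl; rw [norm_zero] at hwr; linarith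
    have he := hcb w (by linarith [Real.pi_gt_three]) hwr.le
    have he' : c ≤ ‖exp w - 1‖ := by nlinarith [Real.exp_pos w.re]
    have ht := H r w 0 hr0 (min_le_left _ _) hws (by simp) (by simpa using hwr)
    rw [deriv_tau_zero, tau_zero, sub_zero, norm_one, one_mul] at ht
    have hne := sub_ne_zero.2 (exp_ne_one_of_mem_logStrip hws hw0)
    have hτ := tau_ne_zero hws hw0
    have e1 : divPhase h w = h w / (exp w - 1) - h 0 / tau w := by
      rw [eq_div_of_mul_eq hne (divPhase_mul h hws), sub_div, ← tau_mul_deriv hws,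
        mul_comm (tau w), mul_comm (h 0), mul_div_mul_left _ _ (deriv_tau_ne_zero hws)]
    rw [e1, add_mul]
    refine (norm_sub_le _ _).trans (add_le_add ?_ ?_)
    · rw [norm_div, div_eq_mul_one_div, mul_comm]
      exact mul_le_mul (one_div_le_one_div_of_le hc he') (hB w hw) (norm_nonneg _) (by positivity)
    · rw [norm_div, div_eq_mul_one_div, mul_comm]
      refine mul_le_mul ?_ (hB 0 (by simpa using hd)) (norm_nonneg _) (by positivity)
      rw [show 4 / r = 1 / (r / 4) by field_simp]
      exact one_div_le_one_div_of_le (by positivity) ht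
  intro w hw
  rcases lt_or_ge (2 * r) ‖w‖ with hwr | hwr
  · exact far w hw (by linarith) (by linarith)
  · refine Complex.norm_le_of_forall_mem_frontier_norm_le (U := Metric.ball 0 (3 * r))
      Metric.isBounded_ball (f := divPhase h) ?_ ?_ (subset_closure ?_)
    · refine (differentiableOn_divPhase hd hd1 hh).diffContOnCl_ball fun x hx => ?_
      exact (abs_im_le_of_mem_closedBall (a := 0) (by simp) hx).trans_lt (by linarith)
    · intro x hx
      rw [frontier_ball _ (by positivity)] at hx
      have h5 := abs_im_le_of_mem_closedBall (a := 0) (by simp)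
        (Metric.sphere_subset_closedBall hx)
      refine far x (h5.trans_lt (by linarith)) ?_ (h5.trans (by linarith))
      have h3 : ‖x - 0‖ = 3 * r := mem_sphere_iff_norm.1 hx
      rw [sub_zero] at h3
      linarith
    · rw [mem_ball_iff_norm, sub_zero]; linarith

theorem norm_deriv_le_of_strip {g : ℂ → ℂ} {d B : ℝ} (hd : 0 < d)
    (hg : DifferentiableOn ℂ g {w | |w.im| < d}) (hB : ∀ w : ℂ, |w.im| < d → ‖g w‖ ≤ B) {w : ℂ}
    (hw : |w.im| < d / 2) : ‖deriv g w‖ ≤ B / (d / 4) := by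
  have hsub : ∀ x ∈ Metric.closedBall w (d / 4), |x.im| < d := fun x hx =>
    (abs_im_le_of_mem_closedBall hw.le hx).trans_lt (by linarith)
  exact Complex.norm_deriv_le_of_forall_mem_sphere_norm_le (by positivity)
    (hg.diffContOnCl_ball hsub) fun x hx => hB x (hsub x (Metric.sphere_subset_closedBall hx))

theorem integrable_exp_neg_mul_abs {c : ℝ} (hc : 0 < c) :
    Integrable fun u : ℝ => Real.exp (-c * |u|) := by
  rw [← integrableOn_univ, ← Iic_union_Ioi (a := (0 : ℝ)), integrableOn_union]
  constructor
  · refine (integrableOn_exp_mul_Iic hc 0).congr_fun (fun u hu => ?_) measurableSet_Iic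
    simp only [abs_of_nonpos (show u ≤ 0 from hu)]
    ring_nf
  · refine (integrableOn_exp_mul_Ioi (neg_lt_zero.2 hc) 0).congr_fun (fun u hu => ?_)
      measurableSet_Ioi
    simp only [abs_of_pos (show 0 < u from hu)]

theorem phase_ofReal_re_ge (u : ℝ) : |u| - 1 ≤ (phase u).re := by
  rw [phase_ofReal, ofReal_re]
  rcases le_or_gt 0 u with h | h
  · rw [abs_of_nonneg h]
    nlinarith [Real.quadratic_le_exp_of_nonneg h, sq_nonneg (u - 1)]
  · rw [abs_of_neg h]
    linarith [Real.exp_pos u]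

theorem phase_ofReal_re_nonneg (u : ℝ) : 0 ≤ (phase u).re := by
  rw [phase_ofReal, ofReal_re]
  linarith [Real.add_one_le_exp u]

theorem norm_exp_neg_mul_phase (N : ℂ) (u : ℝ) :
    ‖exp (-N * phase u)‖ = Real.exp (-N.re * (phase u).re) := by
  rw [norm_exp, mul_re, neg_re, phase_ofReal, ofReal_im, mul_zero, sub_zero]

theorem norm_exp_neg_mul_phase_le {N : ℂ} (hN : 1 ≤ N.re) (u : ℝ) :
    ‖exp (-N * phase u)‖ ≤ Real.exp 1 * Real.exp (-1 * |u|) := by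
  rw [norm_exp_neg_mul_phase, ← Real.exp_add]
  refine Real.exp_le_exp.2 ?_
  have h1 := phase_ofReal_re_ge u
  have h2 := phase_ofReal_re_nonneg u
  nlinarith

theorem continuous_phase_ofReal : Continuous fun u : ℝ => phase u :=
  differentiable_phase.continuous.comp continuous_ofReal

theorem integrable_exp_neg_mul_phase_mul {N : ℂ} (hN : 1 ≤ N.re) {g : ℝ → ℂ} (hg : Continuous g)
    {B : ℝ} (hB : ∀ u, ‖g u‖ ≤ B) : Integrable fun u : ℝ => exp (-N * phase u) * g u := by
  have hB0 : 0 ≤ B := (norm_nonneg _).trans (hB 0)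
  refine Integrable.mono' (((integrable_exp_neg_mul_abs one_pos).const_mul (Real.exp 1)).mul_const B)
    ?_ (Eventually.of_forall fun u => ?_)
  · exact ((continuous_const.mul continuous_phase_ofReal).cexp.mul hg).aestronglyMeasurable
  · rw [norm_mul]
    exact mul_le_mul (norm_exp_neg_mul_phase_le hN u) (hB u) (norm_nonneg _) (by positivity)

theorem norm_integral_exp_neg_mul_phase_mul_le {N : ℂ} (hN : 1 ≤ N.re) {g : ℝ → ℂ}
    {B : ℝ} (hB : ∀ u, ‖g u‖ ≤ B) : ‖∫ u : ℝ, exp (-N * phase u) * g u‖ ≤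
      (∫ u : ℝ, Real.exp 1 * Real.exp (-1 * |u|)) * B := by
  have hB0 : 0 ≤ B := (norm_nonneg _).trans (hB 0)
  rw [← integral_mul_const]
  refine norm_integral_le_of_norm_le
    (((integrable_exp_neg_mul_abs one_pos).const_mul (Real.exp 1)).mul_const B)
    (Eventually.of_forall fun u => ?_)
  rw [norm_mul]
  exact mul_le_mul (norm_exp_neg_mul_phase_le hN u) (hB u) (norm_nonneg _) (by positivity)

theorem integral_comp_tauReal (f : ℝ → ℂ) :
    ∫ u : ℝ, deriv tau u * f (tauReal u) = ∫ t : ℝ, f t := by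
  have h := integral_image_eq_integral_abs_deriv_smul MeasurableSet.univ
    (fun u _ => (hasDerivAt_tauReal u).hasDerivWithinAt) tauReal_strictMono.injective.injOn f
  rw [image_univ, tauReal_surjective.range_eq, Measure.restrict_univ] at h
  rw [h]
  congr 1 with u
  rw [abs_of_pos (deriv_tau_ofReal_re_pos u), real_smul, ← deriv_tau_ofReal]

theorem integrable_comp_tauReal {f : ℝ → ℂ} (hf : Integrable f) :
    Integrable fun u : ℝ => deriv tau u * f (tauReal u) := by
  have h := integrableOn_image_iff_integrableOn_abs_deriv_smul MeasurableSet.univ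
    (fun u _ => (hasDerivAt_tauReal u).hasDerivWithinAt) tauReal_strictMono.injective.injOn f
  rw [image_univ, tauReal_surjective.range_eq, integrableOn_univ, integrableOn_univ] at h
  refine (h.1 hf).congr (Eventually.of_forall fun u => ?_)
  simp only
  rw [abs_of_pos (deriv_tau_ofReal_re_pos u), real_smul, ← deriv_tau_ofReal]

theorem exp_neg_mul_phase_eq (N : ℂ) (u : ℝ) :
    exp (-N * phase u) = exp (-(N / 2) * (tauReal u : ℂ) ^ 2) := by
  rw [← tau_ofReal, tau_sq (ofReal_mem_logStrip u)]
  congr 1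
  ring

/-- The substitution `t = tau u` makes this an exact Gaussian integral. That is the reason for
subtracting `h 0 * tau'` rather than `h 0` in `divPhase`: the leading term then carries no error. -/
theorem integral_exp_neg_mul_phase_mul_deriv_tau {N : ℂ} (hN : 0 < N.re) :
    ∫ u : ℝ, exp (-N * phase u) * deriv tau u = (2 * Real.pi / N) ^ (1 / 2 : ℂ) := by
  have h := integral_comp_tauReal fun t => exp (-(N / 2) * (t : ℂ) ^ 2)
  have hb : 0 < (N / 2).re := by simpa using hN
  rw [integral_gaussian_complex hb, div_div_eq_mul_div, mul_comm (Real.pi : ℂ)] at h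
  rw [← h]
  congr 1 with u
  rw [exp_neg_mul_phase_eq, mul_comm]

theorem integrable_exp_neg_mul_phase_mul_deriv_tau {N : ℂ} (hN : 0 < N.re) :
    Integrable fun u : ℝ => exp (-N * phase u) * deriv tau u := by
  have hb : 0 < (N / 2).re := by simpa using hN
  refine (integrable_comp_tauReal (integrable_cexp_neg_mul_sq hb)).congr
    (Eventually.of_forall fun u => ?_)
  simp only
  rw [exp_neg_mul_phase_eq, mul_comm]

theorem continuous_comp_ofReal_of_strip {g : ℂ → ℂ} {d : ℝ} (hd : 0 < d)
    (hg : DifferentiableOn ℂ g {w | |w.im| < d}) : Continuous fun u : ℝ => g u :=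
  hg.continuousOn.comp_continuous continuous_ofReal fun u => by simpa using hd

/-- One integration by parts: the total derivative of `exp (-N * phase) * divPhase h` integrates to
zero, and its part with factor `N` is `h - h 0 * tau'`. -/
theorem integral_exp_neg_mul_phase_mul_eq {N : ℂ} (hN : 1 ≤ N.re) {h : ℂ → ℂ} {d B B' B'' : ℝ}
    (hd : 0 < d) (hd1 : d ≤ 1) (hh : DifferentiableOn ℂ h {w | |w.im| < d})
    (hB : ∀ u : ℝ, ‖h u‖ ≤ B) (hB' : ∀ u : ℝ, ‖divPhase h u‖ ≤ B')
    (hB'' : ∀ u : ℝ, ‖deriv (divPhase h) u‖ ≤ B'') :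
    ∫ u : ℝ, exp (-N * phase u) * h u = h 0 * (2 * Real.pi / N) ^ (1 / 2 : ℂ) +
      1 / N * ∫ u : ℝ, exp (-N * phase u) * deriv (divPhase h) u := by
  have hN0 : 0 < N.re := by linarith
  have hNne : N ≠ 0 := by rintro rfl; simp at hN0
  have hM := differentiableOn_divPhase hd hd1 hh
  have hM' := hM.deriv (isOpen_imStrip d)
  have hmem : ∀ u : ℝ, (u : ℂ) ∈ {w : ℂ | |w.im| < d} := fun u => by simpa using hd
  have i1 := integrable_exp_neg_mul_phase_mul hN (continuous_comp_ofReal_of_strip hd hh) hB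
  have i2 := integrable_exp_neg_mul_phase_mul hN (continuous_comp_ofReal_of_strip hd hM) hB'
  have i3 := integrable_exp_neg_mul_phase_mul hN (continuous_comp_ofReal_of_strip hd hM') hB''
  have i4 := (integrable_exp_neg_mul_phase_mul_deriv_tau hN0).mul_const (h 0)
  have e1 : ∀ u : ℝ, exp (-N * phase u) * h u - exp (-N * phase u) * deriv tau u * h 0 =
      exp (-N * phase u) * (divPhase h u * (exp u - 1)) := fun u => by
    rw [divPhase_mul h (ofReal_mem_logStrip u)]; ring
  have hderiv : ∀ u : ℝ, HasDerivAt (fun u : ℝ => exp (-N * phase u) * divPhase h u)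
      (exp (-N * phase u) * deriv (divPhase h) u -
        N * (exp (-N * phase u) * h u - exp (-N * phase u) * deriv tau u * h 0)) u := by
    intro u
    have h1 : HasDerivAt (fun w : ℂ => exp (-N * phase w) * divPhase h w) _ (u : ℂ) :=
      (((hasDerivAt_phase u).const_mul (-N)).cexp).mul
        (hM.differentiableAt ((isOpen_imStrip d).mem_nhds (hmem u))).hasDerivAt
    refine h1.comp_ofReal.congr_deriv ?_
    rw [e1]; ring
  have i5 : Integrable fun u : ℝ =>
      N * (exp (-N * phase u) * h u - exp (-N * phase u) * deriv tau u * h 0) :=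
    (i1.sub i4).const_mul N
  have hz := integral_eq_zero_of_hasDerivAt_of_integrable hderiv (i3.sub i5) i2
  rw [integral_sub i3 i5, integral_const_mul, integral_sub i1 i4,
    integral_mul_const, integral_exp_neg_mul_phase_mul_deriv_tau hN0] at hz
  rw [← sub_eq_iff_eq_add', eq_comm, one_div, inv_mul_eq_iff_eq_mul₀ hNne]
  linear_combination hz

/-- A single integration by parts with the absolute bound would give only `O(1 / N)`. A second one
shows that the remaining integral is itself of order `N ^ (-1 / 2)`. Each derivative is paid for by
Cauchy's estimate on a strip of half the width. -/
theorem exists_norm_integral_exp_neg_mul_phase_sub_le {d : ℝ} (hd : 0 < d) (hd1 : d ≤ 1) :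
    ∃ C : ℝ, 0 < C ∧ ∀ (h : ℂ → ℂ) (B : ℝ) (N : ℂ), 1 ≤ N.re →
      DifferentiableOn ℂ h {w | |w.im| < d} → (∀ w : ℂ, |w.im| < d → ‖h w‖ ≤ B) →
      ‖(∫ u : ℝ, exp (-N * phase u) * h u) - h 0 * (2 * Real.pi / N) ^ (1 / 2 : ℂ)‖ ≤
        C * B * ‖N‖ ^ (-(3 / 2) : ℝ) := by
  have hd2 : 0 < d / 2 := by positivity
  have hd4 : 0 < d / 2 / 2 := by positivity
  obtain ⟨C₁, hC₁, H₁⟩ := exists_norm_divPhase_le hd hd1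
  obtain ⟨C₂, hC₂, H₂⟩ := exists_norm_divPhase_le hd2 (by linarith)
  set J : ℝ := ∫ u : ℝ, Real.exp 1 * Real.exp (-1 * |u|) with hJ
  have hJ0 : 0 ≤ J := integral_nonneg fun u => by positivity
  refine ⟨C₁ / (d / 4) * Real.sqrt (2 * Real.pi) + J * (C₂ * (C₁ / (d / 4)) / (d / 2 / 4)),
    by positivity, fun h B N hN hh hB => ?_⟩
  have hre : ∀ {c : ℝ}, 0 < c → ∀ u : ℝ, |(u : ℂ).im| < c := fun hc u => by simpa using hc
  have hB0 : 0 ≤ B := (norm_nonneg _).trans (hB 0 (by simpa using hd))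
  set M := divPhase h with hMdef
  have hM : DifferentiableOn ℂ M {w | |w.im| < d} := differentiableOn_divPhase hd hd1 hh
  have hMB := H₁ h B hh hB
  set D := deriv M with hDdef
  have hsub : {w : ℂ | |w.im| < d / 2} ⊆ {w : ℂ | |w.im| < d} := fun w hw =>
    lt_trans (show |w.im| < d / 2 from hw) (by linarith)
  have hD : DifferentiableOn ℂ D {w | |w.im| < d / 2} :=
    (hM.deriv (isOpen_imStrip d)).mono hsub
  have hDB : ∀ w : ℂ, |w.im| < d / 2 → ‖D w‖ ≤ C₁ * B / (d / 4) := fun w hw =>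
    norm_deriv_le_of_strip hd hM hMB hw
  have hM2 := differentiableOn_divPhase hd2 (by linarith) hD
  have hM2B := H₂ D _ hD hDB
  have hD2B : ∀ w : ℂ, |w.im| < d / 2 / 2 → ‖deriv (divPhase D) w‖ ≤
      C₂ * (C₁ * B / (d / 4)) / (d / 2 / 4) := fun w hw =>
    norm_deriv_le_of_strip hd2 hM2 hM2B hw
  have e1 := integral_exp_neg_mul_phase_mul_eq hN hd hd1 hh (fun u => hB u (hre hd u))
    (fun u => hMB u (hre hd u)) (fun u => hDB u (hre hd2 u))
  have e2 := integral_exp_neg_mul_phase_mul_eq hN hd2 (by linarith) hD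
    (fun u => hDB u (hre hd2 u)) (fun u => hM2B u (hre hd2 u)) (fun u => hD2B u (hre hd4 u))
  have hN1 : 1 ≤ ‖N‖ := hN.trans (re_le_norm N)
  have hNp : 0 < ‖N‖ := by linarith
  have hG : ‖(2 * Real.pi / N) ^ (1 / 2 : ℂ)‖ = Real.sqrt (2 * Real.pi) * ‖N‖ ^ (-(1 / 2) : ℝ) := by
    have : (1 / 2 : ℂ) = ((1 / 2 : ℝ) : ℂ) := by push_cast; rfl
    rw [this, norm_cpow_real, norm_div, norm_mul, norm_real, norm_ofNat, Real.norm_eq_abs,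
      abs_of_pos Real.pi_pos, Real.div_rpow (by positivity) hNp.le, Real.sqrt_eq_rpow,
      Real.rpow_neg hNp.le, div_eq_mul_inv]
  rw [e1, e2, add_sub_cancel_left, mul_add]
  have b1 := hDB 0 (by simpa using hd2)
  have b2 := norm_integral_exp_neg_mul_phase_mul_le hN (g := fun u : ℝ => deriv (divPhase D) u)
    fun u => hD2B u (hre hd4 u)
  have p1 : 1 / ‖N‖ * ‖N‖ ^ (-(1 / 2) : ℝ) = ‖N‖ ^ (-(3 / 2) : ℝ) := by
    rw [one_div, ← Real.rpow_neg_one, ← Real.rpow_add hNp]; norm_num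
  have p2 : 1 / ‖N‖ * (1 / ‖N‖) ≤ ‖N‖ ^ (-(3 / 2) : ℝ) := by
    rw [one_div, ← Real.rpow_neg_one, ← Real.rpow_add hNp]
    exact Real.rpow_le_rpow_of_exponent_le hN1 (by norm_num)
  calc _ ≤ 1 / ‖N‖ * (C₁ * B / (d / 4) * (Real.sqrt (2 * Real.pi) * ‖N‖ ^ (-(1 / 2) : ℝ))) +
        1 / ‖N‖ * (1 / ‖N‖ * (J * (C₂ * (C₁ * B / (d / 4)) / (d / 2 / 4)))) := by
        refine (norm_add_le _ _).trans (add_le_add ?_ ?_)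
        · rw [norm_mul, norm_mul, hG, norm_div, norm_one]
          gcongr
        · rw [norm_mul, norm_mul, norm_div, norm_one]
          gcongr
    _ = C₁ / (d / 4) * Real.sqrt (2 * Real.pi) * B * (1 / ‖N‖ * ‖N‖ ^ (-(1 / 2) : ℝ)) +
        J * (C₂ * (C₁ / (d / 4)) / (d / 2 / 4)) * B * (1 / ‖N‖ * (1 / ‖N‖)) := by ring
    _ ≤ C₁ / (d / 4) * Real.sqrt (2 * Real.pi) * B * ‖N‖ ^ (-(3 / 2) : ℝ) +
        J * (C₂ * (C₁ / (d / 4)) / (d / 2 / 4)) * B * ‖N‖ ^ (-(3 / 2) : ℝ) := by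
        rw [p1]
        gcongr
    _ = _ := by ring

/-! ### Gaussian tails, `erfc`, and the Gaussian Cauchy integral -/

/-- The integral of `exp (-τ ^ 2)` over the horizontal half-line that starts at `x`. -/
noncomputable def gaussTail (x : ℂ) : ℂ := ∫ t in Ioi (0 : ℝ), exp (-(x + (t : ℂ)) ^ 2)

theorem cerfc_eq (x : ℂ) : cerfc x = 2 / (Real.sqrt Real.pi : ℂ) * gaussTail x := rfl

theorem re_sq_eq (z : ℂ) : (z ^ 2).re = z.re ^ 2 - z.im ^ 2 := by
  rw [pow_two, mul_re]; ring

theorem integrable_mul_exp_neg_sub_sq (a b c : ℝ) :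
    Integrable fun t : ℝ => (a + b * |t|) * Real.exp (c * |t| - t ^ 2) := by
  have h1 : Integrable fun t : ℝ => Real.exp (-1 * |t|) * (Real.exp ((|c| + |b| + 2) ^ 2) *
      (|a| + |b|)) := (integrable_exp_neg_mul_abs one_pos).mul_const _
  refine h1.mono' (by fun_prop) (Eventually.of_forall fun t => ?_)
  rw [norm_mul, Real.norm_eq_abs, Real.norm_eq_abs, Real.abs_exp]
  have h2 : abs (a + b * |t|) ≤ (|a| + |b|) * Real.exp |t| := by
    have h3 := abs_add_le a (b * |t|)
    rw [abs_mul, abs_abs] at h3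
    have h4 := Real.add_one_le_exp |t|
    have h5 := mul_le_mul_of_nonneg_left h4 (abs_nonneg a)
    have h6 := mul_le_mul_of_nonneg_left h4 (abs_nonneg b)
    nlinarith [abs_nonneg a, abs_nonneg b, abs_nonneg t, mul_nonneg (abs_nonneg a) (abs_nonneg t)]
  have h7 : Real.exp |t| * Real.exp (c * |t| - t ^ 2) ≤
      Real.exp (-1 * |t|) * Real.exp ((|c| + |b| + 2) ^ 2) := by
    rw [← Real.exp_add, ← Real.exp_add, Real.exp_le_exp]
    have h8 := mul_le_mul_of_nonneg_right (le_abs_self c) (abs_nonneg t)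
    rw [← sq_abs t]
    nlinarith [sq_nonneg (|t| - (|c| + |b| + 2)), abs_nonneg b, abs_nonneg c, abs_nonneg t,
      mul_nonneg (abs_nonneg b) (abs_nonneg t), sq_nonneg (|c| + |b| + 2), sq_nonneg |t|,
      mul_nonneg (abs_nonneg c) (abs_nonneg t), sq_nonneg (|t| / 2 - (|c| + |b| + 2))]
  calc abs (a + b * |t|) * Real.exp (c * |t| - t ^ 2)
      ≤ (|a| + |b|) * Real.exp |t| * Real.exp (c * |t| - t ^ 2) := by gcongr
    _ = (|a| + |b|) * (Real.exp |t| * Real.exp (c * |t| - t ^ 2)) := by ring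
    _ ≤ (|a| + |b|) * (Real.exp (-1 * |t|) * Real.exp ((|c| + |b| + 2) ^ 2)) := by gcongr
    _ = _ := by ring

theorem norm_exp_neg_add_sq_le {x : ℂ} {r : ℝ} (hx : ‖x‖ ≤ r) (t : ℝ) :
    ‖exp (-(x + (t : ℂ)) ^ 2)‖ ≤ Real.exp (r ^ 2) * Real.exp (2 * r * |t| - t ^ 2) := by
  rw [norm_exp, ← Real.exp_add, Real.exp_le_exp, neg_re, re_sq_eq]
  simp only [add_re, add_im, ofReal_re, ofReal_im, add_zero]
  have h1 := (abs_le.1 ((abs_re_le_norm x).trans hx))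
  have h2 := (abs_im_le_norm x).trans hx
  have h3 : x.im ^ 2 ≤ r ^ 2 := sq_le_sq' (abs_le.1 h2).1 (abs_le.1 h2).2
  have h4 : -(2 * (x.re * t)) ≤ 2 * (r * |t|) := by
    have := neg_abs_le (x.re * t)
    rw [abs_mul] at this
    have := mul_le_mul_of_nonneg_right ((abs_re_le_norm x).trans hx) (abs_nonneg t)
    linarith
  nlinarith [sq_nonneg x.re]

theorem integrable_exp_neg_add_sq (x : ℂ) :
    Integrable fun t : ℝ => exp (-(x + (t : ℂ)) ^ 2) := by
  have h := (integrable_mul_exp_neg_sub_sq 1 0 (2 * ‖x‖)).const_mul (Real.exp (‖x‖ ^ 2))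
  refine h.mono' (by fun_prop) (Eventually.of_forall fun t => ?_)
  simpa using norm_exp_neg_add_sq_le le_rfl t

/-- Differentiating under the integral in `x` is the same as differentiating the integrand in `t`,
so the integral of the derivative telescopes to its boundary value at `t = 0`. -/
theorem hasDerivAt_gaussTail (x : ℂ) : HasDerivAt gaussTail (-exp (-x ^ 2)) x := by
  set r := ‖x‖ + 1 with hr
  have hball : ∀ y ∈ Metric.ball x 1, ‖y‖ ≤ r := fun y hy => by
    have h1 := mem_ball_iff_norm.1 hy
    have h2 := norm_sub_norm_le y x
    linarith
  have hF' : ∀ (y : ℂ) (t : ℝ), HasDerivAt (fun y : ℂ => exp (-(y + (t : ℂ)) ^ 2))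
      (-(2 * (y + t)) * exp (-(y + (t : ℂ)) ^ 2)) y := fun y t =>
    ((((hasDerivAt_id y).add_const (t : ℂ)).pow 2).neg.cexp).congr_deriv (by simp; ring)
  have hbound : ∀ y ∈ Metric.ball x 1, ∀ t : ℝ, ‖-(2 * (y + t)) * exp (-(y + (t : ℂ)) ^ 2)‖ ≤
      (2 * r + 2 * |t|) * Real.exp (2 * r * |t| - t ^ 2) * Real.exp (r ^ 2) := fun y hy t => by
    rw [norm_mul, norm_neg, norm_mul, norm_ofNat]
    have h1 := norm_add_le y t
    rw [norm_real, Real.norm_eq_abs] at h1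
    have h2 := hball y hy
    calc _ ≤ (2 * r + 2 * |t|) * (Real.exp (r ^ 2) * Real.exp (2 * r * |t| - t ^ 2)) := by
          refine mul_le_mul (by linarith) (norm_exp_neg_add_sq_le h2 t) (norm_nonneg _) ?_
          have := (norm_nonneg y).trans h2
          positivity
      _ = _ := by ring
  have hint := (integrable_mul_exp_neg_sub_sq (2 * r) 2 (2 * r)).mul_const (Real.exp (r ^ 2))
  have h := hasDerivAt_integral_of_dominated_loc_of_deriv_le
    (μ := volume.restrict (Ioi (0 : ℝ))) (F := fun (y : ℂ) (t : ℝ) => exp (-(y + (t : ℂ)) ^ 2))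
    (F' := fun y t => -(2 * (y + t)) * exp (-(y + (t : ℂ)) ^ 2)) (x₀ := x)
    (Metric.ball_mem_nhds x one_pos)
    (Eventually.of_forall fun y => (by fun_prop))
    (integrable_exp_neg_add_sq x).integrableOn
    (by fun_prop)
    (Eventually.of_forall fun t y hy => hbound y hy t) hint.integrableOn
    (Eventually.of_forall fun t y _ => hF' y t)
  refine h.2.congr_deriv ?_
  have hd : ∀ t : ℝ, HasDerivAt (fun t : ℝ => exp (-(x + (t : ℂ)) ^ 2))
      (-(2 * (x + t)) * exp (-(x + (t : ℂ)) ^ 2)) t := fun t => by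
    have h1 : HasDerivAt (fun s : ℂ => exp (-(x + s) ^ 2))
      (-(2 * (x + t)) * exp (-(x + (t : ℂ)) ^ 2)) (t : ℂ) :=
      ((((hasDerivAt_id (t : ℂ)).const_add x).pow 2).neg.cexp).congr_deriv (by simp; ring)
    exact h1.comp_ofReal
  have hi := (hint.mono' (by fun_prop)
    (Eventually.of_forall (hbound x (Metric.mem_ball_self one_pos))))
  have := integral_Ioi_of_hasDerivAt_of_tendsto' (a := (0 : ℝ)) (fun t _ => hd t) hi.integrableOn
    (tendsto_zero_of_hasDerivAt_of_integrableOn_Ioi (a := (0 : ℝ)) (fun t _ => hd t)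
      hi.integrableOn (integrable_exp_neg_add_sq x).integrableOn)
  simpa using this

theorem norm_gaussTail_le {y : ℂ} (hy : 0 ≤ y.re) :
    ‖gaussTail y‖ ≤ Real.exp (-(y ^ 2).re) * ∫ t in Ioi (0 : ℝ), Real.exp (-1 * t ^ 2) := by
  rw [gaussTail, ← integral_const_mul]
  refine norm_integral_le_of_norm_le ((integrable_exp_neg_mul_sq one_pos).integrableOn.const_mul _)
    ?_
  refine (ae_restrict_mem measurableSet_Ioi).mono fun t ht => ?_
  rw [norm_exp, ← Real.exp_add, Real.exp_le_exp, neg_re, re_sq_eq, re_sq_eq]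
  simp only [add_re, add_im, ofReal_re, ofReal_im, add_zero]
  nlinarith [mul_nonneg hy (le_of_lt (show 0 < t from ht))]

/-- Rotation of the path without a contour argument: `gaussTail (x + c * r)` is a primitive in `r`
of minus the new integrand times `c`, and it tends to 0 because `c` and `c ^ 2` have positive real
part. -/
theorem gaussTail_eq_integral_ray (x : ℂ) {c : ℂ} (hc : 0 < c.re) (hc2 : 0 < (c ^ 2).re) :
    IntegrableOn (fun r : ℝ => exp (-(x + c * r) ^ 2)) (Ioi 0) ∧
    gaussTail x = c * ∫ r in Ioi (0 : ℝ), exp (-(x + c * r) ^ 2) := by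
  have hint : Integrable fun r : ℝ => exp (-(x + c * r) ^ 2) := by
    have h := integrable_cexp_quadratic (b := c ^ 2) hc2 (-(2 * x * c)) (-x ^ 2)
    refine h.congr (Eventually.of_forall fun r => ?_)
    simp only
    congr 1
    ring
  refine ⟨hint.integrableOn, ?_⟩
  have hd : ∀ r : ℝ, HasDerivAt (fun r : ℝ => gaussTail (x + c * r))
      (-c * exp (-(x + c * r) ^ 2)) r := fun r => by
    have h1 : HasDerivAt (fun s : ℂ => gaussTail (x + c * s)) (-c * exp (-(x + c * r) ^ 2))
        (r : ℂ) := by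
      have h2 : HasDerivAt (fun s : ℂ => x + c * s) c (r : ℂ) := by
        simpa using ((hasDerivAt_id (r : ℂ)).const_mul c).const_add x
      rw [show -c * exp (-(x + c * r) ^ 2) = -exp (-(x + c * r) ^ 2) * c by ring]
      exact (hasDerivAt_gaussTail (x + c * r)).comp (r : ℂ) h2
    exact h1.comp_ofReal
  have hlim : Tendsto (fun r : ℝ => gaussTail (x + c * r)) atTop (𝓝 0) := by
    set J := ∫ t in Ioi (0 : ℝ), Real.exp (-1 * t ^ 2)
    have h1 : ∀ᶠ r : ℝ in atTop, ‖gaussTail (x + c * r)‖ ≤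
        Real.exp (-((x + c * r) ^ 2).re) * J := by
      have : Tendsto (fun r : ℝ => x.re + c.re * r) atTop atTop :=
        tendsto_atTop_add_const_left _ _ (tendsto_id.const_mul_atTop hc)
      filter_upwards [this.eventually_ge_atTop 0] with r hr
      exact norm_gaussTail_le (by simpa using hr)
    refine squeeze_zero_norm' h1 ?_
    rw [show (0 : ℝ) = 0 * J by ring]
    refine (Real.tendsto_exp_atBot.comp (tendsto_neg_atTop_atBot.comp ?_)).mul_const J
    have h2 : ∀ r : ℝ, ((x + c * r) ^ 2).re =
        (x ^ 2).re + r * (2 * (x * c).re + (c ^ 2).re * r) := fun r => by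
      have : (x + c * r) ^ 2 = x ^ 2 + (r : ℂ) * (2 * (x * c) + c ^ 2 * r) := by ring
      rw [this, add_re, re_ofReal_mul, add_re, re_mul_ofReal]
      simp
    simp only [h2]
    exact tendsto_atTop_add_const_left _ _ (tendsto_id.atTop_mul_atTop₀
      (tendsto_atTop_add_const_left _ _ (tendsto_id.const_mul_atTop hc2)))
  have := integral_Ioi_of_hasDerivAt_of_tendsto' (a := (0 : ℝ)) (fun r _ => hd r)
    (hint.const_mul (-c)).integrableOn hlim
  rw [integral_const_mul] at this
  simp only [ofReal_zero, mul_zero, add_zero, zero_sub] at this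
  linear_combination this

theorem gaussTail_add_neg (x : ℂ) : gaussTail x + gaussTail (-x) = Real.sqrt Real.pi := by
  have hd : ∀ y : ℂ, HasDerivAt (fun x => gaussTail x + gaussTail (-x)) 0 y := fun y => by
    have h1 := (hasDerivAt_gaussTail (-y)).comp y (hasDerivAt_neg y)
    exact ((hasDerivAt_gaussTail y).add h1).congr_deriv (by simp)
  have hc := is_const_of_deriv_eq_zero (f := fun x => gaussTail x + gaussTail (-x))
    (fun y => (hd y).differentiableAt) (fun y => (hd y).deriv) x 0
  have h0 : gaussTail 0 = (Real.sqrt Real.pi / 2 : ℝ) := by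
    have := integral_gaussian_Ioi 1
    rw [div_one] at this
    rw [← this, gaussTail, ← integral_complex_ofReal]
    congr 1 with t
    simp
  rw [hc, neg_zero, h0]
  push_cast
  ring

theorem cerfc_add_neg (x : ℂ) : cerfc x + cerfc (-x) = 2 := by
  rw [cerfc_eq, cerfc_eq, ← mul_add, gaussTail_add_neg, div_mul_cancel₀]
  exact_mod_cast (Real.sqrt_pos.2 Real.pi_pos).ne'

theorem continuous_cerfc : Continuous cerfc :=
  continuous_const.mul (continuous_iff_continuousAt.2 fun x =>
    (hasDerivAt_gaussTail x).continuousAt)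

theorem cpow_half_sq (b : ℂ) : (b ^ (1 / 2 : ℂ)) ^ 2 = b := by
  rw [← cpow_nat_mul]
  norm_num

theorem cpow_half_re_pos {b : ℂ} (hb : 0 < b.re) : 0 < (b ^ (1 / 2 : ℂ)).re := by
  have hb0 : b ≠ 0 := by rintro rfl; simp at hb
  rw [cpow_def_of_ne_zero hb0, exp_re]
  refine mul_pos (Real.exp_pos _) (Real.cos_pos_of_mem_Ioo ?_)
  have h1 := abs_lt.1 (abs_arg_lt_pi_div_two_iff.2 (Or.inl hb))
  have h2 : (log b * (1 / 2)).im = b.arg / 2 := by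
    rw [show (1 / 2 : ℂ) = ((1 / 2 : ℝ) : ℂ) by push_cast; rfl, im_mul_ofReal, log_im]; ring
  rw [h2]
  constructor <;> linarith [Real.pi_pos]

theorem pi_div_cpow_half_mul {b : ℂ} (hb : 0 < b.re) :
    (Real.pi / b) ^ (1 / 2 : ℂ) * b ^ (1 / 2 : ℂ) = (Real.sqrt Real.pi : ℂ) := by
  have hb0 : b ≠ 0 := by rintro rfl; simp at hb
  have harg : b.arg ≠ Real.pi := by
    have h1 := abs_lt.1 (abs_arg_lt_pi_div_two_iff.2 (Or.inl hb))
    intro h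
    linarith [Real.pi_pos]
  have hπ : (Real.pi : ℂ) / b ≠ 0 := div_ne_zero (by exact_mod_cast Real.pi_ne_zero) hb0
  rw [cpow_def_of_ne_zero hπ, cpow_def_of_ne_zero hb0, ← exp_add, div_eq_mul_inv,
    log_ofReal_mul Real.pi_pos (inv_ne_zero hb0), log_inv _ harg, Real.sqrt_eq_rpow,
    Real.rpow_def_of_pos Real.pi_pos, ofReal_exp]
  congr 1
  push_cast
  ring

/-- The Cauchy integral of a Gaussian at a point of the lower half-plane. -/
theorem integral_gaussian_div_sub {N T : ℂ} (hN : 0 < N.re) (hT : T.im < 0) :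
    ∫ t : ℝ, exp (-(N / 2) * (t : ℂ) ^ 2) / (T - t) =
      Real.pi * I * exp (-(N / 2) * T ^ 2) * cerfc (I * T * (N / 2) ^ (1 / 2 : ℂ)) := by
  set b := N / 2 with hbdef
  have hb : 0 < b.re := by simpa [hbdef] using hN
  have hb0 : b ≠ 0 := by rintro h; rw [h] at hb; simp at hb
  set s := b ^ (1 / 2 : ℂ) with hs
  have hs2 : s ^ 2 = b := cpow_half_sq b
  have hsre : 0 < s.re := cpow_half_re_pos hb
  have hs0 : s ≠ 0 := by rintro h; rw [h] at hsre; simp at hsre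
  -- Chosen to complete the square: with `2 * c * s = 1` and `c ^ 2 = 1 / (4 * b)` the exponent
  -- after the Fourier transform is `-b * T ^ 2 - (I * T * s + c * r) ^ 2` up to the outer sign
  -- conventions, a tail integral along the direction `c`.
  set c := 1 / (2 * s) with hc
  have hcs : 2 * c * s = 1 := by rw [hc]; field_simp
  have hc2 : c ^ 2 = (1 / 4 : ℝ) * b⁻¹ := by
    rw [hc, ← hs2]; push_cast; field_simp; norm_num
  have hcre : 0 < c.re := by
    have : c = (1 / 2 : ℝ) * s⁻¹ := by rw [hc]; push_cast; field_simp
    rw [this, re_ofReal_mul, inv_re]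
    have := normSq_pos.2 hs0
    positivity
  have hc2re : 0 < (c ^ 2).re := by
    rw [hc2, re_ofReal_mul, inv_re]
    have := normSq_pos.2 hb0
    positivity
  have hcaux : ∀ t : ℝ, (T - t : ℂ) ≠ 0 := fun t h => by
    have := congrArg im h
    simp at this
    linarith
  -- The Cauchy kernel is written as a Laplace integral, convergent because `Im T < 0`; exchanging
  -- the integrals then leaves the Fourier transform of a Gaussian.
  have h1 : ∀ t : ℝ, exp (-b * (t : ℂ) ^ 2) / (T - t) =
      ∫ r in Ioi (0 : ℝ), I * (exp (-b * (t : ℂ) ^ 2) * exp (-I * (T - t) * r)) := fun t => by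
    have hre : (-I * (T - t)).re < 0 := by simpa using hT
    rw [integral_const_mul, integral_const_mul, integral_exp_mul_complex_Ioi hre]
    have := hcaux t
    simp only [ofReal_zero, mul_zero, exp_zero]
    field_simp
  have hint : Integrable (Function.uncurry fun (t r : ℝ) =>
      I * (exp (-b * (t : ℂ) ^ 2) * exp (-I * (T - t) * r)))
      (volume.prod (volume.restrict (Ioi (0 : ℝ)))) := by
    have i1 : Integrable (fun t : ℝ => exp (-b * (t : ℂ) ^ 2)) := integrable_cexp_neg_mul_sq hb
    have i2 : Integrable (fun r : ℝ => exp (-I * T * r)) (volume.restrict (Ioi (0 : ℝ))) :=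
      integrableOn_exp_mul_complex_Ioi (by simpa using hT) 0
    refine (i1.mul_prod i2).mono (by fun_prop) (Eventually.of_forall fun z => ?_)
    simp only [Function.uncurry, norm_mul, norm_I, one_mul]
    refine le_of_eq ?_
    congr 1
    rw [norm_exp, norm_exp]
    congr 1
    simp
  simp_rw [h1]
  rw [integral_integral_swap hint]
  have h2 : ∀ r : ℝ, ∫ t : ℝ, I * (exp (-b * (t : ℂ) ^ 2) * exp (-I * (T - t) * r)) =
      I * (Real.pi / b) ^ (1 / 2 : ℂ) * exp (-b * T ^ 2) *
        exp (-(I * T * s + c * r) ^ 2) := fun r => by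
    have h3 := fourierIntegral_gaussian hb (r : ℂ)
    have h4 : ∀ t : ℝ, I * (exp (-b * (t : ℂ) ^ 2) * exp (-I * (T - t) * r)) =
        I * exp (-I * T * r) * (exp (I * r * t) * exp (-b * (t : ℂ) ^ 2)) := fun t => by
      have : exp (-I * (T - t) * r) = exp (-I * T * r) * exp (I * r * t) := by
        rw [← exp_add]; congr 1; ring
      rw [this]; ring
    simp_rw [h4]
    rw [integral_const_mul, h3]
    have h5 : exp (-I * T * r) * exp (-(r : ℂ) ^ 2 / (4 * b)) =
        exp (-b * T ^ 2) * exp (-(I * T * s + c * r) ^ 2) := by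
      rw [← exp_add, ← exp_add]
      congr 1
      have e1 : (I * T * s + c * r) ^ 2 = I ^ 2 * T ^ 2 * s ^ 2 + I * T * r * (2 * c * s) +
        c ^ 2 * r ^ 2 := by ring
      rw [e1, hcs, hs2, hc2, I_sq]
      push_cast
      field_simp
      ring
    linear_combination (I * (Real.pi / b) ^ (1 / 2 : ℂ)) * h5
  simp_rw [h2]
  rw [integral_const_mul, cerfc_eq, (gaussTail_eq_integral_ray _ hcre hc2re).2]
  have h6 := pi_div_cpow_half_mul hb
  have h7 : (Real.sqrt Real.pi : ℂ) ^ 2 = Real.pi := by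
    rw [← ofReal_pow, Real.sq_sqrt Real.pi_pos.le]
  have h8 : (Real.sqrt Real.pi : ℂ) ≠ 0 := by exact_mod_cast (Real.sqrt_pos.2 Real.pi_pos).ne'
  have h9 : (Real.pi / b) ^ (1 / 2 : ℂ) = Real.sqrt Real.pi * (2 * c) := by
    rw [← h6, mul_assoc, ← hs, show s * (2 * c) = 2 * c * s by ring, hcs, mul_one]
  rw [h9, ← h7]
  field_simp

/-- The reflection `t ↦ -t` maps to the lower half-plane, and `erfc x + erfc (-x) = 2` restores the
argument. The `-2` is the residue jump across the line. -/
theorem integral_gaussian_div_sub' {N T : ℂ} (hN : 0 < N.re) (hT : 0 < T.im) :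
    ∫ t : ℝ, exp (-(N / 2) * (t : ℂ) ^ 2) / (T - t) =
      Real.pi * I * exp (-(N / 2) * T ^ 2) * (cerfc (I * T * (N / 2) ^ (1 / 2 : ℂ)) - 2) := by
  have h := integral_gaussian_div_sub (T := -T) hN (by simpa using hT)
  rw [← integral_neg_eq_self] at h
  have h2 := cerfc_add_neg (I * T * (N / 2) ^ (1 / 2 : ℂ))
  have h3 : ∫ t : ℝ, exp (-(N / 2) * (t : ℂ) ^ 2) / (T - t) =
      -∫ t : ℝ, exp (-(N / 2) * ((-t : ℝ) : ℂ) ^ 2) / (-T - (-t : ℝ)) := by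
    rw [← integral_neg]
    congr 1 with t
    push_cast
    rw [neg_sq, show (-T - -(t : ℂ)) = -(T - t) by ring, div_neg, neg_neg]
  rw [h3, h, neg_sq, show I * -T * (N / 2) ^ (1 / 2 : ℂ) = -(I * T * (N / 2) ^ (1 / 2 : ℂ)) by ring]
  linear_combination (-(Real.pi * I * exp (-(N / 2) * T ^ 2))) * h2

/-- The integral over the line in the representation of the first hyperterminant. -/
theorem integral_exp_neg_mul_phase_div {N l : ℂ} (hN : 1 ≤ N.re) {d : ℝ} (hd : 0 < d) (hd1 : d ≤ 1)
    (hl : |l.im| ≤ 2 * Real.pi - d) (hl0 : l.im ≠ 0) {B : ℝ} (hB : ∀ u : ℝ, ‖regKernel l u‖ ≤ B) :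
    ∫ u : ℝ, exp (-N * phase u) / (exp (l - u) - 1) =
      (∫ t : ℝ, exp (-(N / 2) * (t : ℂ) ^ 2) / (tau l - t)) +
        ∫ u : ℝ, exp (-N * phase u) * regKernel l u := by
  have hls : l ∈ logStrip := by rw [mem_logStrip]; linarith
  have him := tau_im_ne_zero hls hl0
  have hb : 0 < (N / 2).re := by rw [show (2 : ℂ) = ((2 : ℝ) : ℂ) by push_cast; rfl, div_ofReal_re]; linarith
  have hT : ∀ t : ℝ, (tau l - t : ℂ) ≠ 0 := fun t h => by
    have := congrArg im h
    simp at this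
    exact him this
  have i1 : Integrable fun t : ℝ => exp (-(N / 2) * (t : ℂ) ^ 2) / (tau l - t) := by
    refine ((integrable_cexp_neg_mul_sq hb).norm.mul_const (1 / |(tau l).im|)).mono' ?_
      (Eventually.of_forall fun t => ?_)
    · exact Continuous.aestronglyMeasurable (Continuous.div (by fun_prop) (by fun_prop) hT)
    · rw [norm_div, div_eq_mul_one_div]
      refine mul_le_mul_of_nonneg_left (one_div_le_one_div_of_le (abs_pos.2 him) ?_)
        (norm_nonneg _)
      simpa using abs_im_le_norm (tau l - t)
  have hk : DifferentiableOn ℂ (regKernel l) {w | |w.im| < d} := fun w hw =>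
    (differentiableAt_regKernel hd hd1 hl hw).differentiableWithinAt
  have i2 := integrable_exp_neg_mul_phase_mul hN (continuous_comp_ofReal_of_strip hd hk) hB
  rw [← integral_comp_tauReal fun t => exp (-(N / 2) * (t : ℂ) ^ 2) / (tau l - t), ← integral_add (integrable_comp_tauReal i1) i2]
  congr 1 with u
  have hne : (u : ℂ) ≠ l := fun h => hl0 (by rw [← h, ofReal_im])
  rw [regKernel_of_ne hls hne, ← exp_neg_mul_phase_eq, tau_ofReal]
  ring

/-! ### Cauchy transforms along horizontal lines -/

/-- The Cauchy transform, in the logarithmic coordinate, of `Φ` along the line `Im W = η`. -/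
noncomputable def cauchyLine (Φ : ℂ → ℂ) (η : ℝ) (Z : ℂ) : ℂ :=
  ∫ u : ℝ, Φ (u + η * I) / (exp (Z - (u + η * I)) - 1)

/-- `Φ` is entire and, locally uniformly for `A < Im W < B`, decays exponentially as
`Re W → ∞`, and so does `exp W * Φ W` as `Re W → -∞`. -/
def StripDecay (Φ : ℂ → ℂ) (A B : ℝ) : Prop :=
  Differentiable ℂ Φ ∧ ∀ a b : ℝ, A < a → b < B → ∃ C c : ℝ, 0 ≤ C ∧ 0 < c ∧
    ∀ u v : ℝ, a ≤ v → v ≤ b →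
      ‖Φ (u + v * I)‖ ≤ C * Real.exp (-c * |u|) * (1 + Real.exp (-u))

/-- The growth `exp (-u)` permitted to `φ` as `u → -∞` is compensated by the growth `exp (X - u)` of
the denominator. -/
theorem norm_div_exp_sub_one_le {κ X u C E : ℝ} {φ x : ℂ} (hκ : 0 < κ)
    (hx : κ * (1 + Real.exp x.re) ≤ ‖exp x - 1‖) (hre : x.re = X - u)
    (hE : 0 ≤ E) (hφ : ‖φ‖ ≤ C * E * (1 + Real.exp (-u))) (hC : 0 ≤ C) :
    ‖φ / (exp x - 1)‖ ≤ C * (1 + Real.exp (-X)) / κ * E := by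
  have hpos : 0 < 1 + Real.exp x.re := by positivity
  have h1 : 1 + Real.exp (-u) ≤ (1 + Real.exp (-X)) * (1 + Real.exp x.re) := by
    have : Real.exp (-u) = Real.exp (-X) * Real.exp x.re := by
      rw [← Real.exp_add, hre]; congr 1; ring
    rw [this]
    nlinarith [Real.exp_pos (-X), Real.exp_pos x.re]
  rw [norm_div, div_le_iff₀ (lt_of_lt_of_le (by positivity) hx)]
  calc ‖φ‖ ≤ C * E * ((1 + Real.exp (-X)) * (1 + Real.exp x.re)) :=
        hφ.trans (by gcongr)
    _ = C * (1 + Real.exp (-X)) / κ * E * (κ * (1 + Real.exp x.re)) := by field_simp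
    _ ≤ _ := by gcongr

theorem exists_le_norm_exp_sub_one_of_im {ε : ℝ} (hε : 0 < ε) : ∃ κ : ℝ, 0 < κ ∧ ∀ x : ℂ,
    ε - 2 * Real.pi ≤ x.im → x.im ≤ -ε → κ * (1 + Real.exp x.re) ≤ ‖exp x - 1‖ := by
  obtain ⟨κ, hκ, H⟩ := exists_le_norm_exp_sub_one hε hε
  refine ⟨κ, hκ, fun x h1 h2 => H x (abs_le.2 ⟨by linarith, ?_⟩) ?_⟩
  · by_contra h
    linarith
  · have := abs_im_le_norm x
    rw [abs_of_neg (by linarith)] at this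
    linarith

theorem exp_sub_one_ne_zero_of_im {x : ℂ} (h1 : -(2 * Real.pi) < x.im) (h2 : x.im < 0) :
    exp x - 1 ≠ 0 :=
  sub_ne_zero.2 (exp_ne_one_of_mem_logStrip (by rw [mem_logStrip, abs_lt]; constructor <;> linarith)
    (by rintro rfl; simp at h2))

theorem continuous_linePoint (η : ℝ) : Continuous fun u : ℝ => (u : ℂ) + η * I := by fun_prop

theorem sub_linePoint_im (Z : ℂ) (u η : ℝ) : (Z - (u + η * I)).im = Z.im - η := by simp

theorem sub_linePoint_re (Z : ℂ) (u η : ℝ) : (Z - (u + η * I)).re = Z.re - u := by simp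

theorem differentiableAt_cauchyLine {Φ : ℂ → ℂ} {A B : ℝ} (hΦ : StripDecay Φ A B) {η : ℝ}
    (hA : A < η) (hB : η < B) {Z : ℂ} (h1 : η - 2 * Real.pi < Z.im) (h2 : Z.im < η) :
    DifferentiableAt ℂ (cauchyLine Φ η) Z := by
  obtain ⟨C, c, hC, hc, hb⟩ := hΦ.2 η η hA hB
  -- Half the distance to either edge of the strip, so that points of the `ε`-ball still keep
  -- distance `ε` from the edges; the cap 1 controls the real part.
  set ε := min (min ((Z.im - (η - 2 * Real.pi)) / 2) ((η - Z.im) / 2)) 1 with hε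
  have hε0 : 0 < ε := lt_min (lt_min (by linarith) (by linarith)) one_pos
  have hε1 : ε ≤ (Z.im - (η - 2 * Real.pi)) / 2 := (min_le_left _ _).trans (min_le_left _ _)
  have hε2 : ε ≤ (η - Z.im) / 2 := (min_le_left _ _).trans (min_le_right _ _)
  obtain ⟨κ, hκ, hκb⟩ := exists_le_norm_exp_sub_one_of_im hε0
  have hker : ∀ Y ∈ Metric.ball Z ε, ∀ u : ℝ, κ * (1 + Real.exp (Y - (u + η * I)).re) ≤
      ‖exp (Y - (u + η * I)) - 1‖ := fun Y hY u => by
    have h3 := (abs_im_le_norm _).trans (mem_ball_iff_norm.1 hY).le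
    rw [sub_im] at h3
    have h4 := abs_le.1 h3
    exact hκb _ (by rw [sub_linePoint_im]; linarith) (by rw [sub_linePoint_im]; linarith)
  have hne : ∀ Y ∈ Metric.ball Z ε, ∀ u : ℝ, exp (Y - (u + η * I)) - 1 ≠ 0 := fun Y hY u =>
    norm_pos_iff.1 (lt_of_lt_of_le (by positivity) (hker Y hY u))
  have hcontΦ : Continuous fun u : ℝ => Φ (u + η * I) :=
    hΦ.1.continuous.comp (continuous_linePoint η)
  have hcont : ∀ Y ∈ Metric.ball Z ε, Continuous fun u : ℝ =>
      Φ (u + η * I) / (exp (Y - (u + η * I)) - 1) := fun Y hY =>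
    hcontΦ.div (by fun_prop) (hne Y hY)
  have hbound : ∀ Y ∈ Metric.ball Z ε, ∀ u : ℝ, ‖Φ (u + η * I) / (exp (Y - (u + η * I)) - 1)‖ ≤
      C * (1 + Real.exp (-(Z.re - 1))) / κ * Real.exp (-c * |u|) := fun Y hY u => by
    refine (norm_div_exp_sub_one_le hκ (hker Y hY u) (sub_linePoint_re Y u η) (Real.exp_pos _).le
      (hb u η le_rfl le_rfl) hC).trans ?_
    have h3 := (abs_re_le_norm _).trans (mem_ball_iff_norm.1 hY).le
    rw [sub_re] at h3
    have h4 : ε ≤ 1 := min_le_right _ _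
    have h5 : -Y.re ≤ -(Z.re - 1) := by linarith [(abs_le.1 h3).1]
    gcongr
  have hder : ∀ Y ∈ Metric.ball Z ε, ∀ u : ℝ, HasDerivAt
      (fun Y => Φ (u + η * I) / (exp (Y - (u + η * I)) - 1))
      (Φ (u + η * I) / (exp (Y - (u + η * I)) - 1) *
        (-exp (Y - (u + η * I)) / (exp (Y - (u + η * I)) - 1))) Y := fun Y hY u => by
    have h3 := (((hasDerivAt_id Y).sub_const ((u : ℂ) + η * I)).cexp).sub_const 1
    refine ((hasDerivAt_const Y (Φ (u + η * I))).div h3 (hne Y hY u)).congr_deriv ?_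
    have := hne Y hY u
    simp only [id]
    field_simp
    ring
  have hratio : ∀ Y ∈ Metric.ball Z ε, ∀ u : ℝ,
      ‖-exp (Y - (u + η * I)) / (exp (Y - (u + η * I)) - 1)‖ ≤ 1 / κ := fun Y hY u => by
    have h3 := hker Y hY u
    rw [norm_div, norm_neg, norm_exp, div_le_div_iff₀ (lt_of_lt_of_le (by positivity) h3) hκ]
    linarith
  have hint : Integrable fun u : ℝ =>
      C * (1 + Real.exp (-(Z.re - 1))) / κ * Real.exp (-c * |u|) :=
    (integrable_exp_neg_mul_abs hc).const_mul _
  have hZ := Metric.mem_ball_self (x := Z) hε0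
  have h := hasDerivAt_integral_of_dominated_loc_of_deriv_le (μ := volume)
    (F := fun (Y : ℂ) (u : ℝ) => Φ (u + η * I) / (exp (Y - (u + η * I)) - 1))
    (F' := fun (Y : ℂ) (u : ℝ) => Φ (u + η * I) / (exp (Y - (u + η * I)) - 1) *
        (-exp (Y - (u + η * I)) / (exp (Y - (u + η * I)) - 1)))
    (bound := fun u : ℝ => C * (1 + Real.exp (-(Z.re - 1))) / κ * Real.exp (-c * |u|) * (1 / κ))
    (x₀ := Z) (Metric.ball_mem_nhds Z hε0)
    (by
      filter_upwards [Metric.ball_mem_nhds Z hε0] with Y hY using (hcont Y hY).aestronglyMeasurable)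
    (hint.mono' (hcont Z hZ).aestronglyMeasurable (Eventually.of_forall (hbound Z hZ)))
    ((hcont Z hZ).mul (Continuous.div (by fun_prop) (by fun_prop) (hne Z hZ))).aestronglyMeasurable
    (Eventually.of_forall fun u Y hY => by
      rw [norm_mul]
      exact mul_le_mul (hbound Y hY u) (hratio Y hY u) (norm_nonneg _)
        ((norm_nonneg _).trans (hbound Y hY u)))
    (hint.mul_const _) (Eventually.of_forall fun u Y hY => hder Y hY u)
  exact h.2.differentiableAt

theorem integrable_cauchyLine {Φ : ℂ → ℂ} {A B : ℝ} (hΦ : StripDecay Φ A B) {η : ℝ}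
    (hA : A < η) (hB : η < B) {Z : ℂ} (h1 : η - 2 * Real.pi < Z.im) (h2 : Z.im < η) :
    Integrable fun u : ℝ => Φ (u + η * I) / (exp (Z - (u + η * I)) - 1) := by
  obtain ⟨C, c, hC, hc, hb⟩ := hΦ.2 η η hA hB
  obtain ⟨κ, hκ, hκb⟩ := exists_le_norm_exp_sub_one_of_im
    (show 0 < min (Z.im - (η - 2 * Real.pi)) (η - Z.im) from lt_min (by linarith) (by linarith))
  refine ((integrable_exp_neg_mul_abs hc).const_mul (C * (1 + Real.exp (-Z.re)) / κ)).mono' ?_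
    (Eventually.of_forall fun u => ?_)
  · refine Continuous.aestronglyMeasurable (Continuous.div
      (hΦ.1.continuous.comp (continuous_linePoint η)) (by fun_prop) fun u => ?_)
    apply exp_sub_one_ne_zero_of_im <;> rw [sub_linePoint_im] <;> linarith
  · refine norm_div_exp_sub_one_le hκ (hκb _ ?_ ?_) (sub_linePoint_re Z u η) (Real.exp_pos _).le
      (hb u η le_rfl le_rfl) hC
    · rw [sub_linePoint_im]
      linarith [min_le_left (Z.im - (η - 2 * Real.pi)) (η - Z.im)]
    · rw [sub_linePoint_im]
      linarith [min_le_right (Z.im - (η - 2 * Real.pi)) (η - Z.im)]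

theorem cauchyLine_add_two_pi (Φ : ℂ → ℂ) (η : ℝ) (Z : ℂ) :
    cauchyLine Φ η (Z + 2 * Real.pi * I) = cauchyLine Φ η Z := by
  unfold cauchyLine
  congr 1 with u
  rw [show Z + 2 * Real.pi * I - (u + η * I) = Z - (u + η * I) + 2 * Real.pi * I by ring,
    exp_periodic]

/-- Cauchy's theorem for two horizontal lines. -/
theorem integral_line_eq_integral_line {f : ℂ → ℂ} {a b : ℝ} (hab : a ≤ b)
    (hd : ∀ W : ℂ, a ≤ W.im → W.im ≤ b → DifferentiableAt ℂ f W) {C c R : ℝ} (hc : 0 < c)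
    (hf : ∀ u v : ℝ, a ≤ v → v ≤ b → R ≤ |u| → ‖f (u + v * I)‖ ≤ C * Real.exp (-c * |u|))
    (ha : Integrable fun u : ℝ => f (u + a * I)) (hb : Integrable fun u : ℝ => f (u + b * I)) :
    ∫ u : ℝ, f (u + a * I) = ∫ u : ℝ, f (u + b * I) := by
  have hrect : ∀ r : ℝ, (∫ x : ℝ in -r..r, f (x + a * I)) - (∫ x : ℝ in -r..r, f (x + b * I)) +
      I • (∫ y : ℝ in a..b, f ((r : ℝ) + y * I)) - I • (∫ y : ℝ in a..b, f ((-r : ℝ) + y * I)) =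
        0 := fun r => by
    have := integral_boundary_rect_eq_zero_of_differentiableOn f ⟨-r, a⟩ ⟨r, b⟩
      (fun W hW => (hd W (by
        have := hW.2
        rw [mem_preimage, uIcc_of_le hab] at this
        exact this.1) (by
        have := hW.2
        rw [mem_preimage, uIcc_of_le hab] at this
        exact this.2)).differentiableWithinAt)
    simpa using this
  have hexp : Tendsto (fun r : ℝ => C * Real.exp (-c * |r|) * |b - a|) atTop (𝓝 0) := by
    have h1 : Tendsto (fun r : ℝ => -c * |r|) atTop atBot :=
      tendsto_abs_atTop_atTop.const_mul_atTop_of_neg (by linarith)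
    have := ((Real.tendsto_exp_atBot.comp h1).const_mul C).mul_const |b - a|
    simpa using this
  have hvert : ∀ s : ℝ, |s| = 1 →
      Tendsto (fun r : ℝ => ∫ y : ℝ in a..b, f ((s * r : ℝ) + y * I)) atTop (𝓝 0) := fun s hs => by
    refine squeeze_zero_norm' ?_ hexp
    filter_upwards [eventually_ge_atTop R] with r hr
    refine intervalIntegral.norm_integral_le_of_norm_le_const fun y hy => ?_
    rw [uIoc_of_le hab] at hy
    have := hf (s * r) y hy.1.le hy.2 (by rw [abs_mul, hs, one_mul]; exact hr.trans (le_abs_self r))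
    rwa [abs_mul, hs, one_mul] at this
  have h1 := intervalIntegral_tendsto_integral ha tendsto_neg_atTop_atBot tendsto_id
  have h2 := intervalIntegral_tendsto_integral hb tendsto_neg_atTop_atBot tendsto_id
  have h3 := hvert 1 (by simp)
  have h4 := hvert (-1) (by simp)
  simp only [one_mul, neg_mul] at h3 h4
  have h5 := ((h1.sub h2).add (h3.const_smul I)).sub (h4.const_smul I)
  simp only [id, hrect, smul_zero, add_zero, sub_zero] at h5
  exact (sub_eq_zero.1 (tendsto_nhds_unique h5 tendsto_const_nhds))

/-- The poles in `W` are `Z + 2 π i k`. The point `Z` lies below both lines and `Z + 2 π i` above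
both, so none is crossed. -/
theorem cauchyLine_eq_of_le {Φ : ℂ → ℂ} {A B : ℝ} (hΦ : StripDecay Φ A B) {η η' : ℝ}
    (hA : A < η) (hB : η' < B) (hη : η ≤ η') {Z : ℂ} (h1 : η' - 2 * Real.pi < Z.im)
    (h2 : Z.im < η) : cauchyLine Φ η Z = cauchyLine Φ η' Z := by
  obtain ⟨C, c, hC, hc, hb⟩ := hΦ.2 η η' hA hB
  obtain ⟨κ, hκ, hκb⟩ := exists_le_norm_exp_sub_one_of_im
    (show 0 < min (Z.im - (η' - 2 * Real.pi)) (η - Z.im) from lt_min (by linarith) (by linarith))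
  have m1 := min_le_left (Z.im - (η' - 2 * Real.pi)) (η - Z.im)
  have m2 := min_le_right (Z.im - (η' - 2 * Real.pi)) (η - Z.im)
  refine integral_line_eq_integral_line (f := fun W => Φ W / (exp (Z - W) - 1)) hη
    (fun W hW1 hW2 => ?_) (C := C * (1 + Real.exp (-Z.re)) / κ) (R := 0) hc
    (fun u v hv1 hv2 _ => ?_) (integrable_cauchyLine hΦ hA (by linarith) (by linarith) h2)
    (integrable_cauchyLine hΦ (by linarith) hB h1 (by linarith))
  · refine (hΦ.1 W).div ?_ ?_
    · exact ((differentiableAt_id.const_sub Z).cexp).sub_const 1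
    · apply exp_sub_one_ne_zero_of_im <;> rw [sub_im] <;> linarith
  · refine norm_div_exp_sub_one_le hκ (hκb _ ?_ ?_) (sub_linePoint_re Z u v) (Real.exp_pos _).le
      (hb u v hv1 hv2) hC
    · rw [sub_linePoint_im]; linarith
    · rw [sub_linePoint_im]; linarith

/-! ### The jump across the line -/

theorem sinh_eq_exp_mul (x : ℂ) : sinh x = exp (-x) * (exp (2 * x) - 1) / 2 := by
  rw [sinh, mul_sub, ← exp_add]
  ring_nf

theorem exists_norm_inv_sinh_le {r d : ℝ} (hr : 0 < r) (hd : 0 < d) : ∃ M : ℝ, 0 < M ∧ ∀ x : ℂ,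
    |x.im| ≤ Real.pi - d → r ≤ ‖x‖ → sinh x ≠ 0 ∧ ‖(sinh x)⁻¹‖ ≤ M * Real.exp (-1 * |x.re|) := by
  obtain ⟨κ, hκ, H⟩ := exists_le_norm_exp_sub_one (r := 2 * r) (d := 2 * d) (by positivity)
    (by positivity)
  refine ⟨2 / κ, by positivity, fun x hx hxr => ?_⟩
  have h2 : (2 * x).im = 2 * x.im := by simp
  have h3 : (2 * x).re = 2 * x.re := by simp
  have h1 := H (2 * x) (by rw [h2, abs_mul, abs_two]; linarith)
    (by rw [norm_mul, norm_ofNat]; linarith)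
  have hpos : 0 < ‖exp (2 * x) - 1‖ := lt_of_lt_of_le (by positivity) h1
  have hs : sinh x ≠ 0 := by
    rw [sinh_eq_exp_mul]
    exact div_ne_zero (mul_ne_zero (exp_ne_zero _) (norm_pos_iff.1 hpos)) two_ne_zero
  refine ⟨hs, ?_⟩
  rw [norm_inv, inv_le_iff_one_le_mul₀ (norm_pos_iff.2 hs), sinh_eq_exp_mul, norm_div, norm_mul,
    norm_exp, norm_ofNat, neg_re]
  rw [h3] at h1
  have h4 : Real.exp |x.re| ≤ Real.exp (-x.re) * (1 + Real.exp (2 * x.re)) := by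
    rw [mul_add, mul_one, ← Real.exp_add, show -x.re + 2 * x.re = x.re by ring]
    rcases abs_cases x.re with h | h <;> rw [h.1] <;>
      linarith [Real.exp_pos x.re, Real.exp_pos (-x.re)]
  have h5 : Real.exp (-1 * |x.re|) * Real.exp |x.re| = 1 := by rw [← Real.exp_add]; simp
  calc (1 : ℝ) = 2 / κ * Real.exp (-1 * |x.re|) * (κ * Real.exp |x.re| / 2) := by
        rw [show 2 / κ * Real.exp (-1 * |x.re|) * (κ * Real.exp |x.re| / 2) =
          Real.exp (-1 * |x.re|) * Real.exp |x.re| by field_simp, h5]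
    _ ≤ 2 / κ * Real.exp (-1 * |x.re|) * (κ * (Real.exp (-x.re) * (1 + Real.exp (2 * x.re))) / 2) := by
        gcongr
    _ = 2 / κ * Real.exp (-1 * |x.re|) * (Real.exp (-x.re) * (κ * (1 + Real.exp (2 * x.re))) / 2) := by
        ring
    _ ≤ _ := by gcongr

theorem integrable_inv_sinh {y : ℝ} (hy : y ≠ 0) (hy' : |y| < Real.pi) :
    Integrable fun u : ℝ => (sinh (u + y * I))⁻¹ := by
  obtain ⟨M, hM, H⟩ := exists_norm_inv_sinh_le (abs_pos.2 hy) (sub_pos.2 hy')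
  have him : ∀ u : ℝ, ((u : ℂ) + y * I).im = y := fun u => by simp
  have hre : ∀ u : ℝ, ((u : ℂ) + y * I).re = u := fun u => by simp
  have H' : ∀ u : ℝ, _ := fun u => H (u + y * I) (by rw [him]; linarith)
    (by have := abs_im_le_norm ((u : ℂ) + y * I); rwa [him] at this)
  refine ((integrable_exp_neg_mul_abs one_pos).const_mul M).mono' ?_ (Eventually.of_forall fun u => ?_)
  · exact (Continuous.inv₀ (by fun_prop) fun u => (H' u).1).aestronglyMeasurable
  · have := (H' u).2
    rwa [hre] at this

/-- With `E = exp (u + y * I)`, a primitive of `-1 / sinh` is `log ((1 + E) / (1 - E))`. The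
quotient stays in the upper half-plane and runs from 1 to -1, so the principal logarithm runs from 0
to `π i`. -/
theorem integral_inv_sinh_of_pos {y : ℝ} (hy : 0 < y) (hy' : y < Real.pi) :
    ∫ u : ℝ, (sinh (u + y * I))⁻¹ = -(Real.pi * I) := by
  have him : ∀ u : ℝ, 0 < (exp ((u : ℂ) + y * I)).im := fun u => by
    rw [exp_im]
    simp only [add_re, ofReal_re, mul_re, I_re, mul_zero, ofReal_im, I_im, mul_one, sub_self,
      add_zero, add_im, mul_im, zero_add]
    exact mul_pos (Real.exp_pos _) (Real.sin_pos_of_pos_of_lt_pi hy hy')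
  have hne : ∀ {E : ℂ}, 0 < E.im → 1 - E ≠ 0 ∧ 1 + E ≠ 0 := fun hE =>
    ⟨fun h => by have := congrArg im h; simp at this; linarith,
      fun h => by have := congrArg im h; simp at this; linarith⟩
  have hq : ∀ {E : ℂ}, 0 < E.im → 0 < ((1 + E) / (1 - E)).im := fun {E} hE => by
    have hn := normSq_pos.2 (hne hE).1
    have : (1 + E) / (1 - E) = 2 / (1 - E) - 1 := by
      have := (hne hE).1
      field_simp
      ring
    rw [this, sub_im, div_im]
    simp only [re_ofNat, im_ofNat, sub_re, sub_im, one_re, one_im, zero_mul, zero_div, zero_sub,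
      sub_zero]
    rw [mul_neg, neg_div, neg_neg]
    positivity
  have hder : ∀ u : ℝ, HasDerivAt (fun u : ℝ => log ((1 + exp ((u : ℂ) + y * I)) /
      (1 - exp ((u : ℂ) + y * I)))) (-(sinh (u + y * I))⁻¹) u := fun u => by
    have h1 : HasDerivAt (fun x : ℂ => exp (x + y * I)) (exp ((u : ℂ) + y * I)) (u : ℂ) := by
      simpa using ((hasDerivAt_id (u : ℂ)).add_const ((y : ℂ) * I)).cexp
    have hE := him u
    have hl : (1 + exp ((u : ℂ) + y * I)) / (1 - exp ((u : ℂ) + y * I)) ∈ slitPlane :=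
      Or.inr (hq hE).ne'
    have h2 := ((h1.const_add 1).fun_div (h1.const_sub 1) (hne hE).1).clog hl
    refine h2.comp_ofReal.congr_deriv ?_
    rw [sinh, exp_neg]
    have n1 := (hne hE).1
    have n2 := (hne hE).2
    have n3 := exp_ne_zero ((u : ℂ) + y * I)
    set E := exp ((u : ℂ) + y * I)
    have n4 : E ^ 2 - 1 ≠ 0 := by
      have : E ^ 2 - 1 = -((1 - E) * (1 + E)) := by ring
      rw [this]
      exact neg_ne_zero.2 (mul_ne_zero n1 n2)
    field_simp
    ring
  have hbot : Tendsto (fun u : ℝ => exp ((u : ℂ) + y * I)) atBot (𝓝 0) := by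
    rw [tendsto_zero_iff_norm_tendsto_zero]
    simp only [norm_exp, add_re, ofReal_re, mul_re, I_re, mul_zero, ofReal_im, I_im, mul_one,
      sub_self, add_zero]
    exact Real.tendsto_exp_atBot
  have l1 : Tendsto (fun u : ℝ => log ((1 + exp ((u : ℂ) + y * I)) /
      (1 - exp ((u : ℂ) + y * I)))) atBot (𝓝 0) := by
    have h1 : Tendsto (fun u : ℝ => (1 + exp ((u : ℂ) + y * I)) /
      (1 - exp ((u : ℂ) + y * I))) atBot (𝓝 ((1 + 0) / (1 - 0))) :=
      (hbot.const_add 1).div (hbot.const_sub 1) (by simp)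
    rw [add_zero, sub_zero, div_one] at h1
    have := h1.clog (Or.inl (by simp))
    rwa [log_one] at this
  have l2 : Tendsto (fun u : ℝ => log ((1 + exp ((u : ℂ) + y * I)) /
      (1 - exp ((u : ℂ) + y * I)))) atTop (𝓝 (Real.pi * I)) := by
    have hinv : Tendsto (fun u : ℝ => (exp ((u : ℂ) + y * I))⁻¹) atTop (𝓝 0) := by
      rw [tendsto_zero_iff_norm_tendsto_zero]
      simp only [norm_inv, norm_exp, add_re, ofReal_re, mul_re, I_re, mul_zero, ofReal_im, I_im,
        mul_one, sub_self, add_zero]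
      exact tendsto_inv_atTop_zero.comp Real.tendsto_exp_atTop
    have h1 : Tendsto (fun u : ℝ => (1 + exp ((u : ℂ) + y * I)) /
      (1 - exp ((u : ℂ) + y * I))) atTop (𝓝 (-1)) := by
      have h2 := ((hinv.add_const 1).div (hinv.sub_const 1) (by simp))
      rw [zero_add, zero_sub, one_div_neg_one_eq_neg_one] at h2
      refine h2.congr fun u => ?_
      have n3 := exp_ne_zero ((u : ℂ) + y * I)
      have n1 := (hne (him u)).1
      set E := exp ((u : ℂ) + y * I)
      have n4 : E⁻¹ - 1 ≠ 0 := by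
        intro h
        apply n1
        field_simp at h
        rwa [mul_zero] at h
      simp only [Pi.div_apply]
      rw [div_eq_div_iff n4 n1]
      field_simp
      ring
    have h3 := tendsto_log_nhdsWithin_im_nonneg_of_re_neg_of_im_zero (z := -1) (by simp) (by simp)
    have h4 := h3.comp (tendsto_nhdsWithin_iff.2 ⟨h1, Eventually.of_forall fun u => (hq (him u)).le⟩)
    have h5 : (Real.log ‖(-1 : ℂ)‖ : ℂ) + Real.pi * I = Real.pi * I := by simp
    rw [h5] at h4
    exact h4
  have hint := (integrable_inv_sinh hy.ne' (by rwa [abs_of_pos hy])).neg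
  have := integral_of_hasDerivAt_of_tendsto hder hint l1 l2
  rw [integral_neg] at this
  linear_combination -this

theorem integral_inv_sinh_of_neg {y : ℝ} (hy : y < 0) (hy' : -Real.pi < y) :
    ∫ u : ℝ, (sinh (u + y * I))⁻¹ = Real.pi * I := by
  have h := integral_inv_sinh_of_pos (y := -y) (by linarith) (by linarith)
  rw [← integral_neg_eq_self]
  rw [← neg_eq_iff_eq_neg] at h
  rw [← h, ← integral_neg]
  congr 1 with u
  rw [← inv_neg, ← sinh_neg]
  push_cast
  ring_nf

/-- The jump of the Cauchy transform when the line of integration crosses the point `Z`. -/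
theorem cauchyLine_sub_cauchyLine {Φ : ℂ → ℂ} {A B : ℝ} (hΦ : StripDecay Φ A B) {η η' : ℝ}
    (hA : A < η) (hB : η' < B) {Z : ℂ} (h1 : η < Z.im) (h2 : Z.im < η')
    (hlt : η' - η < Real.pi) :
    cauchyLine Φ η' Z - cauchyLine Φ η Z = 2 * Real.pi * I * Φ Z := by
  obtain ⟨C, c, hC, hc, hb⟩ := hΦ.2 η η' hA hB
  have hπ := Real.pi_pos
  -- The factor is chosen so that `Φ W / (exp (Z - W) - 1) = -H W / sinh (W - Z)`. Subtracting `H Z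
  -- = Φ Z` in the numerator removes the pole, and the correction is integrable with explicit
  -- integrals `±π i` on the two sides of `Z`.
  set H : ℂ → ℂ := fun W => Φ W * (1 + exp (W - Z)) / 2 with hH
  have hHd : Differentiable ℂ H :=
    (hΦ.1.mul ((differentiable_id.sub_const Z).cexp.const_add 1)).div_const 2
  have d1 : Differentiable ℂ (dslope H Z) := by
    rw [← differentiableOn_univ, differentiableOn_dslope univ_mem]
    exact hHd.differentiableOn
  have d2 : Differentiable ℂ (dslope sinh 0) := by
    rw [← differentiableOn_univ, differentiableOn_dslope univ_mem]
    exact differentiable_sinh.differentiableOn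
  have hsinh : ∀ x : ℂ, |x.im| < Real.pi → x ≠ 0 → sinh x ≠ 0 := fun x hx h0 => by
    obtain ⟨M, -, h⟩ := exists_norm_inv_sinh_le (norm_pos_iff.2 h0) (sub_pos.2 hx)
    exact (h x (by linarith) le_rfl).1
  have hds : ∀ x : ℂ, |x.im| < Real.pi → dslope sinh 0 x ≠ 0 := fun x hx => by
    by_cases h : x = 0
    · rw [h, dslope_same]; simp
    · rw [dslope_of_ne _ h, slope_def_field, sinh_zero, sub_zero, sub_zero]
      exact div_ne_zero (hsinh x hx h) h
  set G : ℂ → ℂ := fun W => -(dslope H Z W / dslope sinh 0 (W - Z)) with hG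
  have him : ∀ W : ℂ, η ≤ W.im → W.im ≤ η' → |(W - Z).im| < Real.pi := fun W hW1 hW2 => by
    rw [sub_im, abs_lt]; constructor <;> linarith
  have hGd : ∀ W : ℂ, η ≤ W.im → W.im ≤ η' → DifferentiableAt ℂ G W := fun W hW1 hW2 =>
    ((d1 W).div (((d2 _).comp W (differentiableAt_id.sub_const Z)))
      (hds _ (him W hW1 hW2))).neg
  have hGe : ∀ W : ℂ, η ≤ W.im → W.im ≤ η' → W ≠ Z →
      G W = Φ W / (exp (Z - W) - 1) + Φ Z * (sinh (W - Z))⁻¹ := fun W hW1 hW2 hWZ => by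
    have hx : W - Z ≠ 0 := sub_ne_zero.2 hWZ
    have hs := hsinh _ (him W hW1 hW2) hx
    have e1 : H Z = Φ Z := by simp [hH]; ring
    have e2 : G W = -((H W - Φ Z) / sinh (W - Z)) := by
      simp only [hG]
      rw [dslope_of_ne _ hWZ, dslope_of_ne _ hx, slope_def_field, slope_def_field, sinh_zero,
        sub_zero, sub_zero, e1, div_div_div_cancel_right₀ hx]
    have e3 : exp (Z - W) = (exp (W - Z))⁻¹ := by rw [← exp_neg, neg_sub]
    rw [e2, e3]
    simp only [hH]
    have hE := exp_ne_zero (W - Z)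
    rw [sinh, exp_neg] at hs ⊢
    set E := exp (W - Z)
    have n4 : E ^ 2 - 1 ≠ 0 := by
      intro h
      apply hs
      rw [show E - E⁻¹ = (E ^ 2 - 1) / E by field_simp, h, zero_div, zero_div]
    have n1 : 1 - E ≠ 0 := fun h => n4 (by linear_combination (-(1 + E)) * h)
    have n5 : E⁻¹ - 1 ≠ 0 := by
      intro h
      apply n1
      field_simp at h
      rwa [mul_zero] at h
    have n6 : E⁻¹ - 1 = (1 - E) / E := by field_simp
    rw [n6]
    field_simp
    ring
  have hre : ∀ u v : ℝ, ((u : ℂ) + v * I - Z).re = u - Z.re := fun u v => by simp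
  have him' : ∀ u v : ℝ, ((u : ℂ) + v * I - Z).im = v - Z.im := fun u v => by simp
  have hline : ∀ u v : ℝ, ((u : ℂ) + v * I).im = v := fun u v => by simp
  have hshift : ∀ u v : ℝ, (u : ℂ) + v * I - Z = ((u - Z.re : ℝ) : ℂ) + ((v - Z.im : ℝ) : ℂ) * I :=
    fun u v => by apply Complex.ext <;> simp
  have i1 : Integrable fun u : ℝ => Φ (u + η * I) / (exp (Z - (u + η * I)) - 1) := by
    have := integrable_cauchyLine hΦ hA (by linarith) (Z := Z - 2 * Real.pi * I) (η := η)
      (by simp; linarith) (by simp; linarith)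
    refine this.congr (Eventually.of_forall fun u => ?_)
    simp only
    rw [← exp_periodic (Z - 2 * Real.pi * I - (u + η * I))]
    congr 3
    ring
  have i2 : Integrable fun u : ℝ => Φ (u + η' * I) / (exp (Z - (u + η' * I)) - 1) :=
    integrable_cauchyLine hΦ (by linarith) hB (by linarith) h2
  have s1 : ∀ v : ℝ, v - Z.im ≠ 0 → |v - Z.im| < Real.pi →
      Integrable fun u : ℝ => Φ Z * (sinh (u + v * I - Z))⁻¹ := fun v hv hv' => by
    have := ((integrable_inv_sinh hv hv').comp_sub_right Z.re).const_mul (Φ Z)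
    simpa only [hshift] using this
  have s2 : ∀ v : ℝ, ∫ u : ℝ, Φ Z * (sinh (u + v * I - Z))⁻¹ =
      Φ Z * ∫ u : ℝ, (sinh (u + ((v - Z.im : ℝ) : ℂ) * I))⁻¹ := fun v => by
    rw [integral_const_mul, ← integral_sub_right_eq_self
      (fun u : ℝ => (sinh (u + ((v - Z.im : ℝ) : ℂ) * I))⁻¹) Z.re]
    simp only [hshift]
  have a1 : |η - Z.im| < Real.pi := abs_lt.2 ⟨by linarith, by linarith⟩
  have a2 : |η' - Z.im| < Real.pi := abs_lt.2 ⟨by linarith, by linarith⟩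
  have g1 : ∀ u : ℝ, G (u + η * I) = Φ (u + η * I) / (exp (Z - (u + η * I)) - 1) +
      Φ Z * (sinh (u + η * I - Z))⁻¹ := fun u =>
    hGe _ (by simp) (by simp; linarith) fun h => by have := congrArg im h; simp at this; linarith
  have g2 : ∀ u : ℝ, G (u + η' * I) = Φ (u + η' * I) / (exp (Z - (u + η' * I)) - 1) +
      Φ Z * (sinh (u + η' * I - Z))⁻¹ := fun u =>
    hGe _ (by simp; linarith) (by simp) fun h => by have := congrArg im h; simp at this; linarith
  have j1 := i1.add (s1 η (by linarith) a1)
  have j2 := i2.add (s1 η' (by linarith) a2)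
  obtain ⟨κ, hκ, hκb⟩ := exists_le_norm_exp_sub_one (r := 1) one_pos hπ
  obtain ⟨M, hM, hMb⟩ := exists_norm_inv_sinh_le (r := 1) one_pos
    (show 0 < Real.pi - (η' - η) by linarith)
  have key := integral_line_eq_integral_line (f := G) (by linarith : η ≤ η') hGd
    (C := C * (1 + Real.exp (-Z.re)) / κ + ‖Φ Z‖ * (M * Real.exp |Z.re|))
    (R := |Z.re| + 1) (c := min c 1) (by positivity) (fun u v hv1 hv2 hu => by
      have hnorm : 1 ≤ ‖(u : ℂ) + v * I - Z‖ := by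
        have h3 := abs_re_le_norm ((u : ℂ) + v * I - Z)
        rw [hre] at h3
        have h4 := abs_sub_abs_le_abs_sub u Z.re
        linarith
      have habs : |v - Z.im| ≤ Real.pi - (Real.pi - (η' - η)) := abs_le.2 ⟨by linarith, by linarith⟩
      rw [hGe _ (by rw [hline]; exact hv1) (by rw [hline]; exact hv2) (by
        intro h
        rw [h, sub_self, norm_zero] at hnorm
        linarith)]
      have e0 : ∀ {c' : ℝ}, min c 1 ≤ c' → Real.exp (-c' * |u|) ≤ Real.exp (-min c 1 * |u|) :=
        fun h => Real.exp_le_exp.2 (by nlinarith [abs_nonneg u])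
      refine (norm_add_le _ _).trans ?_
      rw [add_mul]
      refine add_le_add ?_ ?_
      · refine (norm_div_exp_sub_one_le hκ (hκb _ ?_ ?_) (sub_linePoint_re Z u v) (Real.exp_pos _).le
          (hb u v hv1 hv2) hC).trans ?_
        · rw [sub_linePoint_im, abs_sub_comm]; linarith
        · rw [norm_sub_rev]; exact hnorm
        · exact mul_le_mul_of_nonneg_left (e0 (min_le_left _ _)) (by positivity)
      · have h5 := (hMb _ (by rw [him']; exact habs) hnorm).2
        rw [hre] at h5
        rw [norm_mul, mul_assoc]
        refine mul_le_mul_of_nonneg_left (h5.trans ?_) (norm_nonneg _)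
        rw [mul_assoc]
        refine mul_le_mul_of_nonneg_left ?_ hM.le
        calc Real.exp (-1 * |u - Z.re|) ≤ Real.exp |Z.re| * Real.exp (-1 * |u|) := by
              rw [← Real.exp_add, Real.exp_le_exp]
              linarith [abs_sub_abs_le_abs_sub u Z.re]
          _ ≤ _ := mul_le_mul_of_nonneg_left (e0 (min_le_right _ _)) (Real.exp_pos _).le)
    (j1.congr (Eventually.of_forall fun u => (g1 u).symm))
    (j2.congr (Eventually.of_forall fun u => (g2 u).symm))
  simp only [g1, g2] at key
  rw [integral_add i1 (s1 η (by linarith) a1), integral_add i2 (s1 η' (by linarith) a2), s2, s2,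
    integral_inv_sinh_of_neg (by linarith) (by linarith),
    integral_inv_sinh_of_pos (by linarith) (by linarith)] at key
  unfold cauchyLine
  linear_combination -key

/-! ### Continuation to entire functions -/

/-- The sum of `ψ` over `Z, Z - 2πi, …` that solves `S (k + 1) = S k + ψ (Z - 2πik)`. -/
noncomputable def shiftSum (ψ : ℂ → ℂ) (k : ℤ) (Z : ℂ) : ℂ :=
  ∑ j ∈ Finset.Ico 0 k, ψ (Z - 2 * Real.pi * I * j) -
    ∑ j ∈ Finset.Ico k 0, ψ (Z - 2 * Real.pi * I * j)

theorem shiftSum_zero (ψ : ℂ → ℂ) (Z : ℂ) : shiftSum ψ 0 Z = 0 := by simp [shiftSum]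

theorem shiftSum_add_one (ψ : ℂ → ℂ) (k : ℤ) (Z : ℂ) :
    shiftSum ψ (k + 1) Z = shiftSum ψ k Z + ψ (Z - 2 * Real.pi * I * k) := by
  unfold shiftSum
  rcases le_or_gt 0 k with h | h
  · have h1 : Finset.Ico 0 (k + 1) = insert k (Finset.Ico 0 k) := by ext j; simp; omega
    rw [h1, Finset.sum_insert (by simp), Finset.Ico_eq_empty (by omega : ¬ k + 1 < 0),
      Finset.Ico_eq_empty (by omega : ¬ k < 0)]
    simp; ring
  · have h1 : Finset.Ico k 0 = insert k (Finset.Ico (k + 1) 0) := by ext j; simp; omega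
    rw [h1, Finset.sum_insert (by simp), Finset.Ico_eq_empty (by omega : ¬ 0 < k + 1),
      Finset.Ico_eq_empty (by omega : ¬ 0 < k)]
    simp

theorem differentiable_shiftSum {ψ : ℂ → ℂ} (hψ : Differentiable ℂ ψ) (k : ℤ) :
    Differentiable ℂ (shiftSum ψ k) := by
  unfold shiftSum
  fun_prop

theorem convex_im_Ioo (a b : ℝ) : Convex ℝ {Z : ℂ | a < Z.im ∧ Z.im < b} := by
  have : {Z : ℂ | a < Z.im ∧ Z.im < b} = Complex.imCLM ⁻¹' (Ioo a b) := by ext; simp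
  rw [this]
  exact (convex_Ioo a b).linear_preimage (Complex.imCLM : ℂ →L[ℝ] ℝ).toLinearMap

theorem isOpen_im_Ioo (a b : ℝ) : IsOpen {Z : ℂ | a < Z.im ∧ Z.im < b} :=
  (isOpen_lt continuous_const continuous_im).inter (isOpen_lt continuous_im continuous_const)

theorem exists_mem_im_Ioo {a b : ℝ} (h : a < b) : ∃ Z : ℂ, a < Z.im ∧ Z.im < b :=
  ⟨((a + b) / 2 : ℝ) * I, by
    rw [im_ofReal_mul, I_im]; constructor <;> linarith⟩

/-- Identity theorem on a horizontal strip. -/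
theorem eqOn_strip_of_eqOn_strip {f g : ℂ → ℂ} {a b a' b' : ℝ}
    (hf : DifferentiableOn ℂ f {Z | a < Z.im ∧ Z.im < b})
    (hg : DifferentiableOn ℂ g {Z | a < Z.im ∧ Z.im < b}) (ha : a ≤ a') (hb : b' ≤ b)
    (hab : a' < b') (h : ∀ Z : ℂ, a' < Z.im → Z.im < b' → f Z = g Z) :
    ∀ Z : ℂ, a < Z.im → Z.im < b → f Z = g Z := by
  obtain ⟨Z₀, h0, h1⟩ := exists_mem_im_Ioo hab
  have := (hf.analyticOnNhd (isOpen_im_Ioo a b)).eqOn_of_preconnected_of_eventuallyEq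
    (hg.analyticOnNhd (isOpen_im_Ioo a b)) (convex_im_Ioo a b).isPreconnected
    (z₀ := Z₀) ⟨by linarith, by linarith⟩ (by
      filter_upwards [(isOpen_im_Ioo a' b').mem_nhds ⟨h0, h1⟩] with Z hZ using h Z hZ.1 hZ.2)
  exact fun Z hZ1 hZ2 => this ⟨hZ1, hZ2⟩

theorem eq_of_eqOn_strip {f g : ℂ → ℂ} (hf : Differentiable ℂ f) (hg : Differentiable ℂ g)
    {a b : ℝ} (hab : a < b) (h : ∀ Z : ℂ, a < Z.im → Z.im < b → f Z = g Z) : f = g := by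
  obtain ⟨Z₀, h0, h1⟩ := exists_mem_im_Ioo hab
  exact AnalyticOnNhd.eq_of_eventuallyEq (hf.differentiableOn.analyticOnNhd isOpen_univ)
    (hg.differentiableOn.analyticOnNhd isOpen_univ) (z₀ := Z₀) (by
      filter_upwards [(isOpen_im_Ioo a b).mem_nhds ⟨h0, h1⟩] with Z hZ using h Z hZ.1 hZ.2)

/-- A function on a strip of width more than `2π` whose translate by `2πi` differs from it by an
entire function extends to an entire function. -/
theorem exists_entire_extension {f ψ : ℂ → ℂ} {α ε : ℝ} (hε : 0 < ε) (hε' : ε < 2 * Real.pi)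
    (hψ : Differentiable ℂ ψ)
    (hf : ∀ Z : ℂ, α < Z.im → Z.im < α + 2 * Real.pi + ε → DifferentiableAt ℂ f Z)
    (hfψ : ∀ Z : ℂ, α < Z.im → Z.im < α + ε →
      f (Z + 2 * Real.pi * I) = f Z + ψ (Z + 2 * Real.pi * I)) :
    ∃ F : ℂ → ℂ, Differentiable ℂ F ∧
      (∀ Z : ℂ, F (Z + 2 * Real.pi * I) = F Z + ψ (Z + 2 * Real.pi * I)) ∧
      ∀ Z : ℂ, α < Z.im → Z.im < α + 2 * Real.pi + ε → F Z = f Z := by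
  have hπ := Real.two_pi_pos
  -- The number of periods to subtract. The window of height `2 π` is centred in the strip of height
  -- `2 π + ε`, leaving a margin `ε / 2` on either side, so a fixed `k` serves on a neighbourhood.
  set k : ℂ → ℤ := fun Z => ⌊(Z.im - (α + ε / 2)) / (2 * Real.pi)⌋ with hk
  have hk1 : ∀ Z : ℂ, α + ε / 2 ≤ Z.im - 2 * Real.pi * k Z ∧
      Z.im - 2 * Real.pi * k Z < α + ε / 2 + 2 * Real.pi := fun Z => by
    have h1 := Int.floor_le ((Z.im - (α + ε / 2)) / (2 * Real.pi))
    have h2 := Int.lt_floor_add_one ((Z.im - (α + ε / 2)) / (2 * Real.pi))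
    rw [le_div_iff₀ hπ] at h1
    rw [div_lt_iff₀ hπ] at h2
    constructor <;> linarith
  have him : ∀ (Z : ℂ) (j : ℤ), (Z - 2 * Real.pi * I * j).im = Z.im - 2 * Real.pi * j := fun Z j => by
    simp
  set F : ℂ → ℂ := fun Z => f (Z - 2 * Real.pi * I * k Z) + shiftSum ψ (k Z) Z with hF
  -- Independence of the chosen translate: two admissible indices differ by at most 1, and the
  -- functional equation on the overlap reconciles neighbouring ones.
  have claim : ∀ (Z : ℂ) (j : ℤ), α < Z.im - 2 * Real.pi * j →
      Z.im - 2 * Real.pi * j < α + 2 * Real.pi + ε →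
      F Z = f (Z - 2 * Real.pi * I * j) + shiftSum ψ j Z := by
    intro Z j h1 h2
    obtain ⟨h3, h4⟩ := hk1 Z
    have h5 : (k Z - j : ℝ) < 2 := by
      by_contra hc
      nlinarith [not_lt.1 hc]
    have h6 : (-2 : ℝ) < k Z - j := by
      by_contra hc
      nlinarith [not_lt.1 hc]
    have h5' : k Z - j < 2 := by exact_mod_cast h5
    have h6' : -2 < k Z - j := by exact_mod_cast h6
    have h7 : k Z = j ∨ k Z = j + 1 ∨ j = k Z + 1 := by omega
    simp only [hF]
    rcases h7 with h | h | h
    · rw [h]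
    · rw [h] at h3 h4 ⊢
      push_cast at h3 h4
      have h8 := hfψ (Z - 2 * Real.pi * I * (j + 1 : ℤ)) (by rw [him]; push_cast; linarith)
        (by rw [him]; push_cast; linarith)
      rw [show Z - 2 * Real.pi * I * (j + 1 : ℤ) + 2 * Real.pi * I = Z - 2 * Real.pi * I * j by
        push_cast; ring] at h8
      rw [shiftSum_add_one, h8]
      ring
    · have h9 : (j : ℝ) = k Z + 1 := by rw [h]; push_cast; ring
      rw [h9] at h1 h2
      have h8 := hfψ (Z - 2 * Real.pi * I * j) (by rw [him, h9]; linarith)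
        (by rw [him, h9]; linarith)
      rw [show Z - 2 * Real.pi * I * j + 2 * Real.pi * I = Z - 2 * Real.pi * I * k Z by
        rw [h]; push_cast; ring] at h8
      rw [h8, h, shiftSum_add_one]
      ring
  have hFd : Differentiable ℂ F := fun Z₀ => by
    obtain ⟨h1, h2⟩ := hk1 Z₀
    have hd : DifferentiableAt ℂ (fun Z => f (Z - 2 * Real.pi * I * k Z₀) + shiftSum ψ (k Z₀) Z)
        Z₀ := by
      refine DifferentiableAt.add ?_ (differentiable_shiftSum hψ _ _)
      exact (hf (Z₀ - 2 * Real.pi * I * k Z₀) (by rw [him]; linarith) (by rw [him]; linarith)).comp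
        Z₀ (differentiableAt_id.sub_const _)
    refine hd.congr_of_eventuallyEq ?_
    filter_upwards [(isOpen_im_Ioo (α + 2 * Real.pi * k Z₀)
      (α + 2 * Real.pi + ε + 2 * Real.pi * k Z₀)).mem_nhds
      (show _ ∧ _ from ⟨by linarith, by linarith⟩)] with Z hZ
    exact claim Z (k Z₀) (by linarith [hZ.1]) (by linarith [hZ.2])
  have hFf : ∀ Z : ℂ, α < Z.im → Z.im < α + 2 * Real.pi + ε → F Z = f Z := fun Z h1 h2 => by
    have := claim Z 0 (by simpa using h1) (by simpa using h2)
    simpa [shiftSum_zero] using this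
  refine ⟨F, hFd, fun Z => ?_, hFf⟩
  have hsh : Differentiable ℂ fun Z : ℂ => Z + 2 * Real.pi * I := by fun_prop
  refine congrFun (eq_of_eqOn_strip (f := fun Z => F (Z + 2 * Real.pi * I))
    (g := fun Z => F Z + ψ (Z + 2 * Real.pi * I)) (hFd.comp hsh) (hFd.add (hψ.comp hsh))
    (a := α) (b := α + ε) (by linarith) fun Y h1 h2 => ?_) Z
  have him2 : (Y + 2 * Real.pi * I).im = Y.im + 2 * Real.pi := by simp
  rw [hFf _ (by rw [him2]; linarith) (by rw [him2]; linarith), hFf _ h1 (by linarith), hfψ Y h1 h2]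

/-- The Cauchy transform of a function with `StripDecay` continues to an entire function. -/
theorem exists_cauchyLine_continuation {Φ : ℂ → ℂ} {A B : ℝ} (hΦ : StripDecay Φ A B) (hAB : A < B)
    (hAB' : B - A ≤ 2 * Real.pi) : ∃ F : ℂ → ℂ, Differentiable ℂ F ∧
      (∀ Z : ℂ, F (Z + 2 * Real.pi * I) = F Z + 2 * Real.pi * I * Φ (Z + 2 * Real.pi * I)) ∧
      ∀ η : ℝ, A < η → η < B → ∀ Z : ℂ, η - 2 * Real.pi < Z.im → Z.im < η →
        F Z = cauchyLine Φ η Z := by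
  have hπ := Real.pi_gt_three
  obtain ⟨η, hA, hB⟩ := exists_between hAB
  set ε := min ((B - η) / 2) 1 with hεdef
  have hε : 0 < ε := lt_min (by linarith) one_pos
  have hε1 : ε ≤ 1 := min_le_right _ _
  have hεB : η + ε < B := by
    have : ε ≤ (B - η) / 2 := min_le_left _ _
    linarith
  have agree : ∀ η₁ η₂ : ℝ, A < η₁ → η₁ < B → A < η₂ → η₂ < B → ∀ Z : ℂ,
      η₁ - 2 * Real.pi < Z.im → η₂ - 2 * Real.pi < Z.im → Z.im < η₁ → Z.im < η₂ →
      cauchyLine Φ η₁ Z = cauchyLine Φ η₂ Z := by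
    intro η₁ η₂ a1 b1 a2 b2 Z h1 h2 h3 h4
    rcases le_total η₁ η₂ with h | h
    · exact cauchyLine_eq_of_le hΦ a1 b2 h h2 h3
    · exact (cauchyLine_eq_of_le hΦ a2 b1 h h1 h4).symm
  -- Two nearby lines together cover a strip higher than one period. On the overlap of its ends, the
  -- jump between the lines is the functional equation required; `ε ≤ 1` keeps their distance below
  -- `π`.
  set f : ℂ → ℂ := fun Z => if Z.im < η then cauchyLine Φ η Z else cauchyLine Φ (η + ε) Z with hf
  have f1 : ∀ Z : ℂ, Z.im < η → f Z = cauchyLine Φ η Z := fun Z h => if_pos h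
  have f2 : ∀ Z : ℂ, η + ε - 2 * Real.pi < Z.im → Z.im < η + ε →
      f Z = cauchyLine Φ (η + ε) Z := fun Z h1 h2 => by
    by_cases h : Z.im < η
    · rw [f1 Z h]
      exact agree _ _ hA hB (by linarith) hεB Z (by linarith) h1 h h2
    · exact if_neg h
  obtain ⟨F, hF, hFΦ, hFf⟩ := exists_entire_extension (f := f)
    (ψ := fun Z => 2 * Real.pi * I * Φ Z) (α := η - 2 * Real.pi) hε (by linarith)
    (hΦ.1.const_mul _) (fun Z h1 h2 => by
      rcases lt_or_ge Z.im η with h | h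
      · refine (differentiableAt_cauchyLine hΦ hA hB h1 h).congr_of_eventuallyEq ?_
        filter_upwards [(isOpen_im_Ioo (Z.im - 1) η).mem_nhds ⟨by linarith, h⟩] with Y hY
          using f1 Y hY.2
      · refine (differentiableAt_cauchyLine hΦ (by linarith) hεB (by linarith)
          (by linarith)).congr_of_eventuallyEq (f₁ := f) (f := cauchyLine Φ (η + ε)) ?_
        filter_upwards [(isOpen_im_Ioo (η + ε - 2 * Real.pi) (η + ε)).mem_nhds
          (show _ ∧ _ from ⟨by linarith, by linarith⟩)] with Y hY using f2 Y hY.1 hY.2)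
    (fun Z h1 h2 => by
      have him2 : (Z + 2 * Real.pi * I).im = Z.im + 2 * Real.pi := by simp
      have h3 := cauchyLine_sub_cauchyLine hΦ hA hεB (Z := Z + 2 * Real.pi * I)
        (by rw [him2]; linarith) (by rw [him2]; linarith) (by linarith)
      rw [f1 Z (by linarith), f2 _ (by rw [him2]; linarith) (by rw [him2]; linarith),
        ← cauchyLine_add_two_pi Φ η Z]
      linear_combination h3)
  refine ⟨F, hF, hFΦ, fun η' hA' hB' => ?_⟩
  refine eqOn_strip_of_eqOn_strip (a' := max η η' - 2 * Real.pi) (b' := min η η')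
    hF.differentiableOn (fun Z hZ =>
      (differentiableAt_cauchyLine hΦ hA' hB' hZ.1 hZ.2).differentiableWithinAt)
    (by linarith [le_max_right η η']) (min_le_right _ _) ?_ fun Z h1 h2 => ?_
  · rcases le_total η η' with h | h
    · rw [max_eq_right h, min_eq_left h]; linarith
    · rw [max_eq_left h, min_eq_right h]; linarith
  · have m1 := le_max_left η η'
    have m2 := le_max_right η η'
    have m3 := min_le_left η η'
    have m4 := min_le_right η η'
    rw [hFf Z (by linarith) (by linarith), f1 Z (by linarith)]
    exact agree _ _ hA hB hA' hB' Z (by linarith) (by linarith) (by linarith) (by linarith)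

/-! ### Hyperterminants as Cauchy transforms -/

/-- The function `exp (σ τ) τ ^ (a - 1)` in the logarithmic coordinate. -/
noncomputable def hyperPhi (S a W : ℂ) : ℂ := exp (exp (S + W) + (a - 1) * W)

theorem differentiable_hyperPhi (S a : ℂ) : Differentiable ℂ (hyperPhi S a) := by
  unfold hyperPhi
  fun_prop

theorem norm_hyperPhi (S a : ℂ) (u v : ℝ) : ‖hyperPhi S a (u + v * I)‖ =
    Real.exp (Real.exp (S.re + u) * Real.cos (S.im + v) + (a.re - 1) * u - a.im * v) := by
  rw [hyperPhi, norm_exp, add_re, exp_re]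
  congr 1
  simp
  ring

theorem exp_neg_mul_exp_le {κ : ℝ} (hκ : 0 < κ) (m : ℕ) : ∃ C : ℝ, 0 < C ∧ ∀ u : ℝ,
    Real.exp (-(κ * Real.exp u)) ≤ C * Real.exp (-(m * max u 0)) := by
  refine ⟨max 1 (m.factorial / κ ^ m), by positivity, fun u => ?_⟩
  rcases le_or_gt u 0 with h | h
  · rw [max_eq_right h, mul_zero, neg_zero, Real.exp_zero, mul_one]
    refine le_trans (Real.exp_le_one_iff.2 ?_) (le_max_left _ _)
    have := mul_pos hκ (Real.exp_pos u)
    linarith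
  · rw [max_eq_left h.le]
    refine le_trans ?_ (mul_le_mul_of_nonneg_right (le_max_right _ _) (Real.exp_pos _).le)
    have h1 := Real.pow_div_factorial_le_exp (κ * Real.exp u) (by positivity) m
    have h2 : (0 : ℝ) < (κ * Real.exp u) ^ m / m.factorial := by positivity
    rw [Real.exp_neg]
    refine (inv_anti₀ h2 h1).trans (le_of_eq ?_)
    rw [inv_div, mul_pow, ← Real.exp_nat_mul, Real.exp_neg]
    field_simp

/-- In this strip `cos (Im (S + W))` is negative, uniformly on closed substrips, so there is doubly
exponential decay to the right. The parameter `θ` records the growth tolerated to the left, where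
only `exp ((a - 1) * u)` acts. -/
theorem exists_norm_hyperPhi_le (S : ℂ) {a : ℂ} {θ : ℝ} (ha : 1 - θ < a.re) {α β : ℝ}
    (hα : Real.pi / 2 - S.im < α) (hβ : β < 3 * Real.pi / 2 - S.im) : ∃ C c : ℝ, 0 ≤ C ∧ 0 < c ∧
    ∀ u v : ℝ, α ≤ v → v ≤ β →
      ‖hyperPhi S a (u + v * I)‖ ≤ C * Real.exp (-c * |u|) * (1 + Real.exp (-(θ * u))) := by
  have hπ := Real.pi_pos
  rcases lt_or_ge β α with hαβ | hαβ
  · exact ⟨0, 1, le_rfl, one_pos, fun u v h1 h2 => absurd (h1.trans h2) (not_le.2 hαβ)⟩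
  set d := min (α - (Real.pi / 2 - S.im)) (3 * Real.pi / 2 - S.im - β) with hd
  have hd0 : 0 < d := lt_min (by linarith) (by linarith)
  have hd1 : d ≤ α - (Real.pi / 2 - S.im) := min_le_left _ _
  have hd2 : d ≤ 3 * Real.pi / 2 - S.im - β := min_le_right _ _
  have hsin : 0 < Real.sin d := Real.sin_pos_of_pos_of_lt_pi hd0 (by linarith)
  have hcos : ∀ v : ℝ, α ≤ v → v ≤ β → Real.cos (S.im + v) ≤ -Real.sin d := fun v h1 h2 => by
    have h3 : |S.im + v - Real.pi| ≤ Real.pi / 2 - d := abs_le.2 ⟨by linarith, by linarith⟩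
    have h4 := Real.cos_le_cos_of_nonneg_of_le_pi (abs_nonneg _) (by linarith) h3
    rw [Real.cos_abs, Real.cos_sub_pi, Real.cos_pi_div_two_sub] at h4
    linarith
  obtain ⟨m, hm⟩ := exists_nat_ge (a.re)
  obtain ⟨C, hC, hCb⟩ := exp_neg_mul_exp_le (κ := Real.exp S.re * Real.sin d) (by positivity) m
  set c := min 1 (a.re - 1 + θ) with hc
  have hc0 : 0 < c := lt_min one_pos (by linarith)
  have hc1 : c ≤ 1 := min_le_left _ _
  have hc2 : c ≤ a.re - 1 + θ := min_le_right _ _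
  refine ⟨C * Real.exp (|a.im| * max |α| |β|), c, by positivity, hc0, fun u v h1 h2 => ?_⟩
  rw [norm_hyperPhi]
  have e1 : -(a.im * v) ≤ |a.im| * max |α| |β| := by
    have h3 : |v| ≤ max |α| |β| := abs_le_max_abs_abs h1 h2
    have h4 := neg_abs_le (a.im * v)
    rw [abs_mul] at h4
    nlinarith [abs_nonneg a.im]
  have e2 : Real.exp (S.re + u) * Real.cos (S.im + v) ≤
      -(Real.exp S.re * Real.sin d * Real.exp u) := by
    rw [Real.exp_add]
    nlinarith [hcos v h1 h2, mul_pos (Real.exp_pos S.re) (Real.exp_pos u)]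
  have e3 : Real.exp (-(m * max u 0)) * Real.exp ((a.re - 1) * u) ≤
      Real.exp (-c * |u|) * (1 + Real.exp (-(θ * u))) := by
    rw [← Real.exp_add, mul_add, mul_one, ← Real.exp_add]
    rcases le_or_gt u 0 with h | h
    · rw [max_eq_right h, abs_of_nonpos h]
      refine le_trans (Real.exp_le_exp.2 ?_) (le_add_of_nonneg_left (Real.exp_pos _).le)
      nlinarith
    · rw [max_eq_left h.le, abs_of_pos h]
      refine le_trans (Real.exp_le_exp.2 ?_) (le_add_of_nonneg_right (Real.exp_pos _).le)
      nlinarith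
  calc _ ≤ Real.exp (-(Real.exp S.re * Real.sin d * Real.exp u)) * Real.exp ((a.re - 1) * u) *
        Real.exp (|a.im| * max |α| |β|) := by
        rw [← Real.exp_add, ← Real.exp_add]
        exact Real.exp_le_exp.2 (by linarith)
    _ ≤ C * Real.exp (-(m * max u 0)) * Real.exp ((a.re - 1) * u) *
        Real.exp (|a.im| * max |α| |β|) := by gcongr; exact hCb u
    _ = C * Real.exp (|a.im| * max |α| |β|) *
        (Real.exp (-(m * max u 0)) * Real.exp ((a.re - 1) * u)) := by ring
    _ ≤ C * Real.exp (|a.im| * max |α| |β|) *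
        (Real.exp (-c * |u|) * (1 + Real.exp (-(θ * u)))) := by gcongr
    _ = _ := by ring

theorem norm_hyperPhi_sub (S a : ℂ) (θ u v : ℝ) : ‖hyperPhi S (a - θ) (u + v * I)‖ =
    ‖hyperPhi S a (u + v * I)‖ * Real.exp (-(θ * u)) := by
  rw [norm_hyperPhi, norm_hyperPhi, ← Real.exp_add]
  congr 1
  simp
  ring

/-- A factor growing like `exp (-θ * u)` acts in size as a replacement of `a` by `a - θ`, which is
harmless while `θ < Re a`. -/
theorem stripDecay_hyperPhi_mul (S : ℂ) {a : ℂ} {θ : ℝ} (hθ : 0 ≤ θ) (ha : θ < a.re) {G : ℂ → ℂ}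
    (hG : Differentiable ℂ G) {A B : ℝ} (hA : Real.pi / 2 - S.im ≤ A)
    (hB : B ≤ 3 * Real.pi / 2 - S.im)
    (hGb : ∀ α β : ℝ, A < α → β < B → ∃ K : ℝ, 0 ≤ K ∧ ∀ u v : ℝ, α ≤ v → v ≤ β →
      ‖G (u + v * I)‖ ≤ K * (1 + Real.exp (-(θ * u)))) :
    StripDecay (fun W => hyperPhi S a W * G W) A B := by
  refine ⟨(differentiable_hyperPhi S a).mul hG, fun α β hα hβ => ?_⟩
  obtain ⟨K, hK, hKb⟩ := hGb α β hα hβ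
  obtain ⟨C₁, c₁, hC₁, hc₁, H₁⟩ := exists_norm_hyperPhi_le S (a := a) (θ := 1) (by linarith)
    (hA.trans_lt hα) (hβ.trans_le hB)
  obtain ⟨C₂, c₂, hC₂, hc₂, H₂⟩ := exists_norm_hyperPhi_le S (a := a - θ) (θ := 1)
    (by rw [sub_re, ofReal_re]; linarith) (hA.trans_lt hα) (hβ.trans_le hB)
  refine ⟨K * (C₁ + C₂), min c₁ c₂, by positivity, lt_min hc₁ hc₂, fun u v h1 h2 => ?_⟩
  have h3 := H₁ u v h1 h2
  have h4 := H₂ u v h1 h2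
  rw [norm_hyperPhi_sub] at h4
  rw [one_mul] at h3 h4
  have e0 : ∀ {c' : ℝ}, min c₁ c₂ ≤ c' → Real.exp (-c' * |u|) ≤ Real.exp (-min c₁ c₂ * |u|) :=
    fun h => Real.exp_le_exp.2 (by nlinarith [abs_nonneg u])
  rw [norm_mul]
  calc _ ≤ ‖hyperPhi S a (u + v * I)‖ * (K * (1 + Real.exp (-(θ * u)))) := by
        gcongr; exact hKb u v h1 h2
    _ = K * (‖hyperPhi S a (u + v * I)‖ + ‖hyperPhi S a (u + v * I)‖ * Real.exp (-(θ * u))) := by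
        ring
    _ ≤ K * (C₁ * Real.exp (-min c₁ c₂ * |u|) * (1 + Real.exp (-u)) +
        C₂ * Real.exp (-min c₁ c₂ * |u|) * (1 + Real.exp (-u))) := by
        refine mul_le_mul_of_nonneg_left (add_le_add (h3.trans ?_) (h4.trans ?_)) hK
        · gcongr ?_ * _; exact mul_le_mul_of_nonneg_left (e0 (min_le_left _ _)) hC₁
        · gcongr ?_ * _; exact mul_le_mul_of_nonneg_left (e0 (min_le_right _ _)) hC₂
    _ = _ := by ring

theorem stripDecay_hyperPhi (S : ℂ) {a : ℂ} (ha : 0 < a.re) :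
    StripDecay (hyperPhi S a) (Real.pi / 2 - S.im) (3 * Real.pi / 2 - S.im) := by
  refine ⟨differentiable_hyperPhi S a, fun α β hα hβ => ?_⟩
  obtain ⟨C, c, hC, hc, H⟩ := exists_norm_hyperPhi_le S (a := a) (θ := 1) (by linarith) hα hβ
  exact ⟨C, c, hC, hc, by simpa only [one_mul] using H⟩

/-- The transform inherits the growth exponent: `exp (-θ * s) = exp (-θ * u) * exp (θ * (u - s))`,
and for `0 ≤ θ ≤ 1` the last factor is absorbed by the denominator, of size `1 + exp (u - s)`. -/
theorem exists_norm_cauchyLine_le {Φ : ℂ → ℂ} {η θ C c : ℝ} (hθ0 : 0 ≤ θ) (hθ1 : θ ≤ 1)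
    (hC : 0 ≤ C) (hc : 0 < c)
    (hΦ : ∀ u : ℝ, ‖Φ (u + η * I)‖ ≤ C * Real.exp (-c * |u|) * (1 + Real.exp (-(θ * u))))
    {α β : ℝ} (hα : η - 2 * Real.pi < α) (hβ : β < η) : ∃ K : ℝ, 0 ≤ K ∧
    ∀ u v : ℝ, α ≤ v → v ≤ β → ‖cauchyLine Φ η (u + v * I)‖ ≤ K * (1 + Real.exp (-(θ * u))) := by
  obtain ⟨κ, hκ, hκb⟩ := exists_le_norm_exp_sub_one_of_im
    (show 0 < min (α - (η - 2 * Real.pi)) (η - β) from lt_min (by linarith) (by linarith))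
  have m1 := min_le_left (α - (η - 2 * Real.pi)) (η - β)
  have m2 := min_le_right (α - (η - 2 * Real.pi)) (η - β)
  refine ⟨2 * C / κ * ∫ s : ℝ, Real.exp (-c * |s|), mul_nonneg (by positivity)
    (integral_nonneg fun s => (Real.exp_pos _).le), fun u v h1 h2 => ?_⟩
  rw [mul_assoc, mul_comm (∫ s : ℝ, Real.exp (-c * |s|)), ← mul_assoc, ← integral_const_mul]
  refine norm_integral_le_of_norm_le ((integrable_exp_neg_mul_abs hc).const_mul _)
    (Eventually.of_forall fun s => ?_)
  have him : ((u : ℂ) + v * I - (s + η * I)).im = v - η := by simp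
  have hx := hκb ((u : ℂ) + v * I - (s + η * I)) (by rw [him]; linarith) (by rw [him]; linarith)
  have hre : ((u : ℂ) + v * I - (s + η * I)).re = u - s := by simp
  rw [hre] at hx
  have hpos : 0 < 1 + Real.exp (u - s) := by positivity
  have e1 : Real.exp (θ * (u - s)) ≤ 1 + Real.exp (u - s) := by
    rcases le_total (u - s) 0 with h | h
    · have : Real.exp (θ * (u - s)) ≤ 1 := Real.exp_le_one_iff.2 (by nlinarith)
      linarith [Real.exp_pos (u - s)]
    · have : Real.exp (θ * (u - s)) ≤ Real.exp (u - s) := Real.exp_le_exp.2 (by nlinarith)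
      linarith
  have e2 : 1 + Real.exp (-(θ * s)) ≤ 2 * (1 + Real.exp (-(θ * u))) * (1 + Real.exp (u - s)) := by
    have : Real.exp (-(θ * s)) = Real.exp (-(θ * u)) * Real.exp (θ * (u - s)) := by
      rw [← Real.exp_add]; congr 1; ring
    rw [this]
    nlinarith [Real.exp_pos (-(θ * u)), Real.exp_pos (u - s),
      mul_pos (Real.exp_pos (-(θ * u))) (Real.exp_pos (u - s))]
  rw [norm_div, div_le_iff₀ (lt_of_lt_of_le (by positivity) hx)]
  calc ‖Φ (s + η * I)‖ ≤ C * Real.exp (-c * |s|) *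
        (2 * (1 + Real.exp (-(θ * u))) * (1 + Real.exp (u - s))) := (hΦ s).trans (by gcongr)
    _ = 2 * C / κ * (1 + Real.exp (-(θ * u))) * Real.exp (-c * |s|) *
        (κ * (1 + Real.exp (u - s))) := by field_simp
    _ ≤ _ := by gcongr

theorem rayIntegral_eq (η : ℝ) (φ : ℝ → ℂ) :
    rayIntegral η φ = ∫ u : ℝ, φ (Real.exp u) * exp ((u : ℂ) + η * I) := by
  have h := integral_image_eq_integral_abs_deriv_smul (f := Real.exp) (f' := Real.exp)
    MeasurableSet.univ
    (fun u _ => (Real.hasDerivAt_exp u).hasDerivWithinAt) Real.exp_injective.injOn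
    (fun t => φ t * exp ((η : ℂ) * I))
  rw [image_univ, Real.range_exp, Measure.restrict_univ] at h
  rw [rayIntegral, h]
  congr 1 with u
  rw [abs_of_pos (Real.exp_pos u), real_smul, exp_add, ofReal_exp]
  ring

theorem rayPoint_exp (η u : ℝ) : rayPoint η (Real.exp u) = exp ((u : ℂ) + η * I) := by
  rw [rayPoint, ofReal_exp, exp_add]

theorem rayPower_exp (η u : ℝ) (s : ℂ) : rayPower η (Real.exp u) s = exp (s * ((u : ℂ) + η * I)) := by
  rw [rayPower, Real.log_exp]

theorem exp_mul_div_exp_sub_exp (x Z W : ℂ) :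
    x / (exp Z - exp W) * exp W = x / (exp (Z - W) - 1) := by
  have h : exp Z - exp W = (exp (Z - W) - 1) * exp W := by
    rw [sub_mul, ← exp_add]; ring_nf
  rw [h, div_mul_eq_mul_div, mul_div_mul_right _ _ (exp_ne_zero W)]

theorem hyperPhi_eq (S a W : ℂ) : exp (exp S * exp W) * exp ((a - 1) * W) = hyperPhi S a W := by
  rw [hyperPhi, ← exp_add, ← exp_add]

theorem entireContinuation_eq {U : Set ℂ} {f F : ℂ → ℂ} (hF : Differentiable ℂ F)
    (hU : EqOn F f U) {a b : ℝ} (hab : a < b) (hsub : ∀ Z : ℂ, a < Z.im → Z.im < b → Z ∈ U) :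
    entireContinuation U f = F := by
  have h := Classical.epsilon_spec (p := fun F : ℂ → ℂ => Differentiable ℂ F ∧ EqOn F f U)
    ⟨F, hF, hU⟩
  exact eq_of_eqOn_strip h.1 hF hab fun Z h1 h2 =>
    (h.2 (hsub Z h1 h2)).trans (hU (hsub Z h1 h2)).symm

/-- The substitution `τ = exp W` turns the ray integral into `cauchyLine`. All later work uses only
this: an entire function, its jump under `2 π i`, and the freedom to turn the ray. -/
theorem hyperterminantOne_spec (S : ℂ) {a : ℂ} (ha : 0 < a.re) :
    Differentiable ℂ (hyperterminantOne a S) ∧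
    (∀ Z : ℂ, hyperterminantOne a S (Z + 2 * Real.pi * I) = hyperterminantOne a S Z +
      2 * Real.pi * I * hyperPhi S a (Z + 2 * Real.pi * I)) ∧
    ∀ η : ℝ, |η - (Real.pi - S.im)| < Real.pi / 2 → ∀ Z : ℂ, η - 2 * Real.pi < Z.im → Z.im < η →
      hyperterminantOne a S Z = cauchyLine (hyperPhi S a) η Z := by
  have hπ := Real.pi_pos
  obtain ⟨F, hF, hFs, hFc⟩ := exists_cauchyLine_continuation (stripDecay_hyperPhi S ha)
    (by linarith) (by linarith)
  have hmem : ∀ Z : ℂ, Z ∈ {Z : ℂ | |(S + Z).im| < Real.pi} ↔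
      -Real.pi - S.im < Z.im ∧ Z.im < Real.pi - S.im := fun Z => by
    rw [mem_ofPred_eq, add_im, abs_lt]
    constructor <;> rintro ⟨h1, h2⟩ <;> constructor <;> linarith
  have : hyperterminantOne a S = F := by
    refine entireContinuation_eq hF (fun Z hZ => ?_) (a := -Real.pi - S.im) (b := Real.pi - S.im)
      (by linarith) fun Z h1 h2 => (hmem Z).2 ⟨h1, h2⟩
    obtain ⟨h1, h2⟩ := (hmem Z).1 hZ
    rw [hFc (Real.pi - S.im) (by linarith) (by linarith) Z (by linarith) h2]
    rw [rayIntegral_eq, cauchyLine]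
    congr 1 with u
    rw [rayPoint_exp, rayPower_exp, hyperPhi_eq, exp_mul_div_exp_sub_exp]
  rw [this]
  exact ⟨hF, hFs, fun η hη Z h1 h2 => hFc η (by linarith [(abs_lt.1 hη).1])
    (by linarith [(abs_lt.1 hη).2]) Z h1 h2⟩

/-- The exponent `θ` shares one unit of growth near `τ = 0` between the integrals: the inner
transform may grow like `exp (-θ * u)` and the outer weight must absorb it. The connection formula
uses `θ = 1` for one order and `θ = 0` for the other. -/
theorem hyperterminantTwo_spec {S₀ S₁ a b : ℂ} {η₀ η₁ θ : ℝ} (hθ0 : 0 ≤ θ) (hθ1 : θ ≤ 1)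
    (ha : θ < a.re) (hb0 : 0 < b.re) (hb : 1 - θ < b.re)
    (h0 : |η₀ - (Real.pi - S₀.im)| < Real.pi / 2)
    (h1 : |η₁ - (Real.pi - S₁.im)| < Real.pi / 2) (hη : 0 < |η₀ - η₁|)
    (hη' : |η₀ - η₁| < 2 * Real.pi) :
    Differentiable ℂ (hyperterminantTwo η₀ η₁ a b S₀ S₁) ∧
    ∀ Z : ℂ, η₀ - 2 * Real.pi < Z.im → Z.im < η₀ → hyperterminantTwo η₀ η₁ a b S₀ S₁ Z =
      ∫ u : ℝ, hyperPhi S₀ a (u + η₀ * I) / (exp (Z - (u + η₀ * I)) - 1) *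
        cauchyLine (hyperPhi S₁ b) η₁ (u + η₀ * I) := by
  have hπ := Real.pi_pos
  have h0' := abs_lt.1 h0
  have h1' := abs_lt.1 h1
  obtain ⟨hd, -, hcl⟩ := hyperterminantOne_spec S₁ hb0
  -- A shift by `s = 0` or `s = 1` periods brings the outer line into the strip where the inner
  -- integral represents `hyperterminantOne`; the kernel is periodic, so the inner integral is
  -- unaffected.
  obtain ⟨s, hs1, hs2, hs3⟩ : ∃ s : ℤ, η₁ - 2 * Real.pi < η₀ - 2 * Real.pi * s ∧
      η₀ - 2 * Real.pi * s < η₁ ∧ ∀ W : ℂ, cauchyLine (hyperPhi S₁ b) η₁ (W - 2 * Real.pi * s * I) =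
        cauchyLine (hyperPhi S₁ b) η₁ W := by
    have h2 := abs_lt.1 hη'
    rcases lt_or_gt_of_ne (sub_ne_zero.1 (abs_pos.1 hη)) with h | h
    · exact ⟨0, by push_cast; linarith, by push_cast; linarith, fun W => by simp⟩
    · refine ⟨1, by push_cast; linarith, by push_cast; linarith, fun W => ?_⟩
      rw [← cauchyLine_add_two_pi]
      congr 1
      push_cast
      ring
  set A := max (Real.pi / 2 - S₀.im) (η₁ - 2 * Real.pi + 2 * Real.pi * s) with hA
  set B := min (3 * Real.pi / 2 - S₀.im) (η₁ + 2 * Real.pi * s) with hB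
  have hA0 : A < η₀ := max_lt (by linarith) (by linarith)
  have hB0 : η₀ < B := lt_min (by linarith) (by linarith)
  have hA1 : η₁ - 2 * Real.pi + 2 * Real.pi * s ≤ A := le_max_right _ _
  have hB1 : B ≤ η₁ + 2 * Real.pi * s := min_le_right _ _
  obtain ⟨C, c, hC, hc, hCb⟩ := exists_norm_hyperPhi_le S₁ hb (α := η₁) (β := η₁) (by linarith)
    (by linarith)
  have him : ∀ W : ℂ, (W - 2 * Real.pi * s * I).im = W.im - 2 * Real.pi * s := fun W => by simp
  have hGe : ∀ W : ℂ, A < W.im → W.im < B → hyperterminantOne b S₁ (W - 2 * Real.pi * s * I) =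
      cauchyLine (hyperPhi S₁ b) η₁ W := fun W hW1 hW2 => by
    rw [hcl η₁ h1 _ (by rw [him]; linarith) (by rw [him]; linarith), hs3]
  have hdecay : StripDecay (fun W => hyperPhi S₀ a W *
      hyperterminantOne b S₁ (W - 2 * Real.pi * s * I)) A B := by
    refine stripDecay_hyperPhi_mul S₀ hθ0 ha (hd.comp (differentiable_id.sub_const _))
      (le_max_left _ _) (min_le_left _ _) fun α β hα hβ => ?_
    obtain ⟨K, hK, hKb⟩ := exists_norm_cauchyLine_le hθ0 hθ1 hC hc
      (fun u => hCb u η₁ le_rfl le_rfl) (α := α - 2 * Real.pi * s) (β := β - 2 * Real.pi * s)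
      (by linarith) (by linarith)
    refine ⟨K, hK, fun u v hv1 hv2 => ?_⟩
    have := hKb u (v - 2 * Real.pi * s) (by linarith) (by linarith)
    rw [show (u : ℂ) + ((v - 2 * Real.pi * s : ℝ) : ℂ) * I = u + v * I - 2 * Real.pi * s * I by
      push_cast; ring, hs3] at this
    simp only [Function.comp_apply, id]
    rw [hGe _ (by simp; linarith) (by simp; linarith)]
    exact this
  obtain ⟨F, hF, -, hFc⟩ := exists_cauchyLine_continuation hdecay (by linarith) (by linarith)
  have hmem : ∀ Z : ℂ, Z ∈ {Z : ℂ | |Z.im - η₀ + Real.pi| < Real.pi} ↔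
      η₀ - 2 * Real.pi < Z.im ∧ Z.im < η₀ := fun Z => by
    rw [mem_ofPred_eq, abs_lt]
    constructor <;> rintro ⟨h1, h2⟩ <;> constructor <;> linarith
  have hFe : ∀ Z : ℂ, η₀ - 2 * Real.pi < Z.im → Z.im < η₀ → F Z =
      ∫ u : ℝ, hyperPhi S₀ a (u + η₀ * I) / (exp (Z - (u + η₀ * I)) - 1) *
        cauchyLine (hyperPhi S₁ b) η₁ (u + η₀ * I) := fun Z hZ1 hZ2 => by
    rw [hFc η₀ hA0 hB0 Z hZ1 hZ2, cauchyLine]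
    congr 1 with u
    rw [hGe _ (by simpa using hA0) (by simpa using hB0)]
    ring
  have : hyperterminantTwo η₀ η₁ a b S₀ S₁ = F := by
    refine entireContinuation_eq hF (fun Z hZ => ?_) (a := η₀ - 2 * Real.pi) (b := η₀)
      (by linarith) fun Z h1 h2 => (hmem Z).2 ⟨h1, h2⟩
    obtain ⟨hZ1, hZ2⟩ := (hmem Z).1 hZ
    rw [hFe Z hZ1 hZ2]
    rw [rayIntegral_eq]
    congr 1 with u
    rw [rayIntegral_eq, cauchyLine, ← integral_const_mul, ← integral_mul_const]
    congr 1 with v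
    simp only [rayPoint_exp, rayPower_exp]
    rw [exp_add (exp S₀ * _), ← hyperPhi_eq, ← hyperPhi_eq, ← exp_mul_div_exp_sub_exp,
      ← exp_mul_div_exp_sub_exp]
    rw [← div_div]
    ring
  rw [this]
  exact ⟨hF, hFe⟩

/-! ### The connection formula -/

theorem exp_sub_one_partial_fractions {Z V W : ℂ} (h1 : exp (Z - V) - 1 ≠ 0)
    (h2 : exp (Z - W) - 1 ≠ 0) (h3 : exp (W - V) - 1 ≠ 0) (p q : ℂ) :
    p / (exp (Z - V) - 1) * (q / (exp (V - W) - 1)) =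
      p / (exp (Z - V) - 1) * (q / (exp (Z - W) - 1)) -
        p * (q / (exp (Z - W) - 1)) * (exp (W - V) - 1)⁻¹ := by
  have e1 : exp (Z - W) * exp (W - V) = exp (Z - V) := by rw [← exp_add]; ring_nf
  have e2 : exp (V - W) = (exp (W - V))⁻¹ := by rw [← exp_neg]; ring_nf
  have h4 : exp (W - V) ≠ 0 := exp_ne_zero _
  have h5 : (exp (W - V))⁻¹ - 1 ≠ 0 := by
    intro h
    apply h3
    rw [← inv_inv (exp (W - V)), sub_eq_zero.1 h, inv_one, sub_self]
  have h6 : 1 - exp (W - V) ≠ 0 := by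
    intro h
    apply h3
    linear_combination -h
  rw [e2]
  rw [← e1] at h1 ⊢
  field_simp
  ring

/-- The two double integrals share an initial strip because the directions differ by less than `2
π`. There the partial fractions turn one into the product minus the other, and both sides are
entire. -/
theorem hyperterminantTwo_add_flip {S₀ S₁ a b : ℂ} {η₀ η₁ : ℝ} (ha : 1 < a.re) (hb : 0 < b.re)
    (h0 : |η₀ - (Real.pi - S₀.im)| < Real.pi / 2)
    (h1 : |η₁ - (Real.pi - S₁.im)| < Real.pi / 2) (hη : 0 < |η₀ - η₁|)
    (hη' : |η₀ - η₁| < 2 * Real.pi) (Z : ℂ) :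
    hyperterminantTwo η₀ η₁ a b S₀ S₁ Z + hyperterminantTwo η₁ η₀ b a S₁ S₀ Z =
      hyperterminantOne a S₀ Z * hyperterminantOne b S₁ Z := by
  have hπ := Real.pi_pos
  obtain ⟨d1, e1⟩ := hyperterminantTwo_spec zero_le_one le_rfl ha hb (by linarith) h0 h1 hη hη'
  obtain ⟨d2, e2⟩ := hyperterminantTwo_spec (S₀ := S₁) (S₁ := S₀) le_rfl zero_le_one hb
    (zero_lt_one.trans ha) (by linarith) h1 h0 (by rwa [abs_sub_comm]) (by rwa [abs_sub_comm])
  obtain ⟨d3, -, e3⟩ := hyperterminantOne_spec S₀ (zero_lt_one.trans ha)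
  obtain ⟨d4, -, e4⟩ := hyperterminantOne_spec S₁ hb
  have hab := abs_lt.1 hη'
  refine congrFun (eq_of_eqOn_strip (d1.add d2) (d3.mul d4)
    (a := max η₀ η₁ - 2 * Real.pi) (b := min η₀ η₁) ?_ fun Z hZ1 hZ2 => ?_) Z
  · rw [lt_min_iff, sub_lt_iff_lt_add, sub_lt_iff_lt_add, max_lt_iff, max_lt_iff]
    exact ⟨⟨by linarith, by linarith⟩, by linarith, by linarith⟩
  have z1 := (sub_le_sub_right (le_max_left η₀ η₁) _).trans_lt hZ1
  have z2 := (sub_le_sub_right (le_max_right η₀ η₁) _).trans_lt hZ1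
  have z3 := hZ2.trans_le (min_le_left η₀ η₁)
  have z4 := hZ2.trans_le (min_le_right η₀ η₁)
  have h0' := abs_lt.1 h0
  have h1' := abs_lt.1 h1
  obtain ⟨κ, hκ, hκb⟩ := exists_le_norm_exp_sub_one hη (sub_pos.2 hη')
  have hker : ∀ u v : ℝ, κ ≤ ‖exp ((v + η₁ * I) - (u + η₀ * I)) - 1‖ := fun u v => by
    have him : ((v + η₁ * I : ℂ) - (u + η₀ * I)).im = η₁ - η₀ := by simp
    refine le_trans ?_ (hκb _ ?_ ?_)
    · nlinarith [Real.exp_pos ((v + η₁ * I : ℂ) - (u + η₀ * I)).re]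
    · rw [him, abs_sub_comm]
      linarith
    · rw [abs_sub_comm, ← him]
      exact abs_im_le_norm _
  have n0 : ∀ u : ℝ, exp (Z - (u + η₀ * I)) - 1 ≠ 0 := fun u => by
    apply exp_sub_one_ne_zero_of_im <;> rw [sub_linePoint_im] <;> linarith
  have n1 : ∀ u : ℝ, exp (Z - (u + η₁ * I)) - 1 ≠ 0 := fun u => by
    apply exp_sub_one_ne_zero_of_im <;> rw [sub_linePoint_im] <;> linarith
  have n2 : ∀ u v : ℝ, exp ((v + η₁ * I) - (u + η₀ * I)) - 1 ≠ 0 := fun u v =>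
    norm_pos_iff.1 (hκ.trans_le (hker u v))
  have i0 := integrable_cauchyLine (stripDecay_hyperPhi S₀ (zero_lt_one.trans ha)) (η := η₀)
    (by linarith) (by linarith) z1 z3
  have i1 := integrable_cauchyLine (stripDecay_hyperPhi S₁ hb) (η := η₁)
    (by linarith) (by linarith) z2 z4
  have i2 : Integrable fun u : ℝ => hyperPhi S₀ a (u + η₀ * I) := by
    obtain ⟨C, c, hC, hc, H⟩ := exists_norm_hyperPhi_le S₀ (a := a) (θ := 0) (by linarith)
      (α := η₀) (β := η₀) (by linarith) (by linarith)
    refine ((integrable_exp_neg_mul_abs hc).const_mul (C * 2)).mono'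
      ((differentiable_hyperPhi S₀ a).continuous.comp
        (continuous_linePoint η₀)).aestronglyMeasurable (Eventually.of_forall fun u => ?_)
    refine (H u η₀ le_rfl le_rfl).trans (le_of_eq ?_)
    rw [zero_mul, neg_zero, Real.exp_zero]
    ring
  have j1 := i0.mul_prod i1
  -- Fubini is legitimate since the mixed kernel is bounded: the lines are a positive distance, less
  -- than a full period, apart. Integrability of the bare `hyperPhi S₀ a` is where `1 < Re a`
  -- enters.
  have j2 : Integrable (fun p : ℝ × ℝ => hyperPhi S₀ a (p.1 + η₀ * I) *
      (hyperPhi S₁ b (p.2 + η₁ * I) / (exp (Z - (p.2 + η₁ * I)) - 1)) *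
      (exp ((p.2 + η₁ * I) - (p.1 + η₀ * I)) - 1)⁻¹) (volume.prod volume) := by
    refine (i2.mul_prod i1).mul_bdd (c := κ⁻¹) ?_ (Eventually.of_forall fun p => ?_)
    · refine Continuous.aestronglyMeasurable (Continuous.inv₀ (by fun_prop) fun p => n2 _ _)
    · rw [norm_inv]
      exact inv_anti₀ hκ (hker _ _)
  have k1 : hyperterminantTwo η₀ η₁ a b S₀ S₁ Z = ∫ u : ℝ, ∫ v : ℝ,
      (hyperPhi S₀ a (u + η₀ * I) / (exp (Z - (u + η₀ * I)) - 1) *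
        (hyperPhi S₁ b (v + η₁ * I) / (exp (Z - (v + η₁ * I)) - 1)) -
      hyperPhi S₀ a (u + η₀ * I) *
        (hyperPhi S₁ b (v + η₁ * I) / (exp (Z - (v + η₁ * I)) - 1)) *
        (exp ((v + η₁ * I) - (u + η₀ * I)) - 1)⁻¹) := by
    rw [e1 Z z1 z3]
    congr 1 with u
    rw [cauchyLine, ← integral_const_mul]
    congr 1 with v
    exact exp_sub_one_partial_fractions (n0 u) (n1 v) (n2 u v) _ _
  have k2 : hyperterminantTwo η₁ η₀ b a S₁ S₀ Z = ∫ u : ℝ, ∫ v : ℝ,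
      hyperPhi S₀ a (u + η₀ * I) *
        (hyperPhi S₁ b (v + η₁ * I) / (exp (Z - (v + η₁ * I)) - 1)) *
        (exp ((v + η₁ * I) - (u + η₀ * I)) - 1)⁻¹ := by
    rw [e2 Z z2 z4, integral_integral_swap j2]
    congr 1 with v
    rw [cauchyLine, ← integral_const_mul]
    congr 1 with u
    ring
  rw [Pi.add_apply, Pi.mul_apply, k1, k2, e3 η₀ h0 Z z1 z3, e4 η₁ h1 Z z2 z4, cauchyLine,
    cauchyLine, ← integral_prod_mul]
  refine (congrArg₂ (· + ·) (integral_prod _ (j1.sub j2)).symm (integral_prod _ j2).symm).trans ?_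
  rw [integral_sub' j1 j2]
  exact sub_add_cancel _ _

/-! ### Uniform expansion of the first hyperterminant and conclusion -/

/-- Differentiating the identity of `deriv_deriv_tau_mul` at 0 gives `x = 1 - 2 * x` for the value
sought. It is the source of the `I / 3` in `gZero 0`. -/
theorem deriv_deriv_tau_zero : deriv (deriv tau) 0 = 1 / 3 := by
  have h0 := zero_mem_logStrip
  have d1 := hasDerivAt_deriv_tau h0
  have d2 : HasDerivAt (deriv (deriv tau)) (deriv (deriv (deriv tau)) 0) 0 :=
    (((differentiableOn_deriv_tau.deriv isOpen_logStrip) 0 h0).differentiableAt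
      (isOpen_logStrip.mem_nhds h0)).hasDerivAt
  have h1 : HasDerivAt (fun w => deriv (deriv tau) w * (exp w - 1)) (deriv (deriv tau) 0) 0 :=
    (d2.mul ((hasDerivAt_exp 0).sub_const 1)).congr_deriv (by simp)
  have h2 : HasDerivAt (fun w => deriv (deriv tau) w * (exp w - 1))
      (1 - 2 * deriv (deriv tau) 0) 0 := by
    refine ((d1.mul ((hasDerivAt_exp 0).sub (d1.pow 2))).congr_deriv ?_).congr_of_eventuallyEq ?_
    · simp [deriv_tau_zero]
    · filter_upwards [isOpen_logStrip.mem_nhds h0] with x hx using deriv_deriv_tau_mul hx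
  linear_combination (1 / 3 : ℂ) * h1.unique h2

theorem gZero_of_ne {l : ℂ} (h0 : l ≠ 0) : gZero l = -I * (1 / (exp l - 1) - 1 / tau l) := by
  have e1 : aZero l = I * (exp l - 1) := by rw [aZero]; ring
  rw [gZero, if_neg h0, alphaZero_eq, e1, one_div, one_div, mul_inv, mul_inv, inv_I]
  ring

theorem continuousAt_gZero {l : ℂ} (hl : l ∈ logStrip) : ContinuousAt gZero l := by
  by_cases h0 : l = 0
  · subst h0
    have t1 := hasDerivAt_iff_tendsto_slope.1 (hasDerivAt_deriv_tau hl)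
    have t2 := hasDerivAt_iff_tendsto_slope.1 hasDerivAt_tau_zero
    have t3 : Tendsto (deriv tau) (𝓝[≠] 0) (𝓝 1) := by
      have := (hasDerivAt_deriv_tau hl).continuousAt.tendsto
      rw [deriv_tau_zero] at this
      exact this.mono_left nhdsWithin_le_nhds
    rw [continuousAt_iff_punctured_nhds]
    have h := (t1.div (t2.mul t3) (by simp)).const_mul I
    rw [deriv_deriv_tau_zero] at h
    -- Near 0, `gZero = I * (tau' - 1) / (tau * tau')`, whose limit is `I * tau'' 0`.
    have e : I * (1 / 3 / (1 * 1)) = gZero 0 := by rw [gZero, if_pos rfl]; ring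
    rw [e] at h
    refine h.congr' ?_
    filter_upwards [self_mem_nhdsWithin, mem_nhdsWithin_of_mem_nhds (isOpen_logStrip.mem_nhds hl)]
      with x hx0 hx
    have hx0 : x ≠ 0 := hx0
    have n1 := tau_ne_zero hx hx0
    have n2 := deriv_tau_ne_zero hx
    rw [gZero_of_ne hx0, ← tau_mul_deriv hx]
    simp only [Pi.div_apply, slope_def_field, deriv_tau_zero, tau_zero, sub_zero]
    field_simp
    ring
  · have h1 : ContinuousAt (fun l => -I * (1 / (exp l - 1) - 1 / tau l)) l := by
      refine continuousAt_const.mul ((continuousAt_const.div ?_ ?_).sub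
        (continuousAt_const.div (differentiableAt_tau hl).continuousAt (tau_ne_zero hl h0)))
      · fun_prop
      · exact sub_ne_zero.2 (exp_ne_one_of_mem_logStrip hl h0)
    refine h1.congr ?_
    filter_upwards [isOpen_ne.mem_nhds h0] with x hx using (gZero_of_ne hx).symm

theorem regKernel_zero {l : ℂ} (hl : l ∈ logStrip) (h0 : l ≠ 0) :
    regKernel l 0 = I * gZero l := by
  rw [regKernel_of_ne hl h0.symm, gZero_of_ne h0, sub_zero, deriv_tau_zero, tau_zero, sub_zero,
    ← mul_assoc, mul_neg, I_mul_I, neg_neg, one_mul]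

theorem hyperPhi_saddle {N S : ℂ} (hN : N ≠ 0) (w : ℂ) :
    hyperPhi S (N + 1) (log N + Real.pi * I - S + w) =
      exp (N * (log N + Real.pi * I - S) - N) * exp (-N * phase w) := by
  have h : exp (S + (log N + Real.pi * I - S + w)) = -N * exp w := by
    rw [show S + (log N + Real.pi * I - S + w) = log N + Real.pi * I + w by ring, exp_add, exp_add,
      exp_log hN, exp_pi_mul_I]
    ring
  rw [hyperPhi, h, ← exp_add, phase]
  congr 1
  ring

/-- The horizontal line through the saddle has direction `π - arg σ + arg N`, admissible because
`|arg N| < π / 2`; a real translation puts the saddle at `u = 0`. -/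
theorem cauchyLine_saddle {N S : ℂ} (hN : N ≠ 0) (Z : ℂ) :
    cauchyLine (hyperPhi S (N + 1)) (log N + Real.pi * I - S).im Z =
      exp (N * (log N + Real.pi * I - S) - N) *
        ∫ u : ℝ, exp (-N * phase u) / (exp (logRatio N S Z - u) - 1) := by
  rw [cauchyLine, ← integral_add_right_eq_self _ (log N + Real.pi * I - S).re,
    ← integral_const_mul]
  congr 1 with u
  have e : ((u + (log N + Real.pi * I - S).re : ℝ) : ℂ) + (log N + Real.pi * I - S).im * I =
      log N + Real.pi * I - S + u := by
    conv_rhs => rw [← re_add_im (log N + Real.pi * I - S)]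
    push_cast
    ring
  rw [e, hyperPhi_saddle hN, mul_div_assoc,
    show Z - (log N + Real.pi * I - S + u) = logRatio N S Z - u by rw [logRatio]; ring]

theorem hyperterminantOne_saddle {N S Z : ℂ} (hN : 1 ≤ N.re) {d : ℝ} (hd : 0 < d) (hd1 : d ≤ 1)
    (hl : |(logRatio N S Z).im| ≤ 2 * Real.pi - d) (hl0 : (logRatio N S Z).im ≠ 0) {B : ℝ}
    (hB : ∀ u : ℝ, ‖regKernel (logRatio N S Z) u‖ ≤ B) :
    hyperterminantOne (N + 1) S Z = exp (N * (log N + Real.pi * I - S) - N) *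
      (Real.pi * I * exp (-N * phase (logRatio N S Z)) *
          cerfc (alphaZero (logRatio N S Z) * (N / 2) ^ (1 / 2 : ℂ)) +
        ∫ u : ℝ, exp (-N * phase u) * regKernel (logRatio N S Z) u) := by
  have hN0 : N ≠ 0 := by rintro rfl; simp at hN; linarith
  have hNp : 0 < N.re := by linarith
  have hls : logRatio N S Z ∈ logStrip := by rw [mem_logStrip]; linarith
  have hlim : (logRatio N S Z).im = Z.im - (log N + Real.pi * I - S).im := by
    rw [← sub_im, logRatio]
    congr 1
    ring
  have hη : |(log N + Real.pi * I - S).im - (Real.pi - S.im)| < Real.pi / 2 := by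
    have : (log N + Real.pi * I - S).im - (Real.pi - S.im) = N.arg := by simp [log_im]
    rw [this]
    exact abs_arg_lt_pi_div_two_iff.2 (Or.inl hNp)
  obtain ⟨-, hs, hc⟩ := hyperterminantOne_spec S (a := N + 1) (by simp; linarith)
  have hli := cauchyLine_saddle hN0 Z (S := S)
  rw [integral_exp_neg_mul_phase_div hN hd hd1 hl hl0 hB] at hli
  have htau : exp (-(N / 2) * tau (logRatio N S Z) ^ 2) = exp (-N * phase (logRatio N S Z)) := by
    rw [tau_sq hls]
    congr 1
    ring
  have hl' := abs_le.1 hl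
  rw [alphaZero_eq]
  rcases lt_or_gt_of_ne hl0 with h | h
  · rw [integral_gaussian_div_sub hNp (tau_im_neg hls h), htau] at hli
    rw [← hli]
    exact hc _ hη Z (by linarith) (by linarith)
  -- Here `Z` is above the line. The continuation contributes `2 π i` times `hyperPhi` at `Z`, which
  -- cancels the `-2` beside `cerfc`, so the formula is the same as below the line.
  · rw [integral_gaussian_div_sub' hNp (tau_im_pos hls h), htau] at hli
    have e : Z - 2 * Real.pi * I + 2 * Real.pi * I = Z := by ring
    have him : (Z - 2 * Real.pi * I).im = Z.im - 2 * Real.pi := by simp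
    have h1 := hs (Z - 2 * Real.pi * I)
    have h2 := cauchyLine_add_two_pi (hyperPhi S (N + 1)) (log N + Real.pi * I - S).im
      (Z - 2 * Real.pi * I)
    have h3 := hyperPhi_saddle (S := S) hN0 (logRatio N S Z)
    rw [show log N + Real.pi * I - S + logRatio N S Z = Z by rw [logRatio]; ring] at h3
    rw [e] at h1 h2
    rw [h1, hc _ hη _ (by rw [him]; linarith) (by rw [him]; linarith), ← h2, hli, h3]
    ring

theorem exists_norm_hyperterminantOne_sub_le {d : ℝ} (hd : 0 < d) (hd1 : d ≤ 1) :
    ∃ C : ℝ, ∀ N S Z : ℂ, 1 ≤ N.re → |(logRatio N S Z).im| ≤ 2 * Real.pi - d →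
      ‖hyperterminantOne (N + 1) S Z - exp (N * (log N + Real.pi * I - S) - N) *
        (Real.pi * I * exp (-N * phase (logRatio N S Z)) *
            cerfc (alphaZero (logRatio N S Z) * (N / 2) ^ (1 / 2 : ℂ)) +
          I * gZero (logRatio N S Z) * (2 * Real.pi / N) ^ (1 / 2 : ℂ))‖ ≤
      C * ‖N‖ ^ (-(3 / 2) : ℝ) * ‖exp (N * (log N + Real.pi * I - S) - N)‖ := by
  obtain ⟨ρ, B, hρ, hρd, hB, HB⟩ := exists_norm_regKernel_le hd hd1
  obtain ⟨C, hC, HC⟩ := exists_norm_integral_exp_neg_mul_phase_sub_le hρ (by linarith)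
  have key : ∀ N S Z : ℂ, 1 ≤ N.re → |(logRatio N S Z).im| ≤ 2 * Real.pi - d →
      (logRatio N S Z).im ≠ 0 →
      ‖hyperterminantOne (N + 1) S Z - exp (N * (log N + Real.pi * I - S) - N) *
        (Real.pi * I * exp (-N * phase (logRatio N S Z)) *
            cerfc (alphaZero (logRatio N S Z) * (N / 2) ^ (1 / 2 : ℂ)) +
          I * gZero (logRatio N S Z) * (2 * Real.pi / N) ^ (1 / 2 : ℂ))‖ ≤
      C * B * ‖N‖ ^ (-(3 / 2) : ℝ) * ‖exp (N * (log N + Real.pi * I - S) - N)‖ := by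
    intro N S Z hN hl hl0
    have hls : logRatio N S Z ∈ logStrip := by rw [mem_logStrip]; linarith
    have h := HC (regKernel (logRatio N S Z)) B N hN (fun w hw =>
      (differentiableAt_regKernel hd hd1 hl
        (lt_of_lt_of_le hw (by linarith))).differentiableWithinAt)
      (fun w hw => HB _ w hl (le_of_lt hw))
    rw [regKernel_zero hls (fun h0 => hl0 (by rw [h0, zero_im]))] at h
    rw [hyperterminantOne_saddle hN hd hd1 hl hl0 (fun u => HB _ u hl (by simpa using hρ.le)),
      ← mul_sub, add_sub_add_left_eq_sub, norm_mul, mul_comm]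
    gcongr
  refine ⟨C * B, fun N S Z hN hl => ?_⟩
  -- When the pole lies on the line itself the integral representation is lost, but both sides are
  -- continuous in `Z` and the constant is uniform; the bound passes to the limit along `Z - t * I`,
  -- `t → 0+`.
  by_cases hl0 : (logRatio N S Z).im = 0
  swap
  · exact key N S Z hN hl hl0
  have hls : logRatio N S Z ∈ logStrip := by rw [mem_logStrip]; linarith
  have him : ∀ t : ℝ, (logRatio N S (Z - t * I)).im = -t := fun t => by
    have : logRatio N S (Z - t * I) = logRatio N S Z - t * I := by rw [logRatio, logRatio]; ring
    rw [this, sub_im, hl0]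
    simp
  have cR : Continuous fun Z => logRatio N S Z := by
    unfold logRatio
    fun_prop
  have cF : Continuous (hyperterminantOne (N + 1) S) :=
    (hyperterminantOne_spec S (a := N + 1) (by simp; linarith)).1.continuous
  have cα : ContinuousAt (fun Z => alphaZero (logRatio N S Z)) Z :=
    ContinuousAt.comp (f := fun Z => logRatio N S Z)
      ((alphaZero_spec.1.continuousOn).continuousAt (isOpen_logStrip.mem_nhds hls)) cR.continuousAt
  have cg : ContinuousAt (fun Z => gZero (logRatio N S Z)) Z :=
    ContinuousAt.comp (f := fun Z => logRatio N S Z) (continuousAt_gZero hls) cR.continuousAt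
  have cp : Continuous fun Z => phase (logRatio N S Z) := differentiable_phase.continuous.comp cR
  have ce : ContinuousAt (fun Z => cerfc (alphaZero (logRatio N S Z) * (N / 2) ^ (1 / 2 : ℂ))) Z :=
    ContinuousAt.comp (f := fun Z => alphaZero (logRatio N S Z) * (N / 2) ^ (1 / 2 : ℂ))
      continuous_cerfc.continuousAt (cα.mul continuousAt_const)
  have cE : Continuous fun Z => exp (-N * phase (logRatio N S Z)) := by fun_prop
  have ct : Tendsto (fun t : ℝ => Z - t * I) (𝓝[>] 0) (𝓝 Z) := by
    have : Continuous fun t : ℝ => Z - t * I := by fun_prop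
    have := (this.tendsto 0).mono_left (nhdsWithin_le_nhds (s := Ioi 0))
    simpa using this
  have hcont : ContinuousAt (fun Z => ‖hyperterminantOne (N + 1) S Z -
      exp (N * (log N + Real.pi * I - S) - N) *
        (Real.pi * I * exp (-N * phase (logRatio N S Z)) *
            cerfc (alphaZero (logRatio N S Z) * (N / 2) ^ (1 / 2 : ℂ)) +
          I * gZero (logRatio N S Z) * (2 * Real.pi / N) ^ (1 / 2 : ℂ))‖) Z :=
    (cF.continuousAt.sub (continuousAt_const.mul (((continuousAt_const.mul cE.continuousAt).mul
      ce).add ((continuousAt_const.mul cg).mul continuousAt_const)))).norm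
  refine le_of_tendsto (hcont.tendsto.comp ct) ?_
  filter_upwards [Ioo_mem_nhdsGT (zero_lt_one' ℝ)] with t ht
  refine key N S _ hN ?_ ?_
  · rw [him, abs_neg, abs_of_pos ht.1]
    linarith [ht.2, Real.pi_gt_three]
  · rw [him]
    exact neg_ne_zero.2 ht.1.ne'

theorem exp_mul_exp_logRatio {N : ℂ} (hN : N ≠ 0) (S Z : ℂ) :
    N * exp (logRatio N S Z) = -(exp S * exp Z) := by
  rw [logRatio, exp_sub, exp_sub, exp_add, exp_log hN, exp_pi_mul_I]
  field_simp

theorem exp_saddle_eq {N : ℂ} (hN : N ≠ 0) {S Z : ℂ} (hl : logRatio N S Z ∈ logStrip) :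
    exp (N * (log N + Real.pi * I - S) - N) =
      exp (-(alphaZero (logRatio N S Z) ^ 2 / 2) * N) * exp (exp S * exp Z) * exp (N * Z) := by
  rw [alphaZero_spec.2.1 _ hl, ← exp_add, ← exp_add]
  congr 1
  have h := exp_mul_exp_logRatio hN S Z
  have h2 : Z = logRatio N S Z + (log N + Real.pi * I - S) := by rw [logRatio]; ring
  linear_combination -h - N * h2

theorem exp_saddle_mul_exp_phase {N : ℂ} (hN : N ≠ 0) (S Z : ℂ) :
    exp (N * (log N + Real.pi * I - S) - N) * exp (-N * phase (logRatio N S Z)) =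
      exp (exp S * exp Z) * exp (N * Z) := by
  rw [← exp_add, ← exp_add, phase]
  congr 1
  have h := exp_mul_exp_logRatio hN S Z
  have h2 : Z = logRatio N S Z + (log N + Real.pi * I - S) := by rw [logRatio]; ring
  linear_combination -h - N * h2

theorem mainTheorem6 (δ : ℝ) (hδ : 0 < δ) :
    ∃ C R : ℝ, 0 < R ∧
      ∀ (N₀ N₁ S₀ S₁ Z : ℂ) (η₀ η₁ : ℝ),
        R ≤ N₀.re → -1 < N₁.re →
        |η₀ - (Real.pi - S₀.im)| < Real.pi / 2 →
        |η₁ - (Real.pi - S₁.im)| < Real.pi / 2 →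
        0 < |η₀ - η₁| → |η₀ - η₁| < 2 * Real.pi →
        |(logRatio N₀ S₀ Z).im| ≤ 2 * Real.pi - δ →
        ‖hyperterminantTwo η₀ η₁ (N₀ + 1) (N₁ + 1) S₀ S₁ Z -
            (Real.pi * I * exp (exp S₀ * exp Z) * exp (N₀ * Z) *
                cerfc (alphaZero (logRatio N₀ S₀ Z) * (N₀ / 2) ^ (1 / 2 : ℂ)) *
                hyperterminantOne (N₁ + 1) S₁ Z +
              I * (2 * Real.pi / N₀) ^ (1 / 2 : ℂ) * gZero (logRatio N₀ S₀ Z) *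
                exp (-(alphaZero (logRatio N₀ S₀ Z) ^ 2 / 2) * N₀) *
                exp (exp S₀ * exp Z) * exp (N₀ * Z) *
                hyperterminantOne (N₁ + 1) S₁ Z -
              hyperterminantTwo η₁ η₀ (N₁ + 1) (N₀ + 1) S₁ S₀ Z)‖ ≤
          C * (‖N₀‖ ^ (-(3 / 2) : ℝ) *
            ‖exp (-(alphaZero (logRatio N₀ S₀ Z) ^ 2 / 2) * N₀) *
              exp (exp S₀ * exp Z) * exp (N₀ * Z) *
              hyperterminantOne (N₁ + 1) S₁ Z‖) := by
  have hd : 0 < min δ 1 := lt_min hδ one_pos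
  obtain ⟨C, HC⟩ := exists_norm_hyperterminantOne_sub_le hd (min_le_right _ _)
  -- The expansion is already uniform for `1 ≤ Re N₀`, so `R = 1` serves for every `δ`.
  refine ⟨C, 1, one_pos, fun N₀ N₁ S₀ S₁ Z η₀ η₁ h0 h1 hη0 hη1 hη hη' hl => ?_⟩
  have hN : N₀ ≠ 0 := by rintro rfl; simp at h0; linarith
  have hl' : |(logRatio N₀ S₀ Z).im| ≤ 2 * Real.pi - min δ 1 := by
    linarith [min_le_left δ 1]
  have hls : logRatio N₀ S₀ Z ∈ logStrip := by rw [mem_logStrip]; linarith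
  have hflip := hyperterminantTwo_add_flip (a := N₀ + 1) (b := N₁ + 1) (by simp; linarith)
    (by simp; linarith) hη0 hη1 hη hη' Z
  have h := mul_le_mul_of_nonneg_right (HC N₀ S₀ Z h0 hl')
    (norm_nonneg (hyperterminantOne (N₁ + 1) S₁ Z))
  have hP := exp_saddle_eq hN hls
  have hQ := exp_saddle_mul_exp_phase hN S₀ Z
  rw [← norm_mul, mul_assoc (C * _), ← norm_mul, mul_assoc C, hP] at h
  rw [hP] at hQ
  refine le_of_eq_of_le (congrArg norm ?_) h
  -- The connection formula replaces the two second hyperterminants by the product; `hQ` identifies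
  -- the saddle prefactor times `exp (-N₀ * phase)` with `exp (σ₀ z) * z ^ N₀` in the `erfc` term.
  linear_combination hflip + Real.pi * I *
    cerfc (alphaZero (logRatio N₀ S₀ Z) * (N₀ / 2) ^ (1 / 2 : ℂ)) *
    hyperterminantOne (N₁ + 1) S₁ Z * hQ
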